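/- Let $T$ be the infinite ordered rooted binary tree (every vertex has a left child and a right child), and let $\mathrm{QAut}(\mathcal T_{2,c})$ be the group, under composition, of all bijections $h$ of the vertex set of $T$ such that (1) $h$ preserves adjacency with at most finitely many exceptions, and (2) with at most finitely many exceptional vertices $v$, $h$ preserves the left-right order of the edges incident with and below $v$ (that is, $h$ maps the left and right child of $v$ to the left and right child of $h(v)$, respectively). Let $\mathcal P=\langle a,x\mid (x,\,xax)\rangle$. For a nonempty word $w$, let $D_b(\mathcal P,w)$ be the braided diagram group over $\mathcal P$ based at $w$: its elements are the braided $(w,w)$-diagrams over $\mathcal P$ modulo equivalence of diagrams and insertion and reduction of dipoles, and its multiplication is induced by concatenation of diagrams. Then: (i) $\mathrm{QAut}(\mathcal T_{2,c})\cong D_b(\mathcal P,x)$. (ii) $\mathcal P$ is a tree-like semigroup presentation: every relation $(w_1,w_2)$ of $\mathcal P$ satisfies $|w_1|=1$ and $|w_2|>1$, and no letter is the left side of two different relations. (iii) $\mathrm{QAut}(\mathcal T_{2,c})$ is an FSS group, determined by a small similarity structure: there are a compact ultrametric space $X$ and a finite similarity structure $\mathrm{Sim}_X$ on $X$ with $|\mathrm{Sim}_X(B_1,B_2)|\le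 1$ for all balls $B_1,B_2\subseteq X$ such that $\mathrm{QAut}(\mathcal T_{2,c})\cong\Gamma(\mathrm{Sim}_X)$. Here a finite similarity structure assigns to each ordered pair of balls $B_1,B_2$ of $X$ a finite, possibly empty, set $\mathrm{Sim}_X(B_1,B_2)$ of surjective similarities $B_1\to B_2$, such that these sets contain the identities and are closed under inverses, compositions and restrictions to subballs; and $\Gamma(\mathrm{Sim}_X)$ is the group of all homeomorphisms $h$ of $X$ such that every point of $X$ lies in a ball $B$ for which $h(B)$ is a ball and $h|_B\in\mathrm{Sim}_X(B,h(B))$. -/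

import Mathlib

/-! ### Semigroup presentations -/

/-- A semigroup presentation over the alphabet `A`: a set of ordered pairs of nonempty words. -/
structure SemigroupPresentation (A : Type*) where
  rels : Set (List A × List A)
  nonempty_words : ∀ r ∈ rels, r.1 ≠ [] ∧ r.2 ≠ []

/-- A presentation is tree-like if every relation is of the form `(a, w)` with `a` a letter and
`|w| > 1`, and no letter is the left side of two relations. -/
def SemigroupPresentation.IsTreeLike {A : Type*} (P : SemigroupPresentation A) : Prop :=
  (∀ r ∈ P.rels, r.1.length = 1 ∧ 1 < r.2.length) ∧
  ∀ (a : A) (w₁ w₂ : List A), ([a], w₁) ∈ P.rels → ([a], w₂) ∈ P.rels → w₁ = w₂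

/-! ### Braided diagrams

Diagrams are considered up to homeomorphisms that respect labels, tops and bottoms, and left to
right orders, so a diagram is recorded by its combinatorial data: the finite set of transistors,
and for every wire the places where its two ends are attached. -/

/-- A contact: `(some t, i)` is the `i`-th contact (counted from the left, starting at `0`) on one
side of the transistor `t`, and `(none, i)` is the `i`-th contact on one side of the frame. -/
abbrev Contact (T : Type) := Option T × ℕ

/-- Relabelling of transistors. -/
def Contact.map {T T' : Type} (f : T → T') (c : Contact T) : Contact T' := (c.1.map f, c.2)

/-- A wire with its label and its contacts. Its top end is attached to the *bottom* side of a
transistor or to the top side of the frame, its bottom end to the *top* side of a transistor or to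
the bottom side of the frame. -/
@[ext] structure Wire (T : Type) (A : Type*) where
  top : Contact T
  label : A
  bot : Contact T

/-- Relabelling of transistors. -/
def Wire.map {T T' : Type} {A : Type*} (f : T → T') (W : Wire T A) : Wire T' A :=
  ⟨W.top.map f, W.label, W.bot.map f⟩

/-- `Below wires t₁ t₂`: some wire leads from the bottom of `t₂` to the top of `t₁`. -/
def Below {T : Type} {A : Type*} (wires : Set (Wire T A)) (t₁ t₂ : T) : Prop :=
  ∃ W ∈ wires, W.top.1 = some t₂ ∧ W.bot.1 = some t₁

/-- A braided `(u, v)`-diagram over the semigroup presentation `P`. -/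
structure BraidedDiagram {A : Type*} (P : SemigroupPresentation A) (u v : List A) where
  /-- the transistors -/
  T : Type
  finite : Finite T
  /-- the wires; a wire is determined by its label and contacts in view of `top_inj` -/
  wires : Set (Wire T A)
  nonempty : wires.Nonempty
  /-- the label of the top side of a transistor -/
  topLabel : T → List A
  /-- the label of the bottom side of a transistor -/
  botLabel : T → List A
  /-- distinct wires have distinct top contacts -/
  top_inj : ∀ W ∈ wires, ∀ W' ∈ wires, W.top = W'.top → W = W'
  /-- distinct wires have distinct bottom contacts -/
  bot_inj : ∀ W ∈ wires, ∀ W' ∈ wires, W.bot = W'.bot → W = W'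
  /-- reading the wires along the top of the frame gives `u`, and reading them along the bottom of
  a transistor gives its bottom label -/
  read_top : ∀ (o : Option T) (i : ℕ) (a : A),
    (o.elim u botLabel)[i]? = some a ↔ ∃ W ∈ wires, W.top = (o, i) ∧ W.label = a
  /-- reading the wires along the bottom of the frame gives `v`, and reading them along the top of
  a transistor gives its top label -/
  read_bot : ∀ (o : Option T) (i : ℕ) (a : A),
    (o.elim v topLabel)[i]? = some a ↔ ∃ W ∈ wires, W.bot = (o, i) ∧ W.label = a
  /-- the top and bottom labels of a transistor are the two sides of a relation -/
  rel : ∀ t, (topLabel t, botLabel t) ∈ P.rels ∨ (botLabel t, topLabel t) ∈ P.rels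
  /-- the transitive closure of `Below` is a strict partial order -/
  acyclic : ∀ t, ¬ Relation.TransGen (Below wires) t t

namespace BraidedDiagram

variable {A : Type*} {P : SemigroupPresentation A} {u v w : List A}

/-! #### Concatenation -/

/-- The wires of the concatenation of `Δ₁` (above) and `Δ₂` (below): the wires of `Δ₁` that do not
end on the bottom of its frame, the wires of `Δ₂` that do not start on the top of its frame, and,
for every `i`, the wire glued from the `i`-th wire on the bottom of the frame of `Δ₁` and the
`i`-th wire on the top of the frame of `Δ₂`. -/
def concatWires (Δ₁ : BraidedDiagram P u v) (Δ₂ : BraidedDiagram P v w) :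
    Set (Wire (Δ₁.T ⊕ Δ₂.T) A) :=
  {W | (∃ W₁ ∈ Δ₁.wires, W₁.bot.1 ≠ none ∧ W = W₁.map Sum.inl) ∨
    (∃ W₂ ∈ Δ₂.wires, W₂.top.1 ≠ none ∧ W = W₂.map Sum.inr) ∨
    (∃ W₁ ∈ Δ₁.wires, ∃ W₂ ∈ Δ₂.wires, ∃ i : ℕ, W₁.bot = (none, i) ∧ W₂.top = (none, i) ∧
      W = ⟨W₁.top.map Sum.inl, W₁.label, W₂.bot.map Sum.inr⟩)}

theorem Contact.map_injective {T T' : Type} {f : T → T'} (hf : Function.Injective f) :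
    Function.Injective (Contact.map f) := by
  rintro ⟨o, i⟩ ⟨o', i'⟩ h
  simp only [Contact.map, Prod.mk.injEq] at h
  exact Prod.ext (Option.map_injective hf h.1) h.2

theorem Wire.map_injective {A : Type*} {T T' : Type} {f : T → T'} (hf : Function.Injective f) :
    Function.Injective (Wire.map (A := A) f) := by
  intro W W' h
  simp only [Wire.map, Wire.mk.injEq] at h
  exact Wire.ext (Contact.map_injective hf h.1) h.2.1 (Contact.map_injective hf h.2.2)

/-- The two wires through a position of the glued frame sides have the same label. -/
theorem glue_label {Δ₁ : BraidedDiagram P u v} {Δ₂ : BraidedDiagram P v w} {W₁ : Wire Δ₁.T A}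
    {W₂ : Wire Δ₂.T A} {i : ℕ} (h₁ : W₁ ∈ Δ₁.wires) (h₂ : W₂ ∈ Δ₂.wires)
    (e₁ : W₁.bot = (none, i)) (e₂ : W₂.top = (none, i)) : W₁.label = W₂.label := by
  have a := (Δ₁.read_bot none i W₁.label).2 ⟨W₁, h₁, e₁, rfl⟩
  have b := (Δ₂.read_top none i W₂.label).2 ⟨W₂, h₂, e₂, rfl⟩
  simp only [Option.elim_none] at a b
  exact Option.some.inj (a.symm.trans b)

theorem exists_lower {Δ₁ : BraidedDiagram P u v} (Δ₂ : BraidedDiagram P v w) {W₁ : Wire Δ₁.T A}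
    {i : ℕ} (h₁ : W₁ ∈ Δ₁.wires) (e₁ : W₁.bot = (none, i)) :
    ∃ W₂ ∈ Δ₂.wires, W₂.top = (none, i) := by
  have a := (Δ₁.read_bot none i W₁.label).2 ⟨W₁, h₁, e₁, rfl⟩
  obtain ⟨W₂, h₂, e₂, -⟩ := (Δ₂.read_top none i W₁.label).1 a
  exact ⟨W₂, h₂, e₂⟩

theorem exists_upper (Δ₁ : BraidedDiagram P u v) {Δ₂ : BraidedDiagram P v w} {W₂ : Wire Δ₂.T A}
    {i : ℕ} (h₂ : W₂ ∈ Δ₂.wires) (e₂ : W₂.top = (none, i)) :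
    ∃ W₁ ∈ Δ₁.wires, W₁.bot = (none, i) := by
  have a := (Δ₂.read_top none i W₂.label).2 ⟨W₂, h₂, e₂, rfl⟩
  obtain ⟨W₁, h₁, e₁, -⟩ := (Δ₁.read_bot none i W₂.label).1 a
  exact ⟨W₁, h₁, e₁⟩

/-- Every wire of `Δ₁` continues to a wire of the concatenation with the same top contact. -/
theorem exists_concat_top {Δ₁ : BraidedDiagram P u v} (Δ₂ : BraidedDiagram P v w)
    {W₁ : Wire Δ₁.T A} (h₁ : W₁ ∈ Δ₁.wires) :
    ∃ W ∈ concatWires Δ₁ Δ₂, W.top = W₁.top.map Sum.inl ∧ W.label = W₁.label := by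
  by_cases hb : W₁.bot.1 = none
  · obtain ⟨W₂, h₂, e₂⟩ := exists_lower Δ₂ h₁ (i := W₁.bot.2) (Prod.ext hb rfl)
    exact ⟨_, Or.inr (Or.inr ⟨W₁, h₁, W₂, h₂, _, Prod.ext hb rfl, e₂, rfl⟩), rfl, rfl⟩
  · exact ⟨_, Or.inl ⟨W₁, h₁, hb, rfl⟩, rfl, rfl⟩

/-- Every wire of `Δ₂` continues to a wire of the concatenation with the same bottom contact. -/
theorem exists_concat_bot (Δ₁ : BraidedDiagram P u v) {Δ₂ : BraidedDiagram P v w}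
    {W₂ : Wire Δ₂.T A} (h₂ : W₂ ∈ Δ₂.wires) :
    ∃ W ∈ concatWires Δ₁ Δ₂, W.bot = W₂.bot.map Sum.inr ∧ W.label = W₂.label := by
  by_cases hb : W₂.top.1 = none
  · obtain ⟨W₁, h₁, e₁⟩ := exists_upper Δ₁ h₂ (i := W₂.top.2) (Prod.ext hb rfl)
    exact ⟨_, Or.inr (Or.inr ⟨W₁, h₁, W₂, h₂, _, e₁, Prod.ext hb rfl, rfl⟩), rfl,
      glue_label h₁ h₂ e₁ (Prod.ext hb rfl)⟩
  · exact ⟨_, Or.inr (Or.inl ⟨W₂, h₂, hb, rfl⟩), rfl, rfl⟩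

theorem map_inl_ne_map_inr {T T' : Type} {c : Contact T} {c' : Contact T'} (h : c'.1 ≠ none) :
    c.map (Sum.inl : T → T ⊕ T') ≠ c'.map Sum.inr := by
  obtain ⟨_ | t, i⟩ := c <;> obtain ⟨_ | t', i'⟩ := c' <;> simp_all [Contact.map]

theorem map_inr_ne_map_inl {T T' : Type} {c : Contact T} {c' : Contact T'} (h : c.1 ≠ none) :
    c.map (Sum.inl : T → T ⊕ T') ≠ c'.map Sum.inr := by
  obtain ⟨_ | t, i⟩ := c <;> obtain ⟨_ | t', i'⟩ := c' <;> simp_all [Contact.map]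

theorem below_inl {Δ₁ : BraidedDiagram P u v} {Δ₂ : BraidedDiagram P v w} {s : Δ₁.T}
    {y : Δ₁.T ⊕ Δ₂.T} (h : Below (concatWires Δ₁ Δ₂) (Sum.inl s) y) :
    ∃ t, y = Sum.inl t ∧ Below Δ₁.wires s t := by
  obtain ⟨W, hW, ht, hb⟩ := h
  obtain ⟨W₁, h₁, -, rfl⟩ | ⟨W₂, h₂, -, rfl⟩ | ⟨W₁, h₁, W₂, h₂, i, e₁, e₂, rfl⟩ := hW
  · simp only [Wire.map, Contact.map, Option.map_eq_some_iff, Sum.inl.injEq,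
      exists_eq_right] at ht hb
    obtain ⟨t, ht, rfl⟩ := ht
    exact ⟨t, rfl, W₁, h₁, ht, hb⟩
  · simp [Wire.map, Contact.map] at hb
  · simp [Contact.map] at hb

theorem below_inr {Δ₁ : BraidedDiagram P u v} {Δ₂ : BraidedDiagram P v w} {t : Δ₂.T}
    {y : Δ₁.T ⊕ Δ₂.T} (h : Below (concatWires Δ₁ Δ₂) y (Sum.inr t)) :
    ∃ s, y = Sum.inr s ∧ Below Δ₂.wires s t := by
  obtain ⟨W, hW, ht, hb⟩ := h
  obtain ⟨W₁, h₁, -, rfl⟩ | ⟨W₂, h₂, -, rfl⟩ | ⟨W₁, h₁, W₂, h₂, i, e₁, e₂, rfl⟩ := hW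
  · simp [Wire.map, Contact.map] at ht
  · simp only [Wire.map, Contact.map, Option.map_eq_some_iff, Sum.inr.injEq,
      exists_eq_right] at ht hb
    obtain ⟨s, hs, rfl⟩ := hb
    exact ⟨s, rfl, W₂, h₂, ht, hs⟩
  · simp [Contact.map] at ht

/-- The concatenation `Δ₁ ∘ Δ₂`, with `Δ₁` stacked on top of `Δ₂`. -/
abbrev concat (Δ₁ : BraidedDiagram P u v) (Δ₂ : BraidedDiagram P v w) : BraidedDiagram P u w where
  T := Δ₁.T ⊕ Δ₂.T
  finite := by
    have := Δ₁.finite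
    have := Δ₂.finite
    infer_instance
  wires := concatWires Δ₁ Δ₂
  nonempty := by
    obtain ⟨W₁, h₁⟩ := Δ₁.nonempty
    obtain ⟨W, hW, -⟩ := exists_concat_top Δ₂ h₁
    exact ⟨W, hW⟩
  topLabel := Sum.elim Δ₁.topLabel Δ₂.topLabel
  botLabel := Sum.elim Δ₁.botLabel Δ₂.botLabel
  top_inj := by
    have inl := Contact.map_injective (Sum.inl_injective (α := Δ₁.T) (β := Δ₂.T))
    have inr := Contact.map_injective (Sum.inr_injective (α := Δ₁.T) (β := Δ₂.T))
    rintro W (⟨W₁, h₁, b₁, rfl⟩ | ⟨W₂, h₂, b₂, rfl⟩ | ⟨W₁, h₁, W₂, h₂, i, e₁, e₂, rfl⟩) W'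
      (⟨V₁, k₁, c₁, rfl⟩ | ⟨V₂, k₂, c₂, rfl⟩ | ⟨V₁, k₁, V₂, k₂, j, f₁, f₂, rfl⟩) h <;>
      simp only [Wire.map] at h
    · rw [Δ₁.top_inj _ h₁ _ k₁ (inl h)]
    · exact absurd h (map_inl_ne_map_inr c₂)
    · obtain rfl := Δ₁.top_inj _ h₁ _ k₁ (inl h)
      simp [f₁] at b₁
    · exact absurd h.symm (map_inl_ne_map_inr b₂)
    · rw [Δ₂.top_inj _ h₂ _ k₂ (inr h)]
    · exact absurd h.symm (map_inl_ne_map_inr b₂)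
    · obtain rfl := Δ₁.top_inj _ h₁ _ k₁ (inl h)
      simp [e₁] at c₁
    · exact absurd h (map_inl_ne_map_inr c₂)
    · obtain rfl := Δ₁.top_inj _ h₁ _ k₁ (inl h)
      obtain rfl : i = j := by simpa using e₁.symm.trans f₁
      rw [Δ₂.top_inj _ h₂ _ k₂ (e₂.trans f₂.symm)]
  bot_inj := by
    have inl := Contact.map_injective (Sum.inl_injective (α := Δ₁.T) (β := Δ₂.T))
    have inr := Contact.map_injective (Sum.inr_injective (α := Δ₁.T) (β := Δ₂.T))
    rintro W (⟨W₁, h₁, b₁, rfl⟩ | ⟨W₂, h₂, b₂, rfl⟩ | ⟨W₁, h₁, W₂, h₂, i, e₁, e₂, rfl⟩) W'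
      (⟨V₁, k₁, c₁, rfl⟩ | ⟨V₂, k₂, c₂, rfl⟩ | ⟨V₁, k₁, V₂, k₂, j, f₁, f₂, rfl⟩) h <;>
      simp only [Wire.map] at h
    · rw [Δ₁.bot_inj _ h₁ _ k₁ (inl h)]
    · exact absurd h (map_inr_ne_map_inl b₁)
    · exact absurd h (map_inr_ne_map_inl b₁)
    · exact absurd h.symm (map_inr_ne_map_inl c₁)
    · rw [Δ₂.bot_inj _ h₂ _ k₂ (inr h)]
    · obtain rfl := Δ₂.bot_inj _ h₂ _ k₂ (inr h)
      simp [f₂] at b₂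
    · exact absurd h.symm (map_inr_ne_map_inl c₁)
    · obtain rfl := Δ₂.bot_inj _ h₂ _ k₂ (inr h)
      simp [e₂] at c₂
    · obtain rfl := Δ₂.bot_inj _ h₂ _ k₂ (inr h)
      obtain rfl : i = j := by simpa using e₂.symm.trans f₂
      rw [Δ₁.bot_inj _ h₁ _ k₁ (e₁.trans f₁.symm)]
  read_top := by
    have key : ∀ (o : Option Δ₁.T) (i : ℕ) (a : A), (o.elim u Δ₁.botLabel)[i]? = some a ↔
        ∃ W ∈ concatWires Δ₁ Δ₂, W.top = (o.map Sum.inl, i) ∧ W.label = a := by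
      intro o i a
      rw [Δ₁.read_top]
      constructor
      · rintro ⟨W₁, h₁, e, rfl⟩
        obtain ⟨W, hW, ht, hl⟩ := exists_concat_top Δ₂ h₁
        exact ⟨W, hW, by rw [ht, e]; rfl, hl⟩
      · have inl := Contact.map_injective (Sum.inl_injective (α := Δ₁.T) (β := Δ₂.T))
        rintro ⟨W, (⟨W₁, h₁, b₁, rfl⟩ | ⟨W₂, h₂, b₂, rfl⟩ | ⟨W₁, h₁, W₂, h₂, i, e₁, e₂, rfl⟩), e,
          rfl⟩
        · exact ⟨W₁, h₁, inl e, rfl⟩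
        · exact absurd e.symm (map_inl_ne_map_inr (c := (o, i)) b₂)
        · exact ⟨W₁, h₁, inl e, rfl⟩
    rintro (_ | t | t) i a
    · exact key none i a
    · exact key (some t) i a
    · refine (Δ₂.read_top (some t) i a).trans ⟨?_, ?_⟩
      · rintro ⟨W₂, h₂, e, rfl⟩
        exact ⟨_, Or.inr (Or.inl ⟨W₂, h₂, by simp [e], rfl⟩), by simp [Wire.map, Contact.map, e],
          rfl⟩
      · have inr := Contact.map_injective (Sum.inr_injective (α := Δ₁.T) (β := Δ₂.T))
        rintro ⟨W, (⟨W₁, h₁, b₁, rfl⟩ | ⟨W₂, h₂, b₂, rfl⟩ | ⟨W₁, h₁, W₂, h₂, i, e₁, e₂, rfl⟩), e,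
          rfl⟩
        · exact absurd e (map_inl_ne_map_inr (c' := (some t, i)) (by simp))
        · exact ⟨W₂, h₂, inr e, rfl⟩
        · exact absurd e (map_inl_ne_map_inr (c' := (some t, _)) (by simp))
  read_bot := by
    have key : ∀ (o : Option Δ₂.T) (i : ℕ) (a : A), (o.elim w Δ₂.topLabel)[i]? = some a ↔
        ∃ W ∈ concatWires Δ₁ Δ₂, W.bot = (o.map Sum.inr, i) ∧ W.label = a := by
      intro o i a
      rw [Δ₂.read_bot]
      constructor
      · rintro ⟨W₂, h₂, e, rfl⟩
        obtain ⟨W, hW, ht, hl⟩ := exists_concat_bot Δ₁ h₂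
        exact ⟨W, hW, by rw [ht, e]; rfl, hl⟩
      · have inr := Contact.map_injective (Sum.inr_injective (α := Δ₁.T) (β := Δ₂.T))
        rintro ⟨W, (⟨W₁, h₁, b₁, rfl⟩ | ⟨W₂, h₂, b₂, rfl⟩ | ⟨W₁, h₁, W₂, h₂, i, e₁, e₂, rfl⟩), e,
          rfl⟩
        · exact absurd e (map_inr_ne_map_inl (c' := (o, i)) b₁)
        · exact ⟨W₂, h₂, inr e, rfl⟩
        · exact ⟨W₂, h₂, inr e, (glue_label h₁ h₂ e₁ e₂).symm⟩
    rintro (_ | t | t) i a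
    · exact key none i a
    · refine (Δ₁.read_bot (some t) i a).trans ⟨?_, ?_⟩
      · rintro ⟨W₁, h₁, e, rfl⟩
        exact ⟨_, Or.inl ⟨W₁, h₁, by simp [e], rfl⟩, by simp [Wire.map, Contact.map, e], rfl⟩
      · have inl := Contact.map_injective (Sum.inl_injective (α := Δ₁.T) (β := Δ₂.T))
        rintro ⟨W, (⟨W₁, h₁, b₁, rfl⟩ | ⟨W₂, h₂, b₂, rfl⟩ | ⟨W₁, h₁, W₂, h₂, i, e₁, e₂, rfl⟩), e,
          rfl⟩
        · exact ⟨W₁, h₁, inl e, rfl⟩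
        · exact absurd e.symm (map_inr_ne_map_inl (c := (some t, i)) (by simp))
        · exact absurd e.symm (map_inr_ne_map_inl (c := (some t, _)) (by simp))
    · exact key (some t) i a
  rel := by
    rintro (t | t)
    · exact Δ₁.rel t
    · exact Δ₂.rel t
  acyclic := by
    have h1 : ∀ (s : Δ₁.T) (y : Δ₁.T ⊕ Δ₂.T),
        Relation.TransGen (Below (concatWires Δ₁ Δ₂)) (Sum.inl s) y →
        ∃ t, y = Sum.inl t ∧ Relation.TransGen (Below Δ₁.wires) s t := by
      intro s y h
      induction h with
      | single h =>
        obtain ⟨t, rfl, ht⟩ := below_inl h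
        exact ⟨t, rfl, .single ht⟩
      | tail _ h ih =>
        obtain ⟨t, rfl, ht⟩ := ih
        obtain ⟨t', rfl, ht'⟩ := below_inl h
        exact ⟨t', rfl, ht.tail ht'⟩
    have h2 : ∀ (t : Δ₂.T) (y : Δ₁.T ⊕ Δ₂.T),
        Relation.TransGen (Below (concatWires Δ₁ Δ₂)) y (Sum.inr t) →
        ∃ s, y = Sum.inr s ∧ Relation.TransGen (Below Δ₂.wires) s t := by
      intro t y h
      induction h using Relation.TransGen.head_induction_on with
      | single h =>
        obtain ⟨s, rfl, hs⟩ := below_inr h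
        exact ⟨s, rfl, .single hs⟩
      | head h _ ih =>
        obtain ⟨s, rfl, hs⟩ := ih
        obtain ⟨s', rfl, hs'⟩ := below_inr h
        exact ⟨s', rfl, .head hs' hs⟩
    rintro (t | t) h
    · obtain ⟨t', e, h'⟩ := h1 t _ h
      obtain rfl := Sum.inl_injective e
      exact Δ₁.acyclic t h'
    · obtain ⟨t', e, h'⟩ := h2 t _ h
      obtain rfl := Sum.inr_injective e
      exact Δ₂.acyclic t h'

/-! #### Equivalence, dipoles, equivalence modulo dipoles -/

/-- Equivalence of diagrams: a bijection of the transistors that preserves the labels of their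
sides and carries the wires of `Δ` to the wires of `Δ'` (with their labels and contacts). -/
def Equivalent (Δ Δ' : BraidedDiagram P u v) : Prop :=
  ∃ e : Δ.T ≃ Δ'.T,
    (∀ t, Δ'.topLabel (e t) = Δ.topLabel t) ∧
    (∀ t, Δ'.botLabel (e t) = Δ.botLabel t) ∧
    ∀ W, W ∈ Δ.wires ↔ W.map e ∈ Δ'.wires

/-- `T₁` and `T₂` (with `T₂` above `T₁`) form a dipole: the bottom label of `T₁` is the top label of
`T₂`, and the wires at the bottom of `T₂` are, in order, the wires at the top of `T₁`. -/
def IsDipole (Δ : BraidedDiagram P u v) (T₁ T₂ : Δ.T) : Prop :=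
  Below Δ.wires T₁ T₂ ∧
  Δ.botLabel T₁ = Δ.topLabel T₂ ∧
  ∀ W ∈ Δ.wires, ∀ i : ℕ, W.top = (some T₂, i) ↔ W.bot = (some T₁, i)

/-- `Δ'` is (equivalent to) the diagram obtained from `Δ` by reducing a dipole `(T₁, T₂)`: the
transistors of `Δ'` are identified by `f` with those of `Δ` other than `T₁` and `T₂`, and the wires
of `Δ'` are the wires of `Δ` not attached to `T₁` or `T₂`, and the wires glued from the `i`-th wire
at the top of `T₂` and the `i`-th wire at the bottom of `T₁`. -/
def ReducesTo (Δ Δ' : BraidedDiagram P u v) : Prop :=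
  ∃ (T₁ T₂ : Δ.T) (f : Δ'.T → Δ.T), Δ.IsDipole T₁ T₂ ∧
    Function.Injective f ∧ Set.range f = {t | t ≠ T₁ ∧ t ≠ T₂} ∧
    (∀ t, Δ.topLabel (f t) = Δ'.topLabel t) ∧
    (∀ t, Δ.botLabel (f t) = Δ'.botLabel t) ∧
    ∀ W, W ∈ Δ'.wires ↔ W.map f ∈ Δ.wires ∨
      ∃ V₂ ∈ Δ.wires, ∃ V₁ ∈ Δ.wires, ∃ i : ℕ, V₂.bot = (some T₂, i) ∧ V₁.top = (some T₁, i) ∧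
        W.map f = ⟨V₂.top, V₂.label, V₁.bot⟩

/-- Equivalence modulo dipoles: the equivalence relation generated by equivalence of diagrams and
reduction (hence also insertion) of dipoles. -/
def DipoleEquiv : BraidedDiagram P u v → BraidedDiagram P u v → Prop :=
  Relation.EqvGen fun Δ Δ' => Δ.Equivalent Δ' ∨ Δ.ReducesTo Δ'

/-- Equivalence modulo dipoles as a setoid. -/
def dipoleSetoid (P : SemigroupPresentation A) (u v : List A) : Setoid (BraidedDiagram P u v) :=
  Relation.EqvGen.setoid fun Δ Δ' => Δ.Equivalent Δ' ∨ Δ.ReducesTo Δ'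

/-! #### Concatenation respects equivalence modulo dipoles -/

theorem Wire.map_comp {T T' T'' : Type} (f : T → T') (g : T' → T'') (W : Wire T A) :
    (W.map f).map g = W.map (g ∘ f) := by
  simp [Wire.map, Contact.map]

theorem equivalent_of_forward {Δ Δ' : BraidedDiagram P u v} (e : Δ.T ≃ Δ'.T)
    (ht : ∀ t, Δ'.topLabel (e t) = Δ.topLabel t) (hb : ∀ t, Δ'.botLabel (e t) = Δ.botLabel t)
    (hw : ∀ W ∈ Δ.wires, W.map e ∈ Δ'.wires) : Δ.Equivalent Δ' := by
  refine ⟨e, ht, hb, fun W => ⟨hw W, fun h => ?_⟩⟩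
  have h1 := (Δ'.read_top (W.top.1.map e) W.top.2 W.label).2 ⟨_, h, rfl, rfl⟩
  have h2 : (W.top.1.map e).elim u Δ'.botLabel = W.top.1.elim u Δ.botLabel := by
    cases W.top.1 <;> simp [hb]
  rw [h2, Δ.read_top] at h1
  obtain ⟨V, hV, hVt, -⟩ := h1
  have := Δ'.top_inj _ (hw V hV) _ h (by simp [Wire.map, hVt])
  rwa [← Wire.map_injective e.injective this]

theorem reducesTo_of_forward {Δ Δ' : BraidedDiagram P u v} (T₁ T₂ : Δ.T) (f : Δ'.T → Δ.T)
    (hd : Δ.IsDipole T₁ T₂) (hf : Function.Injective f)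
    (hr : Set.range f = {t | t ≠ T₁ ∧ t ≠ T₂})
    (ht : ∀ t, Δ.topLabel (f t) = Δ'.topLabel t) (hb : ∀ t, Δ.botLabel (f t) = Δ'.botLabel t)
    (hw : ∀ W ∈ Δ'.wires, W.map f ∈ Δ.wires ∨
      ∃ V₂ ∈ Δ.wires, ∃ V₁ ∈ Δ.wires, ∃ i : ℕ, V₂.bot = (some T₂, i) ∧ V₁.top = (some T₁, i) ∧
        W.map f = ⟨V₂.top, V₂.label, V₁.bot⟩) : Δ.ReducesTo Δ' := by
  refine ⟨T₁, T₂, f, hd, hf, hr, ht, hb, fun W => ⟨hw W, fun h => ?_⟩⟩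
  have hne : ∀ t, f t ≠ T₂ := fun t => (hr.subset (Set.mem_range_self t)).2
  have hbot : ∀ (X : Wire Δ'.T A) (V : Wire Δ.T A) (i : ℕ), V.bot = (some T₂, i) →
      X.map f ≠ V := by
    rintro X V i h rfl
    simp only [Wire.map, Contact.map, Prod.mk.injEq, Option.map_eq_some_iff] at h
    obtain ⟨⟨t, -, h⟩, -⟩ := h
    exact hne t h
  have htop : ∃ V ∈ Δ.wires, V.top = (W.map f).top ∧ V.label = W.label := by
    obtain h | ⟨V₂, h₂, V₁, h₁, i, e₂, e₁, e⟩ := h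
    · exact ⟨_, h, rfl, rfl⟩
    · exact ⟨V₂, h₂, by rw [e], by simpa [Wire.map] using (congrArg Wire.label e).symm⟩
  have h1 : ∃ X ∈ Δ'.wires, X.top = W.top := by
    obtain ⟨V, hV, e, el⟩ := htop
    have h1 := (Δ.read_top (W.top.1.map f) W.top.2 W.label).2 ⟨V, hV, e, el⟩
    have h2 : (W.top.1.map f).elim u Δ.botLabel = W.top.1.elim u Δ'.botLabel := by
      cases W.top.1 <;> simp [hb]
    rw [h2, Δ'.read_top] at h1
    obtain ⟨X, hX, e, -⟩ := h1
    exact ⟨X, hX, e⟩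
  obtain ⟨X, hX, hXt⟩ := h1
  have hXW : X.map f = W.map f → W ∈ Δ'.wires := fun h => by
    rwa [← Wire.map_injective hf h]
  have hXt' : (X.map f).top = (W.map f).top := by simp [Wire.map, hXt]
  refine hXW ?_
  obtain h | ⟨V₂, h₂, V₁, h₁, i, e₂, e₁, e⟩ := h <;>
    obtain k | ⟨U₂, k₂, U₁, k₁, j, c₂, c₁, c⟩ := hw X hX
  · exact Δ.top_inj _ k _ h hXt'
  · refine absurd (Δ.top_inj _ h _ k₂ ?_) (hbot _ _ _ c₂)
    rw [← hXt', c]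
  · refine absurd (Δ.top_inj _ k _ h₂ ?_) (hbot _ _ _ e₂)
    rw [hXt', e]
  · have h3 : U₂ = V₂ := Δ.top_inj _ k₂ _ h₂ (by
      have := hXt'
      rw [c, e] at this
      exact this)
    subst h3
    obtain rfl : i = j := by simpa using e₂.symm.trans c₂
    obtain rfl := Δ.top_inj _ k₁ _ h₁ (c₁.trans e₁.symm)
    rw [c, e]

theorem Equivalent.concat_right {Δ Δ' : BraidedDiagram P u v} (h : Δ.Equivalent Δ')
    (Γ : BraidedDiagram P v w) : (Δ.concat Γ).Equivalent (Δ'.concat Γ) := by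
  obtain ⟨e, ht, hb, hw⟩ := h
  refine equivalent_of_forward (Equiv.sumCongr e (Equiv.refl Γ.T)) ?_ ?_ ?_
  · rintro (t | t)
    exacts [ht t, rfl]
  · rintro (t | t)
    exacts [hb t, rfl]
  · rintro W (⟨W₁, h₁, b₁, rfl⟩ | ⟨W₂, h₂, b₂, rfl⟩ | ⟨W₁, h₁, W₂, h₂, i, e₁, e₂, rfl⟩)
    · exact Or.inl ⟨_, (hw _).1 h₁, by simpa [Wire.map, Contact.map] using b₁,
        by simp [Wire.map_comp, Function.comp_def]⟩
    · exact Or.inr (Or.inl ⟨W₂, h₂, b₂, by simp [Wire.map_comp, Function.comp_def]⟩)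
    · exact Or.inr (Or.inr ⟨_, (hw _).1 h₁, W₂, h₂, i, by simp [Wire.map, Contact.map, e₁], e₂,
        by simp [Wire.map, Contact.map, Function.comp_def]⟩)

theorem Equivalent.concat_left {Δ Δ' : BraidedDiagram P v w} (h : Δ.Equivalent Δ')
    (Γ : BraidedDiagram P u v) : (Γ.concat Δ).Equivalent (Γ.concat Δ') := by
  obtain ⟨e, ht, hb, hw⟩ := h
  refine equivalent_of_forward (Equiv.sumCongr (Equiv.refl Γ.T) e) ?_ ?_ ?_
  · rintro (t | t)
    exacts [rfl, ht t]
  · rintro (t | t)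
    exacts [rfl, hb t]
  · rintro W (⟨W₁, h₁, b₁, rfl⟩ | ⟨W₂, h₂, b₂, rfl⟩ | ⟨W₁, h₁, W₂, h₂, i, e₁, e₂, rfl⟩)
    · exact Or.inl ⟨W₁, h₁, b₁, by simp [Wire.map_comp, Function.comp_def]⟩
    · exact Or.inr (Or.inl ⟨_, (hw _).1 h₂, by simpa [Wire.map, Contact.map] using b₂,
        by simp [Wire.map_comp, Function.comp_def]⟩)
    · exact Or.inr (Or.inr ⟨W₁, h₁, _, (hw _).1 h₂, i, e₁, by simp [Wire.map, Contact.map, e₂],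
        by simp [Wire.map, Contact.map, Function.comp_def]⟩)

theorem ReducesTo.concat_right {Δ Δ' : BraidedDiagram P u v} (h : Δ.ReducesTo Δ')
    (Γ : BraidedDiagram P v w) : (Δ.concat Γ).ReducesTo (Δ'.concat Γ) := by
  obtain ⟨T₁, T₂, f, ⟨⟨B, hB, hBt, hBb⟩, hl, hd⟩, hf, hr, ht, hb, hw⟩ := h
  refine reducesTo_of_forward (Δ := Δ.concat Γ) (Δ' := Δ'.concat Γ) (Sum.inl T₁) (Sum.inl T₂)
    (Sum.map f id) ⟨⟨B.map Sum.inl, Or.inl ⟨B, hB, by simp [hBb], rfl⟩, ?_, ?_⟩, hl, ?_⟩ ?_ ?_ ?_ ?_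
    ?_
  · simp [Wire.map, Contact.map, hBt]
  · simp [Wire.map, Contact.map, hBb]
  · have inl := Contact.map_injective (Sum.inl_injective (α := Δ.T) (β := Γ.T))
    rintro W (⟨W₁, h₁, b₁, rfl⟩ | ⟨W₂, h₂, b₂, rfl⟩ | ⟨W₁, h₁, W₂, h₂, j, e₁, e₂, rfl⟩) i
    · have := hd W₁ h₁ i
      rw [← inl.eq_iff, ← inl.eq_iff] at this
      exact this
    · simp [Wire.map, Contact.map]
    · have := hd W₁ h₁ i
      rw [← inl.eq_iff] at this
      refine ⟨fun h => ?_, fun h => ?_⟩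
      · have := this.1 h
        simp [e₁] at this
      · simp [Contact.map] at h
  · exact hf.sumMap Function.injective_id
  · ext (t | t)
    · have := Set.ext_iff.1 hr t
      simpa using this
    · simp
  · rintro (t | t)
    exacts [ht t, rfl]
  · rintro (t | t)
    exacts [hb t, rfl]
  · rintro W (⟨W₁, h₁, b₁, rfl⟩ | ⟨W₂, h₂, b₂, rfl⟩ | ⟨W₁, h₁, W₂, h₂, j, e₁, e₂, rfl⟩)
    · obtain h | ⟨V₂, k₂, V₁, k₁, i, c₂, c₁, c⟩ := (hw _).1 h₁
      · exact Or.inl (Or.inl ⟨_, h, by simpa [Wire.map, Contact.map] using b₁,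
          by simp [Wire.map_comp, Function.comp_def]⟩)
      · have hn : V₁.bot.1 ≠ none := by
          rw [← congrArg (fun X => X.bot.1) c]
          simpa [Wire.map, Contact.map] using b₁
        refine Or.inr ⟨V₂.map Sum.inl, Or.inl ⟨V₂, k₂, by simp [c₂], rfl⟩, V₁.map Sum.inl,
          Or.inl ⟨V₁, k₁, hn, rfl⟩, i, by simp [Wire.map, Contact.map, c₂],
          by simp [Wire.map, Contact.map, c₁], ?_⟩
        have := congrArg (Wire.map (Sum.inl : Δ.T → Δ.T ⊕ Γ.T)) c
        rw [Wire.map_comp] at this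
        rw [Wire.map_comp]
        exact this
    · exact Or.inl (Or.inr (Or.inl ⟨W₂, h₂, b₂, by simp [Wire.map_comp, Function.comp_def]⟩))
    · obtain h | ⟨V₂, k₂, V₁, k₁, i, c₂, c₁, c⟩ := (hw _).1 h₁
      · exact Or.inl (Or.inr (Or.inr ⟨_, h, W₂, h₂, j, by simp [Wire.map, Contact.map, e₁], e₂,
          by simp [Wire.map, Contact.map, Function.comp_def]⟩))
      · have hn : V₁.bot = (none, j) := by
          rw [← congrArg Wire.bot c]
          simp [Wire.map, Contact.map, e₁]
        refine Or.inr ⟨V₂.map Sum.inl, Or.inl ⟨V₂, k₂, by simp [c₂], rfl⟩, _,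
          Or.inr (Or.inr ⟨V₁, k₁, W₂, h₂, j, hn, e₂, rfl⟩), i, by simp [Wire.map, Contact.map, c₂],
          by simp [Contact.map, c₁], ?_⟩
        have c' := congrArg (Wire.map (Sum.inl : Δ.T → Δ.T ⊕ Γ.T)) c
        simp only [Wire.map, Contact.map, Option.map_map, Wire.mk.injEq, Function.comp_def,
          Sum.map_inl, Sum.map_inr, id, Prod.mk.injEq] at c' ⊢
        exact ⟨c'.1, c'.2.1, trivial⟩

theorem ReducesTo.concat_left {Δ Δ' : BraidedDiagram P v w} (h : Δ.ReducesTo Δ')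
    (Γ : BraidedDiagram P u v) : (Γ.concat Δ).ReducesTo (Γ.concat Δ') := by
  obtain ⟨T₁, T₂, f, ⟨⟨B, hB, hBt, hBb⟩, hl, hd⟩, hf, hr, ht, hb, hw⟩ := h
  refine reducesTo_of_forward (Δ := Γ.concat Δ) (Δ' := Γ.concat Δ') (Sum.inr T₁) (Sum.inr T₂)
    (Sum.map id f) ⟨⟨B.map Sum.inr, Or.inr (Or.inl ⟨B, hB, by simp [hBt], rfl⟩), ?_, ?_⟩, hl, ?_⟩
    ?_ ?_ ?_ ?_ ?_
  · simp [Wire.map, Contact.map, hBt]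
  · simp [Wire.map, Contact.map, hBb]
  · have inr := Contact.map_injective (Sum.inr_injective (α := Γ.T) (β := Δ.T))
    rintro W (⟨W₁, h₁, b₁, rfl⟩ | ⟨W₂, h₂, b₂, rfl⟩ | ⟨W₁, h₁, W₂, h₂, j, e₁, e₂, rfl⟩) i
    · simp [Wire.map, Contact.map]
    · have := hd W₂ h₂ i
      rw [← inr.eq_iff, ← inr.eq_iff] at this
      exact this
    · have := hd W₂ h₂ i
      rw [← inr.eq_iff (a := W₂.bot)] at this
      refine ⟨fun h => ?_, fun h => ?_⟩
      · simp [Contact.map] at h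
      · have := this.2 h
        simp [e₂] at this
  · exact Function.injective_id.sumMap hf
  · ext (t | t)
    · simp
    · have := Set.ext_iff.1 hr t
      simpa using this
  · rintro (t | t)
    exacts [rfl, ht t]
  · rintro (t | t)
    exacts [rfl, hb t]
  · rintro W (⟨W₁, h₁, b₁, rfl⟩ | ⟨W₂, h₂, b₂, rfl⟩ | ⟨W₁, h₁, W₂, h₂, j, e₁, e₂, rfl⟩)
    · exact Or.inl (Or.inl ⟨W₁, h₁, b₁, by simp [Wire.map_comp, Function.comp_def]⟩)
    · obtain h | ⟨V₂, k₂, V₁, k₁, i, c₂, c₁, c⟩ := (hw _).1 h₂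
      · exact Or.inl (Or.inr (Or.inl ⟨_, h, by simpa [Wire.map, Contact.map] using b₂,
          by simp [Wire.map_comp, Function.comp_def]⟩))
      · have hn : V₂.top.1 ≠ none := by
          rw [← congrArg (fun X => X.top.1) c]
          simpa [Wire.map, Contact.map] using b₂
        refine Or.inr ⟨V₂.map Sum.inr, Or.inr (Or.inl ⟨V₂, k₂, hn, rfl⟩), V₁.map Sum.inr,
          Or.inr (Or.inl ⟨V₁, k₁, by simp [c₁], rfl⟩), i, by simp [Wire.map, Contact.map, c₂],
          by simp [Wire.map, Contact.map, c₁], ?_⟩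
        have := congrArg (Wire.map (Sum.inr : Δ.T → Γ.T ⊕ Δ.T)) c
        rw [Wire.map_comp] at this
        rw [Wire.map_comp]
        exact this
    · obtain h | ⟨V₂, k₂, V₁, k₁, i, c₂, c₁, c⟩ := (hw _).1 h₂
      · exact Or.inl (Or.inr (Or.inr ⟨W₁, h₁, _, h, j, e₁, by simp [Wire.map, Contact.map, e₂],
          by simp [Wire.map, Contact.map, Function.comp_def]⟩))
      · have hn : V₂.top = (none, j) := by
          rw [← congrArg Wire.top c]
          simp [Wire.map, Contact.map, e₂]
        refine Or.inr ⟨_, Or.inr (Or.inr ⟨W₁, h₁, V₂, k₂, j, e₁, hn, rfl⟩), V₁.map Sum.inr,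
          Or.inr (Or.inl ⟨V₁, k₁, by simp [c₁], rfl⟩), i, by simp [Contact.map, c₂],
          by simp [Wire.map, Contact.map, c₁], ?_⟩
        have c' := congrArg (Wire.map (Sum.inr : Δ.T → Γ.T ⊕ Δ.T)) c
        simp only [Wire.map, Contact.map, Option.map_map, Wire.mk.injEq, Function.comp_def,
          Sum.map_inl, Sum.map_inr, id, Prod.mk.injEq] at c' ⊢
        exact ⟨trivial, trivial, c'.2.2⟩

theorem DipoleEquiv.concat {Δ₁ Δ₁' : BraidedDiagram P u v} {Δ₂ Δ₂' : BraidedDiagram P v w}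
    (h₁ : Δ₁.DipoleEquiv Δ₁') (h₂ : Δ₂.DipoleEquiv Δ₂') :
    (Δ₁.concat Δ₂).DipoleEquiv (Δ₁'.concat Δ₂') := by
  refine Relation.EqvGen.trans _ (Δ₁'.concat Δ₂) _ ?_ ?_
  · induction h₁ with
    | rel _ _ h => exact .rel _ _ (h.imp (·.concat_right _) (·.concat_right _))
    | refl => exact .refl _
    | symm _ _ _ ih => exact .symm _ _ ih
    | trans _ _ _ _ _ ih ih' => exact .trans _ _ _ ih ih'
  · induction h₂ with
    | rel _ _ h => exact .rel _ _ (h.imp (·.concat_left _) (·.concat_left _))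
    | refl => exact .refl _
    | symm _ _ _ ih => exact .symm _ _ ih
    | trans _ _ _ _ _ ih ih' => exact .trans _ _ _ ih ih'

end BraidedDiagram

/-- The braided diagram group `D_b(P, w)` of a presentation `P` based at a nonempty word `w`: the
braided `(w, w)`-diagrams modulo dipoles, with the operation induced by concatenation. -/
def BraidedDiagramGroup {A : Type*} (P : SemigroupPresentation A) (w : List A) :=
  Quotient (BraidedDiagram.dipoleSetoid P w w)

/-- Multiplication is induced by concatenation. Only the operation is recorded here; a
multiplicative bijection from a group shows at once that this operation is a group operation. -/
instance {A : Type*} (P : SemigroupPresentation A) (w : List A) : Mul (BraidedDiagramGroup P w) where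
  mul := Quotient.map₂ BraidedDiagram.concat fun _ _ h₁ _ _ h₂ =>
    BraidedDiagram.DipoleEquiv.concat h₁ h₂

/-- The letters `a` and `x`. -/
inductive Letter
  | a
  | x

/-- The semigroup presentation `⟨a, x ∣ x = xax⟩`. -/
def treePresentation : SemigroupPresentation Letter where
  rels := {([.x], [.x, .a, .x])}
  nonempty_words := by
    rintro r rfl
    simp

/-! ### Quasi-automorphisms of the infinite ordered rooted binary tree

A vertex is a finite sequence of left/right choices, the last choice coming first; the root is the
empty sequence. -/

/-- The left child of a vertex. -/
def leftChild (v : List Bool) : List Bool := false :: v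

/-- The right child of a vertex. -/
def rightChild (v : List Bool) : List Bool := true :: v

/-- The infinite rooted binary tree. -/
def binaryTree : SimpleGraph (List Bool) :=
  SimpleGraph.fromRel fun v w => w = leftChild v ∨ w = rightChild v

/-- The left-right order of the edges incident with and below `v`: `u` and `u'` are the lower ends
of two edges below `v`, the first of which is to the left of the second. -/
def EdgeLeftOf (v u u' : List Bool) : Prop := u = leftChild v ∧ u' = rightChild v

/-- The bijection `h` preserves adjacency, with at most finitely many exceptions. -/
def AlmostPreservesAdj (h : Equiv.Perm (List Bool)) : Prop :=
  {p : List Bool × List Bool |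
    ¬ (binaryTree.Adj p.1 p.2 ↔ binaryTree.Adj (h p.1) (h p.2))}.Finite

/-- The bijection `h` preserves the left-right order of the edges below a vertex, with at most
finitely many exceptional vertices. -/
def AlmostPreservesOrder (h : Equiv.Perm (List Bool)) : Prop :=
  {v : List Bool | ¬ ∀ u u', EdgeLeftOf v u u' → EdgeLeftOf (h v) (h u) (h u')}.Finite

/-- The group `QAut(T_{2,c})` of quasi-automorphisms of the infinite ordered rooted binary tree. -/
def QAut : Subgroup (Equiv.Perm (List Bool)) where
  carrier := {h | AlmostPreservesAdj h ∧ AlmostPreservesOrder h}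
  one_mem' := by simp [AlmostPreservesAdj, AlmostPreservesOrder]
  mul_mem' := by
    rintro g h ⟨g1, g2⟩ ⟨h1, h2⟩
    refine ⟨(h1.union (g1.preimage (f := Prod.map h h)
      (h.injective.prodMap h.injective).injOn)).subset ?_,
      (h2.union (g2.preimage (f := h) h.injective.injOn)).subset ?_⟩
    · intro p hp
      simp only [Set.mem_ofPred_eq, Set.mem_union, Set.mem_preimage, Prod.map,
        Equiv.Perm.coe_mul, Function.comp_apply] at hp ⊢
      tauto
    · intro v hv
      by_contra hn
      simp only [Set.mem_ofPred_eq, Set.mem_union, Set.mem_preimage, not_or, not_not] at hn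
      exact hv fun u u' hu => hn.2 _ _ (hn.1 _ _ hu)
  inv_mem' := by
    rintro h ⟨h1, h2⟩
    have key : ∀ v, h (h⁻¹ v) = v := h.apply_symm_apply
    refine ⟨(h1.image (Prod.map h h)).subset ?_, (h2.image h).subset ?_⟩
    · intro p hp
      refine ⟨(h⁻¹ p.1, h⁻¹ p.2), ?_, by simp⟩
      simp only [Set.mem_ofPred_eq, key] at hp ⊢
      tauto
    · intro v hv
      refine ⟨h⁻¹ v, fun hn => hv ?_, key v⟩
      rintro u u' ⟨rfl, rfl⟩
      obtain ⟨e, e'⟩ := hn _ _ ⟨rfl, rfl⟩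
      rw [key] at e e'
      exact ⟨by rw [← e]; simp, by rw [← e']; simp⟩

/-! ### Finite similarity structures -/

/-- A ball of a metric space. In a compact ultrametric space open balls and closed balls of
positive radius are the same sets. -/
def IsBall {X : Type*} [MetricSpace X] (B : Set X) : Prop :=
  ∃ x : X, ∃ r > 0, B = Metric.ball x r

/-- The balls of a metric space. -/
abbrev Ball (X : Type*) [MetricSpace X] := {B : Set X // IsBall B}

/-- A finite similarity structure: finite sets of surjective similarities between balls, closed
under identities, inverses, compositions and restrictions to balls. A surjective similarity is a
bijection. -/
structure FiniteSimilarityStructure (X : Type*) [MetricSpace X] where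
  sim : (B₁ B₂ : Ball X) → Set (B₁.1 ≃ B₂.1)
  similarity : ∀ (B₁ B₂ : Ball X), ∀ h ∈ sim B₁ B₂,
    ∃ C : ℝ, 0 < C ∧ ∀ x y, dist (h x) (h y) = C * dist x y
  finite : ∀ B₁ B₂ : Ball X, (sim B₁ B₂).Finite
  refl_mem : ∀ B : Ball X, Equiv.refl B.1 ∈ sim B B
  symm_mem : ∀ (B₁ B₂ : Ball X), ∀ h ∈ sim B₁ B₂, h.symm ∈ sim B₂ B₁
  trans_mem : ∀ (B₁ B₂ B₃ : Ball X), ∀ h₁ ∈ sim B₁ B₂, ∀ h₂ ∈ sim B₂ B₃, h₁.trans h₂ ∈ sim B₁ B₃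
  /-- if `B₃ ⊆ B₁` and `h(B₃) = B₄`, then `h` restricts to an element of `sim B₃ B₄` -/
  restrict_mem : ∀ (B₁ B₂ B₃ B₄ : Ball X), ∀ h ∈ sim B₁ B₂, ∀ hs : B₃.1 ⊆ B₁.1,
    (Set.range fun y : B₃.1 => (h ⟨y, hs y.2⟩ : X)) = B₄.1 →
    ∃ g ∈ sim B₃ B₄, ∀ y : B₃.1, (g y : X) = h ⟨y, hs y.2⟩

namespace FiniteSimilarityStructure

/-- A finite similarity structure is small if there is at most one similarity in it between any two
balls. -/
def IsSmall {X : Type*} [MetricSpace X] (S : FiniteSimilarityStructure X) : Prop :=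
  ∀ B₁ B₂ : Ball X, (S.sim B₁ B₂).Subsingleton

/-- The homeomorphism `h` is locally determined by `S`: every point lies in a ball `B` such that
`h` maps `B` onto a ball `B'` and agrees on `B` with an element of `S.sim B B'`. -/
def LocallyDetermined {X : Type*} [MetricSpace X] (S : FiniteSimilarityStructure X)
    (h : X ≃ₜ X) : Prop :=
  ∀ x : X, ∃ B B' : Ball X, x ∈ B.1 ∧ ∃ σ ∈ S.sim B B', ∀ y : B.1, h y = (σ y : X)

/-- The image of a ball under an element of the structure is a ball. -/
theorem exists_restrict {X : Type*} [MetricSpace X] [IsUltrametricDist X]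
    (S : FiniteSimilarityStructure X) {B₁ B₂ : Ball X} {h : B₁.1 ≃ B₂.1} (hh : h ∈ S.sim B₁ B₂)
    (B₃ : Ball X) (hs : B₃.1 ⊆ B₁.1) :
    ∃ B₄ : Ball X, ∃ g ∈ S.sim B₃ B₄, ∀ y : B₃.1, (g y : X) = h ⟨y, hs y.2⟩ := by
  obtain ⟨C, hC, hd⟩ := S.similarity _ _ h hh
  obtain ⟨x, r, hr, e⟩ := B₃.2
  have hx : x ∈ B₃.1 := e ▸ Metric.mem_ball_self hr
  obtain ⟨z, s, hs0, e2⟩ := B₂.2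
  have e2' : B₂.1 = Metric.ball (h ⟨x, hs hx⟩ : X) s := by
    exact e2.trans (IsUltrametricDist.ball_eq_of_mem (e2.subset (h ⟨x, hs hx⟩).2))
  have hball : IsBall (Set.range fun y : B₃.1 => (h ⟨y, hs y.2⟩ : X)) := by
    refine ⟨h ⟨x, hs hx⟩, min (C * r) s, by positivity, ?_⟩
    ext w
    constructor
    · rintro ⟨y, rfl⟩
      have h1 := hd ⟨y, hs y.2⟩ ⟨x, hs hx⟩
      rw [Subtype.dist_eq, Subtype.dist_eq] at h1
      have h2 : (h ⟨y, hs y.2⟩ : X) ∈ Metric.ball (h ⟨x, hs hx⟩ : X) s := e2'.subset (h _).2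
      have h3 : dist (y : X) x < r := e.subset y.2
      simp only [Metric.mem_ball, lt_min_iff] at h2 ⊢
      exact ⟨by rw [h1]; exact mul_lt_mul_of_pos_left h3 hC, h2⟩
    · intro hw
      simp only [Metric.mem_ball, lt_min_iff] at hw
      have hw2 : w ∈ B₂.1 := by
        rw [e2']
        exact hw.2
      have h1 := hd (h.symm ⟨w, hw2⟩) ⟨x, hs hx⟩
      rw [Equiv.apply_symm_apply, Subtype.dist_eq, Subtype.dist_eq] at h1
      have h3 : (h.symm ⟨w, hw2⟩ : X) ∈ B₃.1 := by
        rw [e, Metric.mem_ball]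
        refine lt_of_mul_lt_mul_left ?_ hC.le
        rw [← h1]
        exact hw.1
      exact ⟨⟨_, h3⟩, by simp⟩
  exact ⟨⟨_, hball⟩, S.restrict_mem B₁ B₂ B₃ ⟨_, hball⟩ h hh hs rfl⟩

/-- The group of all homeomorphisms that are locally determined by `S`. -/
def group {X : Type*} [MetricSpace X] [IsUltrametricDist X] (S : FiniteSimilarityStructure X) :
    Subgroup (X ≃ₜ X) where
  carrier := {h | S.LocallyDetermined h}
  one_mem' := fun x => ⟨⟨_, x, 1, one_pos, rfl⟩, ⟨_, x, 1, one_pos, rfl⟩,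
    Metric.mem_ball_self one_pos, _, S.refl_mem _, fun _ => rfl⟩
  mul_mem' := by
    intro g h hg hh x
    obtain ⟨B, B', hx, σ, hσ, eσ⟩ := hh x
    obtain ⟨D, D', hy, τ, hτ, eτ⟩ := hg (h x)
    have hx' : h x ∈ B'.1 := by
      rw [eσ ⟨x, hx⟩]
      exact (σ _).2
    have hE : ∃ E : Ball X, h x ∈ E.1 ∧ E.1 ⊆ B'.1 ∧ E.1 ⊆ D.1 := by
      obtain ⟨b, r, hr, e⟩ := B'.2
      obtain ⟨d, s, hs, e'⟩ := D.2
      rw [e] at hx' ⊢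
      rw [e'] at hy ⊢
      rw [IsUltrametricDist.ball_eq_of_mem hx', IsUltrametricDist.ball_eq_of_mem hy]
      exact ⟨⟨_, h x, min r s, lt_min hr hs, rfl⟩, Metric.mem_ball_self (lt_min hr hs),
        Metric.ball_subset_ball (min_le_left _ _), Metric.ball_subset_ball (min_le_right _ _)⟩
    obtain ⟨E, hE, h1, h2⟩ := hE
    obtain ⟨F, ρ, hρ, eρ⟩ := S.exists_restrict (S.symm_mem _ _ σ hσ) E h1
    obtain ⟨G, π, hπ, eπ⟩ := S.exists_restrict hτ E h2
    have hρh : ∀ y : F.1, h y = (ρ.symm y : X) := by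
      intro y
      have h3 := eρ (ρ.symm y)
      rw [Equiv.apply_symm_apply] at h3
      rw [h3, eσ, Equiv.apply_symm_apply]
    refine ⟨F, G, ?_, ρ.symm.trans π, S.trans_mem _ _ _ _ (S.symm_mem _ _ _ hρ) _ hπ, ?_⟩
    · have h3 := eρ ⟨h x, hE⟩
      have h4 : (⟨h x, h1 hE⟩ : B'.1) = σ ⟨x, hx⟩ := Subtype.ext (eσ ⟨x, hx⟩)
      simp only [h4, Equiv.symm_apply_apply] at h3
      rw [← h3]
      exact (ρ _).2
    · intro y
      change g (h y) = _
      rw [hρh, Equiv.trans_apply, eπ]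
      exact eτ ⟨_, h2 (ρ.symm y).2⟩
  inv_mem' := by
    intro h hh x
    obtain ⟨B, B', hx, σ, hσ, eσ⟩ := hh (h⁻¹ x)
    have hhx : h (h⁻¹ x) = x := h.apply_symm_apply x
    refine ⟨B', B, ?_, σ.symm, S.symm_mem _ _ _ hσ, ?_⟩
    · rw [← hhx, eσ ⟨_, hx⟩]
      exact (σ _).2
    · intro y
      have h1 := eσ (σ.symm y)
      rw [Equiv.apply_symm_apply] at h1
      rw [← h1]
      exact h.symm_apply_apply _

end FiniteSimilarityStructure

/-! A permutation `h` of the vertices is a quasi-automorphism exactly when `exceptions h` is finite,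
because the order condition already controls adjacency (`mem_QAut_iff`). Then `h` carries the
subtree below every vertex outside a finite set `irregular h` canonically onto another subtree.

For (i), a wire labelled `x` is read as carrying a function on the whole tree, and a wire labelled
`a` as carrying a constant function, that is, the value at one vertex. A transistor with top label
`x` (a splitting) cuts a function into its restriction to the left subtree, its value at the root
and its restriction to the right subtree; a transistor with bottom label `x` (a joining) does the
reverse. When the identity enters at the top of the frame, a function `eval` leaves at the bottom.
It is unchanged by equivalence and dipoles, turns concatenation into composition, and is inverted by
turning the diagram upside down. This gives `diagramGroupToQAut`.

This map is onto: `normalForm h` has one splitting for each irregular vertex of the inverse of `h`,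
one joining for each irregular vertex of `h`, and a wire between any two contacts that have to carry
the same value. It is one-to-one: every diagram reduces to one without dipoles, and such a diagram
is rigid. No splitting lies directly below a joining, so the splittings cut the tree from the root
downwards; a cut at a regular vertex would be undone by a joining and produce a dipole, while a cut
at an irregular vertex cannot be avoided. Upside down, the same holds for joinings, so a reduced
diagram is equivalent to the normal form of its permutation (`Evaluates.equivalent_normalForm`).

For (iii), the space consists of the vertices and ends of the tree. Its balls are the cones below
vertices and the single vertices, and the similarity structure contains only the canonical map
between two cones and the map between two single vertices. By compactness an element of the group is
given by finitely many such pieces, of which only the single vertices can contribute exceptions.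
Conversely, a quasi-automorphism extends to the ends through the cones at regular vertices. Since
the vertices are dense, restriction to them is an isomorphism (`groupToQAut`). -/

/-! ### Quasi-automorphisms as permutations that commute with almost all child maps -/

/-- The vertices below which `h` does not preserve some edge. -/
def exceptions (h : List Bool → List Bool) : Set (List Bool) := {v | ∃ b, h (b :: v) ≠ b :: h v}

theorem not_preservesOrder_iff (h : Equiv.Perm (List Bool)) (v : List Bool) :
    (¬ ∀ u u', EdgeLeftOf v u u' → EdgeLeftOf (h v) (h u) (h u')) ↔ v ∈ exceptions h := by
  simp only [EdgeLeftOf, leftChild, rightChild, exceptions, Set.mem_ofPred_eq, Bool.exists_bool]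
  constructor
  · intro H
    by_contra hc
    push Not at hc
    exact H (by rintro _ _ ⟨rfl, rfl⟩; exact hc)
  · intro H hc
    obtain ⟨h1, h2⟩ := hc _ _ ⟨rfl, rfl⟩
    exact H.elim (· h1) (· h2)

theorem almostPreservesOrder_iff (h : Equiv.Perm (List Bool)) :
    AlmostPreservesOrder h ↔ (exceptions h).Finite := by
  unfold AlmostPreservesOrder
  simp only [not_preservesOrder_iff]
  rfl

theorem binaryTree_adj_iff {v w : List Bool} :
    binaryTree.Adj v w ↔ (∃ b, w = b :: v) ∨ ∃ b, v = b :: w := by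
  simp only [binaryTree, SimpleGraph.fromRel_adj, leftChild, rightChild, Bool.exists_bool]
  constructor
  · exact fun h => h.2
  · refine fun h => ⟨?_, h⟩
    rintro rfl
    simp at h

theorem exceptions_inv (h : Equiv.Perm (List Bool)) :
    exceptions (h⁻¹ : Equiv.Perm (List Bool)) = h '' exceptions h := by
  ext w
  constructor
  · rintro ⟨b, hb⟩
    refine ⟨h⁻¹ w, ⟨b, fun e => hb ?_⟩, h.apply_symm_apply w⟩
    rw [← h.injective.eq_iff, e]
    simp
  · rintro ⟨v, ⟨b, hb⟩, rfl⟩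
    refine ⟨b, fun e => hb ?_⟩
    rw [← h.symm.injective.eq_iff]
    simpa using e.symm

/-- A lost edge has an exceptional upper end, and each exceptional vertex accounts for two edges,
each in two orientations. -/
theorem finite_adj_not_adj {h : Equiv.Perm (List Bool)} (hf : (exceptions h).Finite) :
    {p : List Bool × List Bool | binaryTree.Adj p.1 p.2 ∧
      ¬ binaryTree.Adj (h p.1) (h p.2)}.Finite := by
  have hfin := hf.prod (Set.finite_univ (α := Bool))
  refine ((hfin.image fun p => (p.1, p.2 :: p.1)).union
    (hfin.image fun p => (p.2 :: p.1, p.1))).subset ?_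
  rintro ⟨v, w⟩ ⟨h1, h2⟩
  simp only [binaryTree_adj_iff, not_or, not_exists] at h1 h2
  obtain ⟨b, rfl⟩ | ⟨b, rfl⟩ := h1
  · exact Or.inl ⟨(v, b), ⟨⟨b, h2.1 b⟩, trivial⟩, rfl⟩
  · exact Or.inr ⟨(w, b), ⟨⟨b, h2.2 b⟩, trivial⟩, rfl⟩

/-- The order condition suffices: edges lost by `h` lie below its exceptions, and edges created by
`h` are edges lost by the inverse, whose exceptions are the images of those of `h`. -/
theorem mem_QAut_iff (h : Equiv.Perm (List Bool)) : h ∈ QAut ↔ (exceptions h).Finite := by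
  refine ⟨fun H => (almostPreservesOrder_iff h).1 H.2, fun hf =>
    ⟨?_, (almostPreservesOrder_iff h).2 hf⟩⟩
  have hf' : (exceptions (h⁻¹ : Equiv.Perm (List Bool))).Finite := by
    rw [exceptions_inv]
    exact hf.image h
  refine ((finite_adj_not_adj hf).union ((finite_adj_not_adj hf').image
    (Prod.map (h⁻¹ : Equiv.Perm (List Bool)) (h⁻¹ : Equiv.Perm (List Bool))))).subset ?_
  rintro ⟨v, w⟩ hp
  by_cases h1 : binaryTree.Adj v w
  · exact Or.inl ⟨h1, fun h2 => hp (by simp [h1, h2])⟩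
  · have h2 : binaryTree.Adj (h v) (h w) := by
      by_contra h2
      exact hp (by simp [h1, h2])
    exact Or.inr ⟨(h v, h w), ⟨h2, by simpa using h1⟩, by simp⟩

/-! ### Subtrees that are mapped canonically -/

/-- The vertices `q` such that `h` does not map the subtree with root `q` in the canonical way onto
a subtree. -/
def irregular (h : List Bool → List Bool) : Set (List Bool) := {q | ∃ s, h (s ++ q) ≠ s ++ h q}

theorem notMem_irregular {h : List Bool → List Bool} {q : List Bool} :
    q ∉ irregular h ↔ ∀ s, h (s ++ q) = s ++ h q := by
  simp [irregular]

/-- Hence the irregular vertices are closed under passing to ancestors. -/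
theorem append_notMem_irregular {h : List Bool → List Bool} {q : List Bool} (s : List Bool)
    (hq : q ∉ irregular h) : s ++ q ∉ irregular h := by
  rw [notMem_irregular] at hq ⊢
  intro s'
  rw [← List.append_assoc, hq, hq, List.append_assoc]

theorem notMem_irregular_inv {h : Equiv.Perm (List Bool)} {p q : List Bool}
    (hp : ∀ s, h (s ++ q) = s ++ p) : p ∉ irregular (h⁻¹ : Equiv.Perm (List Bool)) := by
  rw [notMem_irregular]
  intro s
  have e : h⁻¹ p = q := by
    rw [Equiv.Perm.inv_eq_iff_eq]
    exact (hp []).symm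
  rw [e, Equiv.Perm.inv_eq_iff_eq, hp]

/-- On the path `s` below an irregular `q`, some edge is the first not to be preserved, so `q` is an
ancestor of an exception. Ancestors are suffixes, since the last choice comes first. -/
theorem irregular_finite {h : List Bool → List Bool} (hf : (exceptions h).Finite) :
    (irregular h).Finite := by
  refine (hf.biUnion (t := fun v => {q | q ∈ v.tails}) fun v _ => List.finite_toSet _).subset ?_
  rintro q ⟨s, hs⟩
  simp only [Set.mem_iUnion, Set.mem_ofPred_eq, List.mem_tails, exists_prop]
  induction s with
  | nil => exact absurd rfl hs
  | cons b s ih =>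
    by_cases hc : h (s ++ q) = s ++ h q
    · exact ⟨s ++ q, ⟨b, fun e => hs (by simpa [hc] using e)⟩, List.suffix_append s q⟩
    · exact ih hc

/-! ### Turning diagrams upside down, induction along wires, existence of reductions -/

/-- The wire turned upside down. -/
def Wire.flip {T : Type} {A : Type*} (W : Wire T A) : Wire T A := ⟨W.bot, W.label, W.top⟩

namespace BraidedDiagram

variable {A : Type*} {P : SemigroupPresentation A} {u v : List A}

theorem below_flip {T : Type} {wires : Set (Wire T A)} :
    Below {W | W.flip ∈ wires} = Function.swap (Below wires) := by
  ext s t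
  constructor
  · rintro ⟨W, hW, h1, h2⟩
    exact ⟨W.flip, hW, h2, h1⟩
  · rintro ⟨W, hW, h1, h2⟩
    exact ⟨W.flip, hW, h2, h1⟩

/-- The diagram turned upside down. -/
def flip (Δ : BraidedDiagram P u v) : BraidedDiagram P v u where
  T := Δ.T
  finite := Δ.finite
  wires := {W | W.flip ∈ Δ.wires}
  nonempty := by
    obtain ⟨W, hW⟩ := Δ.nonempty
    exact ⟨W.flip, hW⟩
  topLabel := Δ.botLabel
  botLabel := Δ.topLabel
  top_inj W hW W' hW' h := congrArg Wire.flip (Δ.bot_inj _ hW _ hW' h)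
  bot_inj W hW W' hW' h := congrArg Wire.flip (Δ.top_inj _ hW _ hW' h)
  read_top o i a := (Δ.read_bot o i a).trans
    ⟨fun ⟨W, hW, h⟩ => ⟨W.flip, hW, h⟩, fun ⟨W, hW, h⟩ => ⟨W.flip, hW, h⟩⟩
  read_bot o i a := (Δ.read_top o i a).trans
    ⟨fun ⟨W, hW, h⟩ => ⟨W.flip, hW, h⟩, fun ⟨W, hW, h⟩ => ⟨W.flip, hW, h⟩⟩
  rel t := (Δ.rel t).symm
  acyclic t h := by
    rw [below_flip, Relation.transGen_swap] at h
    exact Δ.acyclic t h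

theorem flip_mem_flip {Δ : BraidedDiagram P u v} {W : Wire Δ.T A} (hW : W ∈ Δ.wires) :
    W.flip ∈ Δ.flip.wires := hW

theorem wellFounded_below (Δ : BraidedDiagram P u v) : WellFounded (Below Δ.wires) := by
  have := Δ.finite
  have : Std.Irrefl (Relation.TransGen (Below Δ.wires)) := ⟨Δ.acyclic⟩
  exact Subrelation.wf (fun h => Relation.TransGen.single h)
    (Finite.wellFounded_of_trans_of_irrefl (Relation.TransGen (Below Δ.wires)))

theorem wellFounded_above (Δ : BraidedDiagram P u v) :
    WellFounded (Function.swap (Below Δ.wires)) := by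
  have := Δ.flip.wellFounded_below
  rwa [flip, below_flip] at this

/-- Induction from the top of a diagram to its bottom. -/
theorem wire_induction (Δ : BraidedDiagram P u v) {C : Wire Δ.T A → Prop}
    (frame : ∀ W ∈ Δ.wires, W.top.1 = none → C W)
    (step : ∀ t, (∀ W ∈ Δ.wires, W.bot.1 = some t → C W) →
      ∀ W ∈ Δ.wires, W.top.1 = some t → C W) : ∀ W ∈ Δ.wires, C W := by
  have key : ∀ t, ∀ W ∈ Δ.wires, W.top.1 = some t → C W := by
    intro t
    induction t using Δ.wellFounded_above.induction with
    | _ t ih =>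
      refine step t fun W hW hb => ?_
      rcases ht : W.top.1 with _ | t'
      · exact frame W hW ht
      · exact ih t' ⟨W, hW, ht, hb⟩ W hW ht
  intro W hW
  rcases ht : W.top.1 with _ | t
  · exact frame W hW ht
  · exact key t W hW ht

theorem exists_wire_top (Δ : BraidedDiagram P u v) {o : Option Δ.T} {i : ℕ} {a : A}
    (h : (o.elim u Δ.botLabel)[i]? = some a) : ∃ W ∈ Δ.wires, W.top = (o, i) ∧ W.label = a :=
  (Δ.read_top o i a).1 h

theorem exists_wire_bot (Δ : BraidedDiagram P u v) {o : Option Δ.T} {i : ℕ} {a : A}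
    (h : (o.elim v Δ.topLabel)[i]? = some a) : ∃ W ∈ Δ.wires, W.bot = (o, i) ∧ W.label = a :=
  (Δ.read_bot o i a).1 h

theorem getElem?_of_top {Δ : BraidedDiagram P u v} {W : Wire Δ.T A} (hW : W ∈ Δ.wires)
    {o : Option Δ.T} {i : ℕ} (h : W.top = (o, i)) :
    (o.elim u Δ.botLabel)[i]? = some W.label :=
  (Δ.read_top o i _).2 ⟨W, hW, h, rfl⟩

theorem getElem?_of_bot {Δ : BraidedDiagram P u v} {W : Wire Δ.T A} (hW : W ∈ Δ.wires)
    {o : Option Δ.T} {i : ℕ} (h : W.bot = (o, i)) :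
    (o.elim v Δ.topLabel)[i]? = some W.label :=
  (Δ.read_bot o i _).2 ⟨W, hW, h, rfl⟩

theorem IsDipole.flip {Δ : BraidedDiagram P u v} {T₁ T₂ : Δ.T} (h : Δ.IsDipole T₁ T₂) :
    Δ.flip.IsDipole T₂ T₁ := by
  obtain ⟨⟨W, hW, ht, hb⟩, hl, hw⟩ := h
  exact ⟨⟨W.flip, hW, hb, ht⟩, hl.symm, fun W hW i => (hw W.flip hW i).symm⟩

/-! ### Reduction of a single dipole -/

/-- The wires of the diagram in which the dipole `(T₁, T₂)` has been reduced. -/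
def reduceWires (Δ : BraidedDiagram P u v) (T₁ T₂ : Δ.T) :
    Set (Wire {t // t ≠ T₁ ∧ t ≠ T₂} A) :=
  {W | W.map Subtype.val ∈ Δ.wires ∨
    ∃ V₂ ∈ Δ.wires, ∃ V₁ ∈ Δ.wires, ∃ i : ℕ, V₂.bot = (some T₂, i) ∧ V₁.top = (some T₁, i) ∧
      W.map Subtype.val = ⟨V₂.top, V₂.label, V₁.bot⟩}

theorem Contact.exists_map_val {T : Type} {p : T → Prop} {c : Contact T}
    (h : ∀ t, c.1 = some t → p t) : ∃ c' : Contact {t // p t}, c'.map Subtype.val = c := by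
  obtain ⟨_ | t, i⟩ := c
  · exact ⟨(none, i), rfl⟩
  · exact ⟨(some ⟨t, h t rfl⟩, i), rfl⟩

theorem Contact.map_val_ne {T : Type} {p : T → Prop} {t : T} (h : ¬ p t)
    (c : Contact {t // p t}) (i : ℕ) : c.map Subtype.val ≠ (some t, i) := by
  obtain ⟨_ | s, j⟩ := c
  · simp [Contact.map]
  · rintro e
    simp only [Contact.map, Option.map_some, Prod.mk.injEq, Option.some.injEq] at e
    exact h (e.1 ▸ s.2)

theorem IsDipole.label_eq_of_glue {Δ : BraidedDiagram P u v} {T₁ T₂ : Δ.T}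
    (hd : Δ.IsDipole T₁ T₂) {V₁ V₂ : Wire Δ.T A} (h₂ : V₂ ∈ Δ.wires) (h₁ : V₁ ∈ Δ.wires) {i : ℕ}
    (e₂ : V₂.bot = (some T₂, i)) (e₁ : V₁.top = (some T₁, i)) : V₂.label = V₁.label := by
  have a := getElem?_of_bot h₂ e₂
  have b := getElem?_of_top h₁ e₁
  simp only [Option.elim_some] at a b
  rw [hd.2.1] at b
  exact Option.some.inj (a.symm.trans b)

/-- Reduction commutes with turning upside down, so bottom contacts need no separate injectivity
argument. A glued wire records the label of its upper half, which is also that of its lower half. -/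
theorem IsDipole.reduceWires_flip {Δ : BraidedDiagram P u v} {T₁ T₂ : Δ.T}
    (hd : Δ.IsDipole T₁ T₂) {W : Wire {t // t ≠ T₁ ∧ t ≠ T₂} A} (hW : W ∈ Δ.reduceWires T₁ T₂) :
    W.flip.map Subtype.val ∈ Δ.flip.wires ∨
    ∃ V₂ ∈ Δ.flip.wires, ∃ V₁ ∈ Δ.flip.wires, ∃ i : ℕ, V₂.bot = (some T₁, i) ∧
      V₁.top = (some T₂, i) ∧ W.flip.map Subtype.val = ⟨V₂.top, V₂.label, V₁.bot⟩ := by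
  obtain h | ⟨V₂, h₂, V₁, h₁, i, e₂, e₁, e⟩ := hW
  · exact Or.inl h
  · refine Or.inr ⟨V₁.flip, h₁, V₂.flip, h₂, i, e₁, e₂, ?_⟩
    have e' := congrArg Wire.flip e
    rw [hd.label_eq_of_glue h₂ h₁ e₂ e₁] at e'
    exact e'

/-- Two wires of the reduced diagram with the same top contact agree. -/
theorem IsDipole.reduce_top_inj {Δ : BraidedDiagram P u v} {T₁ T₂ : Δ.T}
    {p : Δ.T → Prop} (hp : ¬ p T₂)
    {W W' : Wire {t // p t} A}
    (hW : W.map Subtype.val ∈ Δ.wires ∨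
    ∃ V₂ ∈ Δ.wires, ∃ V₁ ∈ Δ.wires, ∃ i : ℕ, V₂.bot = (some T₂, i) ∧ V₁.top = (some T₁, i) ∧
      W.map Subtype.val = ⟨V₂.top, V₂.label, V₁.bot⟩)
    (hW' : W'.map Subtype.val ∈ Δ.wires ∨
    ∃ V₂ ∈ Δ.wires, ∃ V₁ ∈ Δ.wires, ∃ i : ℕ, V₂.bot = (some T₂, i) ∧ V₁.top = (some T₁, i) ∧
      W'.map Subtype.val = ⟨V₂.top, V₂.label, V₁.bot⟩) (h : W.top = W'.top) : W = W' := by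
  have hbot : ∀ (X : Wire {t // p t} A) (i : ℕ), (X.map Subtype.val).bot ≠ (some T₂, i) :=
    fun X i => Contact.map_val_ne hp _ i
  have ht : (W.map Subtype.val).top = (W'.map Subtype.val).top := by simp [Wire.map, h]
  refine Wire.map_injective Subtype.val_injective ?_
  obtain h | ⟨V₂, h₂, V₁, h₁, i, e₂, e₁, e⟩ := hW <;>
    obtain k | ⟨U₂, k₂, U₁, k₁, j, c₂, c₁, c⟩ := hW'
  · exact Δ.top_inj _ h _ k ht
  · refine absurd ?_ (hbot W j)
    rw [Δ.top_inj _ h _ k₂ (by rw [ht, c]), c₂]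
  · refine absurd ?_ (hbot W' i)
    rw [Δ.top_inj _ k _ h₂ (by rw [← ht, e]), e₂]
  · obtain rfl := Δ.top_inj _ k₂ _ h₂ (by rw [e, c] at ht; exact ht.symm)
    obtain rfl : i = j := by simpa using e₂.symm.trans c₂
    obtain rfl := Δ.top_inj _ k₁ _ h₁ (c₁.trans e₁.symm)
    rw [e, c]

/-- A wire ending at `T₁` starts at `T₂`, so its top contact does not survive. A wire ending at `T₂`
is continued by the wire at the same position below `T₁`; by acyclicity this one ends at neither
transistor of the dipole. -/
theorem IsDipole.reduce_exists_top {Δ : BraidedDiagram P u v} {T₁ T₂ : Δ.T}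
    (hd : Δ.IsDipole T₁ T₂) {V : Wire Δ.T A} (hV : V ∈ Δ.wires)
    {c : Contact {t // t ≠ T₁ ∧ t ≠ T₂}} (hc : c.map Subtype.val = V.top) :
    ∃ W ∈ Δ.reduceWires T₁ T₂, W.top = c ∧ W.label = V.label := by
  have hb1 : ∀ t, V.bot.1 = some t → t ≠ T₁ := by
    rintro t ht rfl
    have := (hd.2.2 V hV V.bot.2).2 (Prod.ext ht rfl)
    exact Contact.map_val_ne (by simp) c _ (hc.trans this)
  by_cases h2 : V.bot.1 = some T₂
  · have a := getElem?_of_bot hV (o := some T₂) (i := V.bot.2) (Prod.ext h2 rfl)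
    rw [Option.elim_some, ← hd.2.1] at a
    obtain ⟨V₁, h₁, e₁, el⟩ := Δ.exists_wire_top (o := some T₁) a
    have : ∀ t, V₁.bot.1 = some t → t ≠ T₁ ∧ t ≠ T₂ := by
      rintro t ht
      constructor
      · rintro rfl
        exact Δ.acyclic _ (.single ⟨V₁, h₁, by rw [e₁], ht⟩)
      · rintro rfl
        exact Δ.acyclic _ (.tail (.single ⟨V₁, h₁, by rw [e₁], ht⟩) hd.1)
    obtain ⟨c', hc'⟩ := Contact.exists_map_val this
    exact ⟨⟨c, V.label, c'⟩, Or.inr ⟨V, hV, V₁, h₁, _, Prod.ext h2 rfl, e₁,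
      by simp [Wire.map, hc, hc']⟩, rfl, rfl⟩
  · obtain ⟨c', hc'⟩ := Contact.exists_map_val (c := V.bot) (p := fun t => t ≠ T₁ ∧ t ≠ T₂)
      fun t ht => ⟨hb1 t ht, by rintro rfl; exact h2 ht⟩
    exact ⟨⟨c, V.label, c'⟩, Or.inl (by simpa [Wire.map, hc, hc'] using hV), rfl, rfl⟩

theorem IsDipole.reduce_exists_bot {Δ : BraidedDiagram P u v} {T₁ T₂ : Δ.T}
    (hd : Δ.IsDipole T₁ T₂) {V : Wire Δ.T A} (hV : V ∈ Δ.wires)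
    {c : Contact {t // t ≠ T₁ ∧ t ≠ T₂}} (hc : c.map Subtype.val = V.bot) :
    ∃ W ∈ Δ.reduceWires T₁ T₂, W.bot = c ∧ W.label = V.label := by
  have hb2 : ∀ t, V.top.1 = some t → t ≠ T₂ := by
    rintro t ht rfl
    have := (hd.2.2 V hV V.top.2).1 (Prod.ext ht rfl)
    exact Contact.map_val_ne (by simp) c _ (hc.trans this)
  by_cases h1 : V.top.1 = some T₁
  · have a := getElem?_of_top hV (o := some T₁) (i := V.top.2) (Prod.ext h1 rfl)
    rw [Option.elim_some, hd.2.1] at a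
    obtain ⟨V₂, h₂, e₂, el⟩ := Δ.exists_wire_bot (o := some T₂) a
    have : ∀ t, V₂.top.1 = some t → t ≠ T₁ ∧ t ≠ T₂ := by
      rintro t ht
      constructor
      · rintro rfl
        exact Δ.acyclic _ (.tail (.single ⟨V₂, h₂, ht, by rw [e₂]⟩) hd.1)
      · rintro rfl
        exact Δ.acyclic _ (.single ⟨V₂, h₂, ht, by rw [e₂]⟩)
    obtain ⟨c', hc'⟩ := Contact.exists_map_val this
    exact ⟨⟨c', V₂.label, c⟩, Or.inr ⟨V₂, h₂, V, hV, _, e₂, Prod.ext h1 rfl,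
      by simp [Wire.map, hc, hc']⟩, rfl, el⟩
  · obtain ⟨c', hc'⟩ := Contact.exists_map_val (c := V.top) (p := fun t => t ≠ T₁ ∧ t ≠ T₂)
      fun t ht => ⟨by rintro rfl; exact h1 ht, hb2 t ht⟩
    exact ⟨⟨c', V.label, c⟩, Or.inl (by simpa [Wire.map, hc, hc'] using hV), rfl, rfl⟩

/-- A glued wire stands for a descent through `T₂` and `T₁`, so reduction creates no cycles. -/
theorem IsDipole.reduce_below {Δ : BraidedDiagram P u v} {T₁ T₂ : Δ.T}
    (hd : Δ.IsDipole T₁ T₂) {s t : {t // t ≠ T₁ ∧ t ≠ T₂}}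
    (h : Below (Δ.reduceWires T₁ T₂) s t) : Relation.TransGen (Below Δ.wires) s t := by
  obtain ⟨W, hW, ht, hb⟩ := h
  have ht' : (W.map Subtype.val).top.1 = some t.1 := by simp [Wire.map, Contact.map, ht]
  have hb' : (W.map Subtype.val).bot.1 = some s.1 := by simp [Wire.map, Contact.map, hb]
  obtain h | ⟨V₂, h₂, V₁, h₁, i, e₂, e₁, e⟩ := hW
  · exact .single ⟨_, h, ht', hb'⟩
  · rw [e] at ht' hb'
    exact ((Relation.TransGen.single ⟨V₁, h₁, by rw [e₁], hb'⟩).tail hd.1).tail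
      ⟨V₂, h₂, ht', by rw [e₂]⟩

/-- The diagram in which the dipole `(T₁, T₂)` has been reduced. -/
def reduce (Δ : BraidedDiagram P u v) (hu : u ≠ []) {T₁ T₂ : Δ.T} (hd : Δ.IsDipole T₁ T₂) :
    BraidedDiagram P u v where
  T := {t // t ≠ T₁ ∧ t ≠ T₂}
  finite := by
    have := Δ.finite
    infer_instance
  wires := Δ.reduceWires T₁ T₂
  nonempty := by
    obtain ⟨a, u', rfl⟩ := List.exists_cons_of_ne_nil hu
    obtain ⟨V, hV, e, -⟩ := Δ.exists_wire_top (o := none) (i := 0) (a := a) rfl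
    obtain ⟨W, hW, -⟩ := hd.reduce_exists_top hV (c := (none, 0)) e.symm
    exact ⟨W, hW⟩
  topLabel t := Δ.topLabel t
  botLabel t := Δ.botLabel t
  top_inj W hW W' hW' h := IsDipole.reduce_top_inj (by simp) hW hW' h
  bot_inj W hW W' hW' h := congrArg Wire.flip (IsDipole.reduce_top_inj (by simp)
    (hd.reduceWires_flip hW) (hd.reduceWires_flip hW') h)
  read_top o i a := by
    have e : o.elim u (fun t => Δ.botLabel t) = (o.map Subtype.val).elim u Δ.botLabel := by
      cases o <;> rfl
    rw [e, Δ.read_top]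
    constructor
    · rintro ⟨V, hV, e, rfl⟩
      exact hd.reduce_exists_top hV (c := (o, i)) e.symm
    · rintro ⟨W, h | ⟨V₂, h₂, V₁, h₁, j, e₂, e₁, e⟩, ht, rfl⟩
      · exact ⟨_, h, by simp [Wire.map, Contact.map, ht], rfl⟩
      · refine ⟨V₂, h₂, ?_, (congrArg Wire.label e).symm⟩
        refine (congrArg Wire.top e).symm.trans ?_
        simp [Wire.map, Contact.map, ht]
  read_bot o i a := by
    have e : o.elim v (fun t => Δ.topLabel t) = (o.map Subtype.val).elim v Δ.topLabel := by
      cases o <;> rfl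
    rw [e, Δ.read_bot]
    constructor
    · rintro ⟨V, hV, e, rfl⟩
      exact hd.reduce_exists_bot hV (c := (o, i)) e.symm
    · rintro ⟨W, h | ⟨V₂, h₂, V₁, h₁, j, e₂, e₁, e⟩, ht, rfl⟩
      · exact ⟨_, h, by simp [Wire.map, Contact.map, ht], rfl⟩
      · refine ⟨V₁, h₁, ?_, ?_⟩
        · refine (congrArg Wire.bot e).symm.trans ?_
          simp [Wire.map, Contact.map, ht]
        · rw [← hd.label_eq_of_glue h₂ h₁ e₂ e₁]
          exact (congrArg Wire.label e).symm
  rel t := Δ.rel t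
  acyclic t h := by
    refine Δ.acyclic t ?_
    have key : ∀ s t, Relation.TransGen (Below (Δ.reduceWires T₁ T₂)) s t →
        Relation.TransGen (Below Δ.wires) s t := by
      intro s t h
      induction h with
      | single h => exact hd.reduce_below h
      | tail _ h ih => exact ih.trans (hd.reduce_below h)
    exact key t t h

theorem reducesTo_reduce (Δ : BraidedDiagram P u v) (hu : u ≠ []) {T₁ T₂ : Δ.T}
    (hd : Δ.IsDipole T₁ T₂) : Δ.ReducesTo (Δ.reduce hu hd) :=
  ⟨T₁, T₂, Subtype.val, hd, Subtype.val_injective, Subtype.range_val, fun _ => rfl, fun _ => rfl,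
    fun _ => Iff.rfl⟩

/-- A diagram without dipoles. -/
def IsReduced (Δ : BraidedDiagram P u v) : Prop := ∀ T₁ T₂, ¬ Δ.IsDipole T₁ T₂

theorem IsReduced.flip {Δ : BraidedDiagram P u v} (h : Δ.IsReduced) : Δ.flip.IsReduced :=
  fun T₁ T₂ hd => h T₂ T₁ hd.flip

/-- Each reduction lowers the number of transistors. -/
theorem exists_isReduced (hu : u ≠ []) (Δ : BraidedDiagram P u v) :
    ∃ Δ' : BraidedDiagram P u v, Δ'.IsReduced ∧ Δ.DipoleEquiv Δ' := by
  induction hn : Nat.card Δ.T using Nat.strong_induction_on generalizing Δ with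
  | _ n ih =>
    by_cases h : Δ.IsReduced
    · exact ⟨Δ, h, .refl _⟩
    · simp only [IsReduced, not_forall, not_not] at h
      obtain ⟨T₁, T₂, hd⟩ := h
      have := Δ.finite
      have hlt : Nat.card (Δ.reduce hu hd).T < n := by
        rw [← hn]
        exact Finite.card_subtype_lt (x := T₁) (by simp)
      obtain ⟨Δ', h1, h2⟩ := ih _ hlt _ rfl
      exact ⟨Δ', h1, .trans _ _ _ (.rel _ _ (Or.inr (Δ.reducesTo_reduce hu hd))) h2⟩

end BraidedDiagram

/-! ### The permutation of the tree defined by a diagram -/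

section Join

variable {Y Z : Type*}

/-- The function on the vertices of the tree that is given by `f` on the left subtree, by the value
of `g` at the root, and by `k` on the right subtree. -/
def join (f g k : List Bool → Y) (s : List Bool) : Y :=
  match s.getLast? with
  | none => g []
  | some false => f s.dropLast
  | some true => k s.dropLast

@[simp] theorem join_nil (f g k : List Bool → Y) : join f g k [] = g [] := rfl

@[simp] theorem join_append_false (f g k : List Bool → Y) (s : List Bool) :
    join f g k (s ++ [false]) = f s := by
  simp [join]

@[simp] theorem join_append_true (f g k : List Bool → Y) (s : List Bool) :
    join f g k (s ++ [true]) = k s := by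
  simp [join]

theorem comp_join (r : Y → Z) (f g k : List Bool → Y) :
    r ∘ join f g k = join (r ∘ f) (r ∘ g) (r ∘ k) := by
  funext s
  obtain rfl | ⟨s, _ | _, rfl⟩ := List.eq_nil_or_concat' s <;> simp

theorem join_restrict (f : List Bool → Y) :
    join (fun s => f (s ++ [false])) (fun _ => f []) (fun s => f (s ++ [true])) = f := by
  funext s
  obtain rfl | ⟨s, _ | _, rfl⟩ := List.eq_nil_or_concat' s <;> simp

/-- `join` sees its middle argument only at the root, so that argument is recovered only because it
is constant. This is why wires labelled `a` must carry constant functions. -/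
theorem join_inj {f g k f' g' k' : List Bool → Y} (h : join f g k = join f' g' k')
    (hg : ∀ s, g s = g []) (hg' : ∀ s, g' s = g' []) : f = f' ∧ g = g' ∧ k = k' := by
  refine ⟨funext fun s => ?_, funext fun s => ?_, funext fun s => ?_⟩
  · simpa using congrFun h (s ++ [false])
  · rw [hg, hg']
    exact congrFun h []
  · simpa using congrFun h (s ++ [true])

/-- The function on the vertices of the tree that results from the values on the wires at a side of
a transistor with label `l`. -/
def joinWord (l : List Letter) (f : ℕ → List Bool → Y) : List Bool → Y :=
  if l.length = 1 then f 0 else join (f 0) (f 1) (f 2)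

theorem joinWord_x (f : ℕ → List Bool → Y) : joinWord [.x] f = f 0 := rfl

theorem joinWord_xax (f : ℕ → List Bool → Y) :
    joinWord [.x, .a, .x] f = join (f 0) (f 1) (f 2) := rfl

theorem comp_joinWord (r : Y → Z) (l : List Letter) (f : ℕ → List Bool → Y) :
    r ∘ joinWord l f = joinWord l (fun i => r ∘ f i) := by
  unfold joinWord
  split_ifs
  · rfl
  · rw [comp_join]

theorem joinWord_congr {l : List Letter} (hl : l = [.x] ∨ l = [.x, .a, .x])
    {f g : ℕ → List Bool → Y} (h : ∀ i c, l[i]? = some c → f i = g i) :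
    joinWord l f = joinWord l g := by
  obtain rfl | rfl := hl
  · simp [joinWord_x, h 0 .x rfl]
  · simp [joinWord_xax, h 0 .x rfl, h 1 .a rfl, h 2 .x rfl]

theorem joinWord_inj {l : List Letter} (hl : l = [.x] ∨ l = [.x, .a, .x])
    {f g : ℕ → List Bool → Y} (h : joinWord l f = joinWord l g)
    (hf : ∀ i, l[i]? = some .a → ∀ s, f i s = f i [])
    (hg : ∀ i, l[i]? = some .a → ∀ s, g i s = g i []) :
    ∀ i c, l[i]? = some c → f i = g i := by
  obtain rfl | rfl := hl
  · rintro (_ | i) c hi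
    · exact h
    · simp at hi
  · obtain ⟨h0, h1, h2⟩ := join_inj h (hf 1 rfl) (hg 1 rfl)
    rintro (_ | _ | _ | i) c hi
    exacts [h0, h1, h2, by simp at hi]

theorem exceptions_append_finite {f : List Bool → List Bool} (hf : (exceptions f).Finite)
    (b : Bool) : (exceptions fun s => f (s ++ [b])).Finite := by
  refine (hf.preimage (f := (· ++ [b])) (List.append_left_injective [b]).injOn).subset ?_
  rintro v ⟨c, hc⟩
  exact ⟨c, hc⟩

/-- Apart from the exceptions inside the two subtrees, only the root can be new. -/
theorem exceptions_join_finite {f g k : List Bool → List Bool} (hf : (exceptions f).Finite)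
    (hk : (exceptions k).Finite) : (exceptions (join f g k)).Finite := by
  refine (((hf.image (· ++ [false])).union (hk.image (· ++ [true]))).union
    (Set.finite_singleton [])).subset ?_
  rintro v ⟨b, hb⟩
  obtain rfl | ⟨s, _ | _, rfl⟩ := List.eq_nil_or_concat' v
  · exact Or.inr rfl
  · refine Or.inl (Or.inl ⟨s, ⟨b, ?_⟩, rfl⟩)
    rwa [← List.cons_append, join_append_false, join_append_false] at hb
  · refine Or.inl (Or.inr ⟨s, ⟨b, ?_⟩, rfl⟩)
    rwa [← List.cons_append, join_append_true, join_append_true] at hb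

end Join

namespace BraidedDiagram

/-! ### Values on the wires of a diagram -/

/-- The braided `(x, x)`-diagrams over `⟨a, x ∣ x = xax⟩`. -/
abbrev TreeDiagram := BraidedDiagram treePresentation [.x] [.x]

variable {Δ Δ' : TreeDiagram} {Y Z : Type*}

theorem labels (Δ : TreeDiagram) (t : Δ.T) :
    (Δ.topLabel t = [.x] ∧ Δ.botLabel t = [.x, .a, .x]) ∨
    (Δ.topLabel t = [.x, .a, .x] ∧ Δ.botLabel t = [.x]) := by
  refine (Δ.rel t).imp ?_ ?_
  · intro h
    exact Prod.mk.inj h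
  · intro h
    exact (Prod.mk.inj h).symm

theorem topLabel_eq_or (Δ : TreeDiagram) (t : Δ.T) :
    Δ.topLabel t = [.x] ∨ Δ.topLabel t = [.x, .a, .x] :=
  (Δ.labels t).imp And.left And.left

theorem botLabel_eq_or (Δ : TreeDiagram) (t : Δ.T) :
    Δ.botLabel t = [.x] ∨ Δ.botLabel t = [.x, .a, .x] :=
  (Δ.labels t).symm.imp And.right And.right

theorem eq_zero_of_getElem? {i : ℕ} {l : Letter} (h : [Letter.x][i]? = some l) :
    i = 0 ∧ l = .x := by
  obtain _ | i := i
  · exact ⟨rfl, by simpa using h.symm⟩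
  · simp at h

theorem top_eq_of_frame {W : Wire Δ.T Letter} (hW : W ∈ Δ.wires) (h : W.top.1 = none) :
    W.top = (none, 0) ∧ W.label = .x := by
  have e : W.top = (none, W.top.2) := Prod.ext h rfl
  obtain ⟨h1, h2⟩ := eq_zero_of_getElem? (getElem?_of_top hW e)
  exact ⟨Prod.ext h h1, h2⟩

theorem bot_eq_of_frame {W : Wire Δ.T Letter} (hW : W ∈ Δ.wires) (h : W.bot.1 = none) :
    W.bot = (none, 0) ∧ W.label = .x :=
  top_eq_of_frame (Δ := Δ.flip) (W := W.flip) hW h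

/-- Values on the wires of a diagram, given by functions `τ` on the top contacts and `β` on the
bottom contacts. A value is a function on the tree, constant for wires with label `a`, and the
values above and below a transistor define the same function. -/
structure IsAssignment (Δ : TreeDiagram) (τ β : Contact Δ.T → List Bool → Y) : Prop where
  wire : ∀ W ∈ Δ.wires, τ W.top = β W.bot
  const : ∀ W ∈ Δ.wires, W.label = .a → ∀ s, τ W.top s = τ W.top []
  trans : ∀ t, joinWord (Δ.topLabel t) (fun i => β (some t, i)) =
    joinWord (Δ.botLabel t) (fun i => τ (some t, i))

namespace IsAssignment

variable {τ β τ' β' : Contact Δ.T → List Bool → Y}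

/-- Splitting and joining only rearrange arguments, so they commute with any map applied to the
values. -/
theorem comp (h : IsAssignment Δ τ β) (r : Y → Z) :
    IsAssignment Δ (fun c => r ∘ τ c) (fun c => r ∘ β c) where
  wire W hW := by rw [h.wire W hW]
  const W hW ha s := congrArg r (h.const W hW ha s)
  trans t := by
    have := congrArg (r ∘ ·) (h.trans t)
    simpa only [comp_joinWord] using this

theorem flip (h : IsAssignment Δ τ β) : IsAssignment Δ.flip β τ where
  wire W hW := (h.wire W.flip hW).symm
  const W hW ha s := by
    have := h.const W.flip hW ha s
    rw [h.wire W.flip hW] at this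
    exact this
  trans t := (h.trans t).symm

theorem const_top (h : IsAssignment Δ τ β) (t : Δ.T) (i : ℕ) (hi : (Δ.botLabel t)[i]? = some .a)
    (s : List Bool) : τ (some t, i) s = τ (some t, i) [] := by
  obtain ⟨W, hW, e, ha⟩ := Δ.exists_wire_top (o := some t) hi
  rw [← e]
  exact h.const W hW ha s

/-- The values above a transistor determine the joined function, and this determines the values
below because `a`-wires are constant; induction from the top does the rest. -/
theorem unique (h : IsAssignment Δ τ β) (h' : IsAssignment Δ τ' β')
    (e : τ (none, 0) = τ' (none, 0)) : ∀ W ∈ Δ.wires, τ W.top = τ' W.top := by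
  refine Δ.wire_induction ?_ ?_
  · intro W hW ht
    rw [(top_eq_of_frame hW ht).1, e]
  · intro t ih W hW ht
    have h1 : joinWord (Δ.botLabel t) (fun i => τ (some t, i)) =
        joinWord (Δ.botLabel t) (fun i => τ' (some t, i)) := by
      rw [← h.trans, ← h'.trans]
      refine joinWord_congr (Δ.topLabel_eq_or t) fun i c hi => ?_
      obtain ⟨V, hV, eb, -⟩ := Δ.exists_wire_bot (o := some t) hi
      rw [← eb, ← h.wire V hV, ← h'.wire V hV]
      exact ih V hV (by rw [eb])
    have e2 : W.top = (some t, W.top.2) := Prod.ext ht rfl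
    have h2 := joinWord_inj (Δ.botLabel_eq_or t) h1 (h.const_top t) (h'.const_top t) _ _
      (getElem?_of_top hW e2)
    rwa [e2]

theorem bot_unique (h : IsAssignment Δ τ β) (h' : IsAssignment Δ τ' β')
    (e : τ (none, 0) = τ' (none, 0)) : β (none, 0) = β' (none, 0) := by
  obtain ⟨W, hW, eb, -⟩ := Δ.exists_wire_bot (o := none) (i := 0) (a := .x) rfl
  rw [← eb, ← h.wire W hW, ← h'.wire W hW]
  exact h.unique h' e W hW

end IsAssignment

/-! ### Propagating a function from the top of the frame -/

section Existence

/-- The values on the wires at the bottom of a transistor with top label `l`, when `b` is the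
sequence of values on the wires at its top. -/
def lowerValues (l : List Letter) (b : ℕ → List Bool → Y) (i : ℕ) : List Bool → Y :=
  if l.length = 1 then
    match i with
    | 0 => fun s => b 0 (s ++ [false])
    | 1 => fun _ => b 0 []
    | _ => fun s => b 0 (s ++ [true])
  else join (b 0) (b 1) (b 2)

open Classical in
/-- The values on the wires at the bottom of a transistor when `f` is the value at the top of the
frame. -/
noncomputable def transistorValues (Δ : TreeDiagram) (f : List Bool → Y) :
    Δ.T → ℕ → List Bool → Y :=
  Δ.wellFounded_above.fix fun t rec => lowerValues (Δ.topLabel t) fun j =>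
    if h : ∃ W ∈ Δ.wires, W.bot = (some t, j) then
      (fun (o : Option Δ.T) (ho : o = h.choose.top.1) =>
        match o, ho with
        | none, _ => f
        | some t', ho => rec t' ⟨h.choose, h.choose_spec.1, ho.symm, by rw [h.choose_spec.2]⟩
            h.choose.top.2) _ rfl
    else f

/-- The values at the top contacts when `f` is the value at the top of the frame. -/
noncomputable def topValues (Δ : TreeDiagram) (f : List Bool → Y) (c : Contact Δ.T) :
    List Bool → Y :=
  match c with
  | (none, _) => f
  | (some t, i) => Δ.transistorValues f t i

open Classical in
/-- The values at the bottom contacts when `f` is the value at the top of the frame. -/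
noncomputable def botValues (Δ : TreeDiagram) (f : List Bool → Y) (c : Contact Δ.T) :
    List Bool → Y :=
  if h : ∃ W ∈ Δ.wires, W.bot = c then Δ.topValues f h.choose.top else f

theorem topValues_some (Δ : TreeDiagram) (f : List Bool → Y) (t : Δ.T) :
    (fun i => Δ.topValues f (some t, i)) =
      lowerValues (Δ.topLabel t) (fun j => Δ.botValues f (some t, j)) := by
  change Δ.transistorValues f t = _
  unfold transistorValues
  rw [WellFounded.fix_eq]
  congr 1
  funext j
  unfold botValues
  split_ifs with h
  · have key : ∀ (o : Option Δ.T) (ho : o = h.choose.top.1),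
        (match o, ho with
        | none, _ => f
        | some t', ho => Δ.transistorValues f t' h.choose.top.2) =
        Δ.topValues f (o, h.choose.top.2) := by
      rintro (_ | _) _ <;> rfl
    exact key _ rfl
  · rfl

theorem isAssignment_values (Δ : TreeDiagram) (f : List Bool → Y) :
    IsAssignment Δ (Δ.topValues f) (Δ.botValues f) where
  wire W hW := by
    have h : ∃ V ∈ Δ.wires, V.bot = W.bot := ⟨W, hW, rfl⟩
    unfold botValues
    rw [dif_pos h, Δ.bot_inj _ h.choose_spec.1 _ hW h.choose_spec.2]
  const W hW ha s := by
    rcases ht : W.top.1 with _ | t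
    · have := (top_eq_of_frame hW ht).2
      simp [ha] at this
    · have e : W.top = (some t, W.top.2) := Prod.ext ht rfl
      have hi := getElem?_of_top hW e
      rw [ha, Option.elim_some] at hi
      have h1 := congrFun (Δ.topValues_some f t) W.top.2
      rw [← e] at h1
      rw [h1]
      obtain ⟨h2, h3⟩ | ⟨h2, h3⟩ := Δ.labels t
      · rw [h3] at hi
        rw [h2]
        -- An `a`-wire can only start at position `1` below a splitting, where `lowerValues` is
        -- constant by definition.
        rcases hn : W.top.2 with _ | _ | _ | n <;> simp [hn] at hi
        rfl
      · rw [h3] at hi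
        simpa using (eq_zero_of_getElem? hi).2
  trans t := by
    rw [topValues_some]
    obtain ⟨h2, h3⟩ | ⟨h2, h3⟩ := Δ.labels t
    · rw [h2, h3]
      exact (join_restrict _).symm
    · rw [h2, h3]
      rfl

end Existence

/-! #### The permutation defined by a diagram -/

/-- The function on the tree at the bottom of the diagram, when the identity is at the top. -/
noncomputable def eval (Δ : TreeDiagram) : List Bool → List Bool := Δ.botValues id (none, 0)

/-- The assignment starting from `id` is universal: composed with the value at the top, it has the
same top value as the given one, and uniqueness applies. All properties of `eval` below come from
choosing a suitable assignment. -/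
theorem IsAssignment.bot_eq {τ β : Contact Δ.T → List Bool → Y} (h : IsAssignment Δ τ β) :
    β (none, 0) = τ (none, 0) ∘ Δ.eval :=
  h.bot_unique ((Δ.isAssignment_values id).comp (τ (none, 0))) rfl

/-- Upside down, the assignment starting from `id` has `eval` at the top and `id` at the bottom. -/
theorem eval_comp_eval_flip (Δ : TreeDiagram) : Δ.eval ∘ Δ.flip.eval = id :=
  (Δ.isAssignment_values id).flip.bot_eq.symm

/-- Induction along the wires: a splitting restricts a function to subtrees, and a joining adds at
most one exception to those of its two `x`-wires. -/
theorem exceptions_eval_finite (Δ : TreeDiagram) : (exceptions Δ.eval).Finite := by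
  have h := Δ.isAssignment_values (id : List Bool → List Bool)
  have key : ∀ W ∈ Δ.wires, W.label = .x → (exceptions (Δ.topValues id W.top)).Finite := by
    refine Δ.wire_induction ?_ ?_
    · intro W hW ht _
      rw [(top_eq_of_frame hW ht).1]
      have : exceptions (Δ.topValues id (none, 0)) = ∅ := by
        ext v
        simp [exceptions, topValues]
      rw [this]
      exact Set.finite_empty
    · intro t ih W hW ht hx
      have hb : ∀ i, (Δ.topLabel t)[i]? = some .x →
          (exceptions (Δ.botValues id (some t, i))).Finite := by
        intro i hi
        obtain ⟨V, hV, eb, hVx⟩ := Δ.exists_wire_bot (o := some t) hi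
        rw [← eb, ← h.wire V hV]
        exact ih V hV (by rw [eb]) hVx
      have e : W.top = (some t, W.top.2) := Prod.ext ht rfl
      have hi := getElem?_of_top hW e
      rw [hx, Option.elim_some] at hi
      have h1 := congrFun (Δ.topValues_some id t) W.top.2
      rw [← e] at h1
      rw [h1]
      obtain ⟨h2, h3⟩ | ⟨h2, h3⟩ := Δ.labels t
      · rw [h2] at hb ⊢
        rw [h3] at hi
        rcases hn : W.top.2 with _ | _ | _ | n <;> simp [hn] at hi
        · exact exceptions_append_finite (hb 0 rfl) false
        · exact exceptions_append_finite (hb 0 rfl) true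
      · rw [h2] at hb ⊢
        exact exceptions_join_finite (hb 0 rfl) (hb 2 rfl)
  obtain ⟨W, hW, eb, hx⟩ := Δ.exists_wire_bot (o := none) (i := 0) (a := .x) rfl
  have := key W hW hx
  rwa [h.wire W hW, eb] at this

/-- The permutation of the tree defined by a diagram. -/
noncomputable def perm (Δ : TreeDiagram) : Equiv.Perm (List Bool) where
  toFun := Δ.eval
  invFun := Δ.flip.eval
  left_inv := congrFun Δ.flip.eval_comp_eval_flip
  right_inv := congrFun Δ.eval_comp_eval_flip

theorem eval_eq_of_isAssignment {τ β : Contact Δ.T → List Bool → List Bool}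
    (h : IsAssignment Δ τ β) (e : τ (none, 0) = id) : Δ.eval = β (none, 0) := by
  rw [h.bot_eq, e]
  rfl

/-- Two assignments are pasted: the one starting from `id` above, and below it the one starting from
`id` composed with `Δ₁.eval`. They agree along the glued frame sides. -/
theorem eval_concat (Δ₁ Δ₂ : TreeDiagram) : (Δ₁.concat Δ₂).eval = Δ₁.eval ∘ Δ₂.eval := by
  have h₁ := Δ₁.isAssignment_values (id : List Bool → List Bool)
  have h₂ := (Δ₂.isAssignment_values (id : List Bool → List Bool)).comp Δ₁.eval
  set τ₁ := Δ₁.topValues id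
  set β₁ := Δ₁.botValues id
  set τ₂ := fun c => Δ₁.eval ∘ Δ₂.topValues id c
  set β₂ := fun c => Δ₁.eval ∘ Δ₂.botValues id c
  let τ : Contact (Δ₁.T ⊕ Δ₂.T) → List Bool → List Bool := fun c =>
    c.1.elim (τ₁ (none, c.2)) (Sum.elim (fun t => τ₁ (some t, c.2)) (fun t => τ₂ (some t, c.2)))
  let β : Contact (Δ₁.T ⊕ Δ₂.T) → List Bool → List Bool := fun c =>
    c.1.elim (β₂ (none, c.2)) (Sum.elim (fun t => β₁ (some t, c.2)) (fun t => β₂ (some t, c.2)))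
  have hτ₁ : ∀ c, τ (c.map Sum.inl) = τ₁ c := by rintro ⟨_ | t, i⟩ <;> rfl
  have hβ₂ : ∀ c, β (c.map Sum.inr) = β₂ c := by rintro ⟨_ | t, i⟩ <;> rfl
  have hτ₂ : ∀ c : Contact Δ₂.T, c.1 ≠ none → τ (c.map Sum.inr) = τ₂ c := by
    rintro ⟨_ | t, i⟩ hc
    exacts [absurd rfl hc, rfl]
  have hβ₁ : ∀ c : Contact Δ₁.T, c.1 ≠ none → β (c.map Sum.inl) = β₁ c := by
    rintro ⟨_ | t, i⟩ hc
    exacts [absurd rfl hc, rfl]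
  have hA : IsAssignment (Δ₁.concat Δ₂) τ β := by
    refine ⟨?_, ?_, ?_⟩
    · rintro W (⟨W₁, k₁, b₁, rfl⟩ | ⟨W₂, k₂, b₂, rfl⟩ | ⟨W₁, k₁, W₂, k₂, i, e₁, e₂, rfl⟩)
      · exact (hτ₁ _).trans ((h₁.wire _ k₁).trans (hβ₁ _ b₁).symm)
      · exact (hτ₂ _ b₂).trans ((h₂.wire _ k₂).trans (hβ₂ _).symm)
      · refine (hτ₁ _).trans ((h₁.wire _ k₁).trans (Eq.trans ?_
          ((h₂.wire _ k₂).trans (hβ₂ _).symm)))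
        rw [(bot_eq_of_frame k₁ (by rw [e₁])).1, (top_eq_of_frame k₂ (by rw [e₂])).1]
        rfl
    · rintro W (⟨W₁, k₁, b₁, rfl⟩ | ⟨W₂, k₂, b₂, rfl⟩ | ⟨W₁, k₁, W₂, k₂, i, e₁, e₂, rfl⟩) ha s
      · have := h₁.const _ k₁ ha s
        rwa [← hτ₁] at this
      · have := h₂.const _ k₂ ha s
        rwa [← hτ₂ _ b₂] at this
      · have := h₁.const _ k₁ ha s
        rwa [← hτ₁] at this
    · rintro (t | t)
      · exact h₁.trans t
      · exact h₂.trans t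
  exact eval_eq_of_isAssignment hA rfl

theorem Equivalent.eval_eq (h : Δ.Equivalent Δ') : Δ.eval = Δ'.eval := by
  obtain ⟨e, ht, hb, hw⟩ := h
  have h' := Δ'.isAssignment_values (id : List Bool → List Bool)
  have hA : IsAssignment Δ (fun c => Δ'.topValues id (c.map e))
      (fun c => Δ'.botValues id (c.map e)) := by
    refine ⟨fun W hW => h'.wire _ ((hw W).1 hW), fun W hW => h'.const _ ((hw W).1 hW), fun t => ?_⟩
    have := h'.trans (e t)
    rwa [ht, hb] at this
  exact eval_eq_of_isAssignment hA rfl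

/-- What enters the dipole leaves it unchanged, so the assignment on the larger diagram restricts to
the reduced one. -/
theorem ReducesTo.eval_eq (h : Δ.ReducesTo Δ') : Δ.eval = Δ'.eval := by
  obtain ⟨T₁, T₂, f, hd, -, -, ht, hb, hw⟩ := h
  have h := Δ.isAssignment_values (id : List Bool → List Bool)
  -- The definition of a dipole asks for only one equality of labels; the other follows because
  -- either side of the single relation determines the other.
  have hl : Δ.botLabel T₂ = Δ.topLabel T₁ := by
    have := hd.2.1
    obtain ⟨h1, h2⟩ | ⟨h1, h2⟩ := Δ.labels T₁ <;> obtain ⟨h3, h4⟩ | ⟨h3, h4⟩ := Δ.labels T₂ <;>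
      simp_all
  have hj : joinWord (Δ.topLabel T₂) (fun i => Δ.botValues id (some T₂, i)) =
      joinWord (Δ.topLabel T₂) (fun i => Δ.topValues id (some T₁, i)) := by
    refine (h.trans T₂).trans (Eq.trans ?_ ((h.trans T₁).trans (by rw [hd.2.1])))
    rw [← hl]
    refine joinWord_congr (Δ.botLabel_eq_or T₂) fun i c hi => ?_
    obtain ⟨W, hW, e, -⟩ := Δ.exists_wire_top (o := some T₂) hi
    rw [← e, h.wire W hW, (hd.2.2 W hW i).1 e]
  -- From equality of the joined functions to equality contact by contact, by constancy on
  -- `a`-wires.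
  have hi := joinWord_inj (Δ.topLabel_eq_or T₂) hj (h.flip.const_top T₂) (by
    rw [← hd.2.1]
    exact h.const_top T₁)
  have hA : IsAssignment Δ' (fun c => Δ.topValues id (c.map f))
      (fun c => Δ.botValues id (c.map f)) := by
    refine ⟨fun W hW => ?_, fun W hW ha s => ?_, fun t => ?_⟩
    · obtain hW | ⟨V₂, h₂, V₁, h₁, i, e₂, e₁, e⟩ := (hw W).1 hW
      · exact h.wire _ hW
      · change Δ.topValues id (W.map f).top = Δ.botValues id (W.map f).bot
        rw [e, h.wire _ h₂, ← h.wire _ h₁, e₂, e₁]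
        exact hi i V₂.label (getElem?_of_bot h₂ e₂)
    · change Δ.topValues id (W.map f).top s = Δ.topValues id (W.map f).top []
      obtain hW | ⟨V₂, h₂, V₁, h₁, i, e₂, e₁, e⟩ := (hw W).1 hW
      · exact h.const _ hW ha s
      · have : (W.map f).label = .a := ha
        rw [e] at this ⊢
        exact h.const _ h₂ this s
    · have := h.trans (f t)
      rwa [ht, hb] at this
  exact (eval_eq_of_isAssignment hA rfl).symm

theorem DipoleEquiv.eval_eq (h : Δ.DipoleEquiv Δ') : Δ.eval = Δ'.eval := by
  induction h with
  | rel _ _ h => exact h.elim Equivalent.eval_eq ReducesTo.eval_eq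
  | refl => rfl
  | symm _ _ _ ih => exact ih.symm
  | trans _ _ _ _ _ ih ih' => exact ih.trans ih'

theorem perm_mem_QAut (Δ : TreeDiagram) : Δ.perm ∈ QAut :=
  (mem_QAut_iff _).2 Δ.exceptions_eval_finite

end BraidedDiagram

/-- The homomorphism from the diagram group to the group of quasi-automorphisms. -/
noncomputable def diagramGroupToQAut :
    BraidedDiagramGroup treePresentation [Letter.x] →ₙ* QAut where
  toFun := Quotient.lift (fun Δ => ⟨Δ.perm, Δ.perm_mem_QAut⟩) fun _ _ h =>
    Subtype.ext (Equiv.ext (congrFun (BraidedDiagram.DipoleEquiv.eval_eq h)))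
  map_mul' := by
    rintro ⟨Δ₁⟩ ⟨Δ₂⟩
    exact Subtype.ext (Equiv.ext (congrFun (BraidedDiagram.eval_concat Δ₁ Δ₂)))

/-! ### Normal forms of diagrams -/

section ContactValues

/-- The label and the value of the wire at a top contact in the normal form of the diagrams that
define `h`, where `g` is the inverse of `h`. -/
def topValue (g h : List Bool → List Bool) :
    Contact (irregular g ⊕ irregular h) → Option (Letter × (List Bool → List Bool))
  | (none, 0) => some (.x, id)
  | (some (.inl p), 0) => some (.x, fun s => s ++ false :: p)
  | (some (.inl p), 1) => some (.a, fun _ => p)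
  | (some (.inl p), 2) => some (.x, fun s => s ++ true :: p)
  | (some (.inr q), 0) => some (.x, fun s => h (s ++ q))
  | _ => none

/-- The label and the value of the wire at a bottom contact. -/
def botValue (g h : List Bool → List Bool) (c : Contact (irregular g ⊕ irregular h)) :
    Option (Letter × (List Bool → List Bool)) :=
  (topValue h g (c.map Sum.swap)).map (Prod.map id (h ∘ ·))

/-- The index of the contact at which the subtree on the side `b` is attached. -/
def sideIndex (b : Bool) : ℕ := if b then 2 else 0

variable {g h : List Bool → List Bool}

theorem topValue_cases {c : Contact (irregular g ⊕ irregular h)} {l : Letter}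
    {f : List Bool → List Bool} (e : topValue g h c = some (l, f)) :
    (c = (none, 0) ∧ l = .x ∧ f = id) ∨
    (∃ p b, c = (some (.inl p), sideIndex b) ∧ l = .x ∧ f = fun s => s ++ b :: p) ∨
    (∃ p, c = (some (.inl p), 1) ∧ l = .a ∧ f = fun _ => p.1) ∨
    (∃ q, c = (some (.inr q), 0) ∧ l = .x ∧ f = fun s => h (s ++ q)) := by
  unfold topValue at e
  split at e <;> simp only [Option.some.injEq, Prod.mk.injEq, reduceCtorEq] at e <;>
    obtain ⟨rfl, rfl⟩ := e
  · exact Or.inl ⟨rfl, rfl, rfl⟩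
  · exact Or.inr (Or.inl ⟨_, false, rfl, rfl, rfl⟩)
  · exact Or.inr (Or.inr (Or.inl ⟨_, rfl, rfl, rfl⟩))
  · exact Or.inr (Or.inl ⟨_, true, rfl, rfl, rfl⟩)
  · exact Or.inr (Or.inr (Or.inr ⟨_, rfl, rfl, rfl⟩))

/-- This separates the values below joinings from those below splittings and at the top of the
frame. -/
theorem irregular_ne_append {q : List Bool} (hq : q ∈ irregular h) (p : List Bool) :
    (fun s => h (s ++ q)) ≠ fun s => s ++ p := by
  intro e
  obtain ⟨s, hs⟩ := hq
  have e0 : h q = p := congrFun e []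
  exact hs (by rw [e0]; exact congrFun e s)

/-- A value determines the contact that carries it: the value at `[]` gives the vertex and the side,
and irregularity tells joinings from the rest. Therefore matching equal values yields at most one
wire per contact. -/
theorem topValue_injective (hh : Function.Injective h)
    {c c' : Contact (irregular g ⊕ irregular h)} {v : Letter × (List Bool → List Bool)}
    (e : topValue g h c = some v) (e' : topValue g h c' = some v) : c = c' := by
  obtain ⟨l, f⟩ := v
  obtain ⟨rfl, rfl, rfl⟩ | ⟨p, b, rfl, rfl, rfl⟩ | ⟨p, rfl, rfl, rfl⟩ | ⟨q, rfl, rfl, rfl⟩ :=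
      topValue_cases e <;>
    obtain ⟨rfl, hl, hf⟩ | ⟨p', b', rfl, hl, hf⟩ | ⟨p', rfl, hl, hf⟩ | ⟨q', rfl, hl, hf⟩ :=
      topValue_cases e' <;> cases hl
  · rfl
  · exact absurd (congrFun hf []) (by simp)
  · exact absurd (hf.symm.trans (funext fun s => (List.append_nil s).symm))
      (irregular_ne_append q'.2 [])
  · exact absurd (congrFun hf []) (by simp)
  · have := congrFun hf []
    simp only [List.nil_append, List.cons.injEq] at this
    rw [this.1, Subtype.ext this.2]
  · exact absurd hf.symm (irregular_ne_append q'.2 _)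
  · rw [Subtype.ext (congrFun hf [])]
  · exact absurd (hf.trans (funext fun s => (List.append_nil s).symm)) (irregular_ne_append q.2 [])
  · exact absurd hf (irregular_ne_append q.2 _)
  · rw [Subtype.ext (hh (congrFun hf []))]

theorem botValue_injective (hh : Function.Injective h) (hg : Function.Injective g)
    {c c' : Contact (irregular g ⊕ irregular h)} {v : Letter × (List Bool → List Bool)}
    (e : botValue g h c = some v) (e' : botValue g h c' = some v) : c = c' := by
  simp only [botValue, Option.map_eq_some_iff] at e e'
  obtain ⟨w, hw, rfl⟩ := e
  obtain ⟨w', hw', e⟩ := e'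
  obtain rfl : w' = w :=
    Function.injective_id.prodMap (fun _ _ h' => hh.comp_left h') e
  exact BraidedDiagram.Contact.map_injective Sum.swap_leftInverse.injective
    (topValue_injective hg hw hw')

/-- If `g p` were regular for `h`, the canonical map from its subtree onto that of `p` could be
inverted. This pairs each splitting with the joining that takes its `a`-wire. -/
theorem mem_irregular_of_inverse (hgh : Function.LeftInverse g h) (hhg : Function.LeftInverse h g)
    {p : List Bool} (hp : p ∈ irregular g) : g p ∈ irregular h := by
  by_contra hq
  rw [notMem_irregular] at hq
  obtain ⟨s, hs⟩ := hp
  refine hs ?_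
  have := congrArg g (hq s)
  rw [hgh, hhg] at this
  exact this.symm

theorem botValue_side (q : irregular h) (b : Bool) :
    botValue g h (some (.inr q), sideIndex b) = some (.x, fun s => h (s ++ b :: q)) := by
  cases b <;> rfl

theorem botValue_one (q : irregular h) :
    botValue g h (some (.inr q), 1) = some (.a, fun _ => h q) := rfl

theorem botValue_none : botValue g h (none, 0) = some (.x, h) := rfl

theorem botValue_inl (hhg : Function.LeftInverse h g) (p : irregular g) :
    botValue g h (some (.inl p), 0) = some (.x, fun s => s ++ p.1) := by
  have : h ∘ (fun s => g (s ++ p.1)) = fun s => s ++ p.1 := funext fun s => hhg _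
  exact congrArg (fun f => some (Letter.x, f)) this

/-- The value at the top of the subtree with root `q`, on the lower side. -/
theorem exists_botValue_lower {q : List Bool} (hq : ∀ b q', q = b :: q' → q' ∈ irregular h) :
    ∃ c, botValue g h c = some (.x, fun s => h (s ++ q)) := by
  obtain _ | ⟨b, q⟩ := q
  · exact ⟨(none, 0), by simp [botValue_none]⟩
  · exact ⟨_, botValue_side ⟨q, hq b q rfl⟩ b⟩

/-- The subtree at `p` is either cut further, when `p` is irregular for `g`, or it is the canonical
image of the subtree at `g p` and enters a joining at the parent of `g p`, or the frame if `g p` is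
the root. That parent is irregular for `h`, since otherwise the parent of `p` would be regular for
`g`. -/
theorem exists_botValue_upper (hgh : Function.LeftInverse g h) (hhg : Function.LeftInverse h g)
    {p : List Bool} (hp : ∀ b p', p = b :: p' → p' ∈ irregular g) :
    ∃ c, botValue g h c = some (.x, fun s => s ++ p) := by
  by_cases hpg : p ∈ irregular g
  · exact ⟨_, botValue_inl hhg ⟨p, hpg⟩⟩
  · rw [notMem_irregular] at hpg
    have e : (fun s => s ++ p) = fun s => h (s ++ g p) := funext fun s => by rw [← hpg, hhg]
    rw [e]
    refine exists_botValue_lower fun b q hq => ?_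
    by_contra hqi
    rw [notMem_irregular] at hqi
    have h1 : p = b :: h q := by
      rw [← hhg p, hq]
      exact hqi [b]
    obtain ⟨s, hs⟩ := hp b _ h1
    rw [hgh] at hs
    refine hs ?_
    rw [← hgh (s ++ q), hqi]

/-- Every wire that starts somewhere ends somewhere. Below a joining at `q` it goes to the joining
at the parent of `q`, which is irregular as an ancestor of an irregular vertex. -/
theorem exists_botValue (hgh : Function.LeftInverse g h) (hhg : Function.LeftInverse h g)
    {c : Contact (irregular g ⊕ irregular h)} {v : Letter × (List Bool → List Bool)}
    (e : topValue g h c = some v) : ∃ c', botValue g h c' = some v := by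
  obtain ⟨l, f⟩ := v
  obtain ⟨rfl, rfl, rfl⟩ | ⟨p, b, rfl, rfl, rfl⟩ | ⟨p, rfl, rfl, rfl⟩ | ⟨q, rfl, rfl, rfl⟩ :=
      topValue_cases e
  · obtain ⟨c, hc⟩ := exists_botValue_upper hgh hhg (p := []) (by simp)
    exact ⟨c, by simpa [Function.id_def] using hc⟩
  · refine exists_botValue_upper hgh hhg ?_
    rintro b' p' e
    exact (List.cons.inj e).2 ▸ p.2
  · refine ⟨(some (.inr ⟨g p, mem_irregular_of_inverse hgh hhg p.2⟩), 1), ?_⟩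
    rw [botValue_one, hhg]
  · refine exists_botValue_lower fun b q' e => ?_
    by_contra hq'
    exact append_notMem_irregular [b] hq' (by simpa [e] using q.2)

theorem topValue_eq_of_botValue_swap (hhg : Function.LeftInverse h g)
    {c : Contact (irregular h ⊕ irregular g)} {l : Letter} {f : List Bool → List Bool}
    (e : botValue h g c = some (l, f)) : topValue g h (c.map Sum.swap) = some (l, h ∘ f) := by
  simp only [botValue, Option.map_eq_some_iff] at e
  obtain ⟨⟨l', f'⟩, hw, e⟩ := e
  cases e
  rw [hw]
  have : h ∘ g ∘ f' = f' := funext fun s => hhg _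
  simp [this]

/-- Turning upside down exchanges the roles of `g` and `h`. -/
theorem exists_topValue (hgh : Function.LeftInverse g h) (hhg : Function.LeftInverse h g)
    {c : Contact (irregular g ⊕ irregular h)} {v : Letter × (List Bool → List Bool)}
    (e : botValue g h c = some v) : ∃ c', topValue g h c' = some v := by
  simp only [botValue, Option.map_eq_some_iff] at e
  obtain ⟨⟨l, f⟩, hw, rfl⟩ := e
  obtain ⟨c', hc'⟩ := exists_botValue hhg hgh hw
  exact ⟨_, topValue_eq_of_botValue_swap hhg hc'⟩

theorem getElem?_eq_some_iff_topValue (o : Option (irregular g ⊕ irregular h)) (i : ℕ)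
    (l : Letter) :
    (o.elim [.x] (Sum.elim (fun _ => [.x, .a, .x]) (fun _ => [.x])))[i]? = some l ↔
      ∃ f, topValue g h (o, i) = some (l, f) := by
  obtain _ | p | q := o
  · obtain _ | i := i <;> simp [topValue]
  · obtain _ | _ | _ | i := i <;> simp [topValue]
  · obtain _ | i := i <;> simp [topValue]

theorem getElem?_eq_some_iff_botValue (o : Option (irregular g ⊕ irregular h)) (i : ℕ)
    (l : Letter) :
    (o.elim [.x] (Sum.elim (fun _ => [.x]) (fun _ => [.x, .a, .x])))[i]? = some l ↔
      ∃ f, botValue g h (o, i) = some (l, f) := by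
  have e : o.elim [.x] (Sum.elim (fun _ => [.x]) (fun _ => [.x, .a, .x])) =
      (o.map Sum.swap).elim [Letter.x] (Sum.elim (fun _ => [.x, .a, .x]) (fun _ => [.x])) := by
    obtain _ | _ | _ := o <;> rfl
  rw [e, getElem?_eq_some_iff_topValue (g := h) (h := g)]
  simp only [botValue, Option.map_eq_some_iff]
  constructor
  · rintro ⟨f, hf⟩
    exact ⟨_, _, hf, rfl⟩
  · rintro ⟨f, ⟨l', f'⟩, hf, e⟩
    cases e
    exact ⟨_, hf⟩

end ContactValues

/-! ### The diagram built from the prescribed values -/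

namespace BraidedDiagram

/-- The wires of the normal form. -/
def normalFormWires (g h : List Bool → List Bool) :
    Set (Wire (irregular g ⊕ irregular h) Letter) :=
  {W | ∃ f, topValue g h W.top = some (W.label, f) ∧ botValue g h W.bot = some (W.label, f)}

/-- A height function on the transistors of the normal form. -/
def normalFormHeight (g h : List Bool → List Bool) : irregular g ⊕ irregular h → ℚ :=
  Sum.elim (fun p => 1 / (p.1.length + 1)) (fun q => - (1 / (q.1.length + 1)))

/-- Going down, splittings move away from the root and joinings towards it, and splittings are
positive while joinings are negative. No wire leads from a joining down to a splitting, by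
`irregular_ne_append`. -/
theorem normalFormHeight_lt {g h : List Bool → List Bool} (hh : Function.Injective h)
    (hhg : Function.LeftInverse h g) {t₁ t₂ : irregular g ⊕ irregular h}
    (hb : Below (normalFormWires g h) t₁ t₂) :
    normalFormHeight g h t₁ < normalFormHeight g h t₂ := by
  obtain ⟨⟨⟨o, i⟩, l, ⟨o', j⟩⟩, ⟨f, h1, h2⟩, e1, e2⟩ := hb
  simp only at h1 h2 e1 e2
  subst e1 e2
  obtain ⟨e, -⟩ | ⟨p, b, e, rfl, rfl⟩ | ⟨p, e, rfl, rfl⟩ | ⟨q, e, rfl, rfl⟩ :=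
    topValue_cases h1
  · simp at e
  all_goals
    obtain ⟨e, rfl⟩ := Prod.mk.inj e
    cases e
    obtain p' | q' := t₁
  · have hj : j = 0 := by
      have := (getElem?_eq_some_iff_botValue (some (.inl p')) j .x).2 ⟨_, h2⟩
      exact (eq_zero_of_getElem? this).1
    subst hj
    rw [botValue_inl hhg] at h2
    have := congrFun (Prod.mk.inj (Option.some.inj h2)).2 []
    have hlen : p.1.length < p'.1.length := by simp_all
    exact one_div_lt_one_div_of_lt (by positivity) (by exact_mod_cast Nat.succ_lt_succ hlen)
  · simp only [normalFormHeight, Sum.elim_inl, Sum.elim_inr]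
    exact lt_trans (neg_lt_zero.2 (by positivity)) (by positivity)
  · have := (getElem?_eq_some_iff_botValue (some (.inl p')) j .a).2 ⟨_, h2⟩
    simpa using (eq_zero_of_getElem? this).2
  · simp only [normalFormHeight, Sum.elim_inl, Sum.elim_inr]
    exact lt_trans (neg_lt_zero.2 (by positivity)) (by positivity)
  · have hj : j = 0 := by
      have := (getElem?_eq_some_iff_botValue (some (.inl p')) j .x).2 ⟨_, h2⟩
      exact (eq_zero_of_getElem? this).1
    subst hj
    rw [botValue_inl hhg] at h2
    exact absurd (Prod.mk.inj (Option.some.inj h2)).2.symm (irregular_ne_append q.2 _)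
  · have key : ∃ b, q.1 = b :: q'.1 := by
      obtain _ | _ | _ | j := j
      · exact ⟨false, (hh (congrFun (Prod.mk.inj (Option.some.inj h2)).2 [])).symm⟩
      · cases h2
      · exact ⟨true, (hh (congrFun (Prod.mk.inj (Option.some.inj h2)).2 [])).symm⟩
      · cases h2
    obtain ⟨b, hq⟩ := key
    have hlen : q'.1.length < q.1.length := by simp [hq]
    exact neg_lt_neg (one_div_lt_one_div_of_lt (by positivity)
      (by exact_mod_cast Nat.succ_lt_succ hlen))

/-- The diagram without dipoles that defines the quasi-automorphism `h`. -/
def normalForm (h : Equiv.Perm (List Bool)) (hf : (exceptions h).Finite) : TreeDiagram where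
  T := irregular h.symm ⊕ irregular h
  finite := by
    have := (irregular_finite hf).to_subtype
    have h2 : (exceptions h.symm).Finite := by
      have := exceptions_inv h
      rw [Equiv.Perm.inv_def] at this
      rw [this]
      exact hf.image h
    have := (irregular_finite h2).to_subtype
    infer_instance
  wires := normalFormWires h.symm h
  nonempty := by
    obtain ⟨c, hc⟩ := exists_botValue h.left_inv h.right_inv (c := (none, 0)) rfl
    exact ⟨⟨(none, 0), .x, c⟩, _, rfl, hc⟩
  topLabel := Sum.elim (fun _ => [.x]) (fun _ => [.x, .a, .x])
  botLabel := Sum.elim (fun _ => [.x, .a, .x]) (fun _ => [.x])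
  top_inj := by
    rintro ⟨c, l, d⟩ ⟨f, h1, h2⟩ ⟨c', l', d'⟩ ⟨f', h1', h2'⟩ e
    simp only at *
    subst e
    obtain ⟨rfl, rfl⟩ := Prod.mk.inj (Option.some.inj (h1.symm.trans h1'))
    rw [botValue_injective h.injective h.symm.injective h2 h2']
  bot_inj := by
    rintro ⟨c, l, d⟩ ⟨f, h1, h2⟩ ⟨c', l', d'⟩ ⟨f', h1', h2'⟩ e
    simp only at *
    subst e
    obtain ⟨rfl, rfl⟩ := Prod.mk.inj (Option.some.inj (h2.symm.trans h2'))
    rw [topValue_injective h.injective h1 h1']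
  read_top o i l := by
    rw [getElem?_eq_some_iff_topValue]
    constructor
    · rintro ⟨f, hf⟩
      obtain ⟨c, hc⟩ := exists_botValue h.left_inv h.right_inv hf
      exact ⟨⟨_, l, c⟩, ⟨f, hf, hc⟩, rfl, rfl⟩
    · rintro ⟨W, ⟨f, h1, h2⟩, e, rfl⟩
      exact ⟨f, e ▸ h1⟩
  read_bot o i l := by
    rw [getElem?_eq_some_iff_botValue]
    constructor
    · rintro ⟨f, hf⟩
      obtain ⟨c, hc⟩ := exists_topValue h.left_inv h.right_inv hf
      exact ⟨⟨c, l, _⟩, ⟨f, hc, hf⟩, rfl, rfl⟩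
    · rintro ⟨W, ⟨f, h1, h2⟩, e, rfl⟩
      exact ⟨f, e ▸ h2⟩
  rel := by
    rintro (_ | _)
    · exact Or.inl rfl
    · exact Or.inr rfl
  acyclic := by
    have key : ∀ s t, Relation.TransGen (Below (normalFormWires h.symm h)) s t →
        normalFormHeight h.symm h s < normalFormHeight h.symm h t := by
      intro s t hst
      induction hst with
      | single hb => exact normalFormHeight_lt h.injective h.right_inv hb
      | tail _ hb ih => exact ih.trans (normalFormHeight_lt h.injective h.right_inv hb)
    exact fun t ht => lt_irrefl _ (key t t ht)

/-- The prescribed values are themselves an assignment, with `id` at the top of the frame and `h` at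
the bottom. -/
theorem eval_normalForm (h : Equiv.Perm (List Bool)) (hf : (exceptions h).Finite) :
    (normalForm h hf).eval = h := by
  have hA : IsAssignment (normalForm h hf)
      -- The default `id` is used only at positions that carry no wire.
      (fun c => (topValue h.symm h c).elim id Prod.snd)
      (fun c => (botValue h.symm h c).elim id Prod.snd) := by
    refine ⟨?_, ?_, ?_⟩
    · rintro W ⟨f, h1, h2⟩
      simp only [h1, h2]
    · rintro W ⟨f, h1, h2⟩ ha s
      simp only [h1, Option.elim_some]
      obtain ⟨-, hl, -⟩ | ⟨p, b, -, hl, -⟩ | ⟨p, -, hl, rfl⟩ | ⟨q, -, hl, -⟩ := topValue_cases h1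
      · simp [hl] at ha
      · simp [hl] at ha
      · rfl
      · simp [hl] at ha
    · rintro (p | q)
      · refine (congrArg (·.elim id Prod.snd) (botValue_inl h.right_inv p)).trans ?_
        refine (join_restrict _).symm.trans ?_
        change join (fun s => (s ++ [false]) ++ p.1) (fun _ => p.1)
            (fun s => (s ++ [true]) ++ p.1) =
          join (fun s => s ++ false :: p.1) (fun _ => p.1) (fun s => s ++ true :: p.1)
        simp
      · refine Eq.trans ?_ (join_restrict _)
        change join (fun s => h (s ++ false :: q.1)) (fun _ => h q.1)
            (fun s => h (s ++ true :: q.1)) =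
          join (fun s => h ((s ++ [false]) ++ q.1)) (fun _ => h q.1)
            (fun s => h ((s ++ [true]) ++ q.1))
        simp
  exact eval_eq_of_isAssignment hA rfl

end BraidedDiagram

/-! ### Reduced diagrams -/

namespace BraidedDiagram

variable {Δ Δ' : TreeDiagram}

/-- The assignment with the identity at the top and `h` at the bottom of the frame. -/
structure Evaluates (Δ : TreeDiagram) (h : Equiv.Perm (List Bool))
    (τ β : Contact Δ.T → List Bool → List Bool) : Prop extends IsAssignment Δ τ β where
  top : τ (none, 0) = id
  bot : β (none, 0) = h

theorem exists_wire_side_top {t : Δ.T} (ht : Δ.topLabel t = [.x]) (b : Bool) :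
    ∃ W ∈ Δ.wires, W.top = (some t, sideIndex b) ∧ W.label = .x := by
  refine Δ.exists_wire_top (o := some t) ?_
  obtain ⟨-, hb⟩ | ⟨h, -⟩ := Δ.labels t
  · rw [Option.elim_some, hb]
    cases b <;> rfl
  · simp [h] at ht

theorem exists_wire_one_top {t : Δ.T} (ht : Δ.topLabel t = [.x]) :
    ∃ W ∈ Δ.wires, W.top = (some t, 1) ∧ W.label = .a := by
  refine Δ.exists_wire_top (o := some t) ?_
  obtain ⟨-, hb⟩ | ⟨h, -⟩ := Δ.labels t
  · rw [Option.elim_some, hb]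
    rfl
  · simp [h] at ht

theorem exists_wire_zero_bot {t : Δ.T} (ht : Δ.topLabel t = [.x]) :
    ∃ W ∈ Δ.wires, W.bot = (some t, 0) ∧ W.label = .x := by
  refine Δ.exists_wire_bot (o := some t) ?_
  rw [Option.elim_some, ht]
  rfl

/-- The wire above a transistor with top label `x` in a reduced diagram. -/
theorem IsReduced.topLabel_above (hr : Δ.IsReduced) {W : Wire Δ.T Letter} (hW : W ∈ Δ.wires)
    {t t' : Δ.T} (hb : W.bot.1 = some t) (ht : Δ.topLabel t = [.x]) (ht' : W.top.1 = some t') :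
    Δ.topLabel t' = [.x] := by
  obtain ⟨h, -⟩ | ⟨h1, h2⟩ := Δ.labels t'
  · exact h
  · have hbt : Δ.botLabel t = [.x, .a, .x] := by
      obtain ⟨-, h⟩ | ⟨h, -⟩ := Δ.labels t
      · exact h
      · simp [h] at ht
    have eb : W.bot = (some t, 0) := by
      have := getElem?_of_bot hW (o := some t) (i := W.bot.2) (Prod.ext hb rfl)
      rw [Option.elim_some, ht] at this
      exact Prod.ext hb (eq_zero_of_getElem? this).1
    have et : W.top = (some t', 0) := by
      have := getElem?_of_top hW (o := some t') (i := W.top.2) (Prod.ext ht' rfl)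
      rw [Option.elim_some, h2] at this
      exact Prod.ext ht' (eq_zero_of_getElem? this).1
    -- A joining and a splitting directly below it are connected by the only wire between those two
    -- sides, so they form a dipole.
    refine absurd ⟨⟨W, hW, ht', hb⟩, by rw [hbt, h1], fun V hV i => ⟨fun e => ?_, fun e => ?_⟩⟩
      (hr t t')
    · have := getElem?_of_top hV e
      rw [Option.elim_some, h2] at this
      obtain rfl := (eq_zero_of_getElem? this).1
      rw [Δ.top_inj _ hV _ hW (e.trans et.symm), eb]
    · have := getElem?_of_bot hV e
      rw [Option.elim_some, ht] at this
      obtain rfl := (eq_zero_of_getElem? this).1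
      rw [Δ.bot_inj _ hV _ hW (e.trans eb.symm), et]

namespace Evaluates

variable {h : Equiv.Perm (List Bool)} {τ β : Contact Δ.T → List Bool → List Bool}

/-- Splittings and joinings are exchanged, and so are `h` and its inverse. Every statement below
about splittings thereby also covers joinings. -/
theorem flip (H : Evaluates Δ h τ β) :
    Evaluates Δ.flip h.symm (fun c => h.symm ∘ β c) (fun c => h.symm ∘ τ c) where
  toIsAssignment := H.toIsAssignment.flip.comp h.symm
  top := (congrArg (h.symm ∘ ·) H.bot).trans (funext h.left_inv)
  bot := congrArg (h.symm ∘ ·) H.top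

theorem join_eq (H : Evaluates Δ h τ β) {t : Δ.T} (ht : Δ.topLabel t = [.x]) :
    β (some t, 0) = join (τ (some t, 0)) (τ (some t, 1)) (τ (some t, 2)) := by
  have e := H.trans t
  obtain ⟨h1, h2⟩ | ⟨h1, -⟩ := Δ.labels t
  · rwa [h1, h2] at e
  · simp [h1] at ht

theorem side_eq (H : Evaluates Δ h τ β) {t : Δ.T} (ht : Δ.topLabel t = [.x]) {p : List Bool}
    (hp : β (some t, 0) = fun s => s ++ p) (b : Bool) :
    τ (some t, sideIndex b) = fun s => s ++ b :: p := by
  rw [H.join_eq ht] at hp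
  funext s
  have := congrFun hp (s ++ [b])
  cases b <;> simpa [sideIndex] using this

theorem one_eq (H : Evaluates Δ h τ β) {t : Δ.T} (ht : Δ.topLabel t = [.x]) {p : List Bool}
    (hp : β (some t, 0) = fun s => s ++ p) : τ (some t, 1) = fun _ => p := by
  rw [H.join_eq ht] at hp
  funext s
  obtain ⟨W, hW, e, ha⟩ := exists_wire_one_top ht
  have h1 := H.const W hW ha s
  rw [e] at h1
  rw [h1]
  exact congrFun hp []

/-- Only splittings lie above a splitting, so its input was obtained from the identity by repeated
restriction to subtrees. -/
theorem exists_path (H : Evaluates Δ h τ β) (hr : Δ.IsReduced) {t : Δ.T}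
    (ht : Δ.topLabel t = [.x]) : ∃ p, β (some t, 0) = fun s => s ++ p := by
  induction t using Δ.wellFounded_above.induction with
  | _ t ih =>
    obtain ⟨W, hW, eb, hx⟩ := exists_wire_zero_bot ht
    rw [← eb, ← H.wire W hW]
    rcases htop : W.top.1 with _ | t'
    · rw [(top_eq_of_frame hW htop).1, H.top]
      exact ⟨[], funext fun s => (List.append_nil s).symm⟩
    · have ht' := hr.topLabel_above hW (by rw [eb]) ht htop
      obtain ⟨p, hp⟩ := ih t' ⟨W, hW, htop, by rw [eb]⟩ ht'
      have e : W.top = (some t', W.top.2) := Prod.ext htop rfl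
      have hi := getElem?_of_top hW e
      obtain ⟨-, hbl⟩ | ⟨h1, -⟩ := Δ.labels t'
      · rw [hx, Option.elim_some, hbl] at hi
        rcases hn : W.top.2 with _ | _ | _ | n <;> simp [hn] at hi
        · rw [e, hn]
          exact ⟨_, H.side_eq ht' hp false⟩
        · rw [e, hn]
          exact ⟨_, H.side_eq ht' hp true⟩
      · simp [h1] at ht'

/-- The wires with label `x` that do not start at a transistor with bottom label `x`. -/
theorem wire_path (H : Evaluates Δ h τ β) (hr : Δ.IsReduced) {W : Wire Δ.T Letter}
    (hW : W ∈ Δ.wires) (hx : W.label = .x) (ht : ∀ t, W.top.1 = some t → Δ.topLabel t = [.x]) :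
    (W.top = (none, 0) ∧ τ W.top = fun s => s ++ []) ∨
    ∃ t b p, Δ.topLabel t = [.x] ∧ W.top = (some t, sideIndex b) ∧
      (β (some t, 0) = fun s => s ++ p) ∧ τ W.top = fun s => s ++ b :: p := by
  rcases htop : W.top.1 with _ | t
  · refine Or.inl ⟨(top_eq_of_frame hW htop).1, ?_⟩
    rw [(top_eq_of_frame hW htop).1, H.top]
    exact funext fun s => (List.append_nil s).symm
  · have ht' := ht t htop
    obtain ⟨p, hp⟩ := H.exists_path hr ht'
    have e : W.top = (some t, W.top.2) := Prod.ext htop rfl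
    have hi := getElem?_of_top hW e
    have key : ∃ b, W.top.2 = sideIndex b := by
      obtain ⟨-, hbl⟩ | ⟨h1, -⟩ := Δ.labels t
      · rw [hx, Option.elim_some, hbl] at hi
        rcases hn : W.top.2 with _ | _ | _ | n <;> simp [hn] at hi
        · exact ⟨false, rfl⟩
        · exact ⟨true, rfl⟩
      · simp [h1] at ht'
    obtain ⟨b, hb⟩ := key
    rw [hb] at e
    exact Or.inr ⟨t, b, p, ht', e, hp, by rw [e]; exact H.side_eq ht' hp b⟩

theorem wire_path_a (H : Evaluates Δ h τ β) (hr : Δ.IsReduced) {W : Wire Δ.T Letter}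
    (hW : W ∈ Δ.wires) (ha : W.label = .a) :
    ∃ t p, Δ.topLabel t = [.x] ∧ W.top = (some t, 1) ∧
      (β (some t, 0) = fun s => s ++ p) ∧ τ W.top = fun _ => p := by
  rcases htop : W.top.1 with _ | t
  · have := (top_eq_of_frame hW htop).2
    simp [ha] at this
  · have e : W.top = (some t, W.top.2) := Prod.ext htop rfl
    have hi := getElem?_of_top hW e
    rw [ha, Option.elim_some] at hi
    obtain ⟨ht, hbl⟩ | ⟨-, hbl⟩ := Δ.labels t
    · rw [hbl] at hi
      have hn : W.top.2 = 1 := by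
        rcases hn : W.top.2 with _ | _ | _ | n <;> simp [hn] at hi
        rfl
      rw [hn] at e
      obtain ⟨p, hp⟩ := H.exists_path hr ht
      exact ⟨t, p, ht, e, hp, by rw [e]; exact H.one_eq ht hp⟩
    · rw [hbl] at hi
      simpa using (eq_zero_of_getElem? hi).2

theorem append_inj {p q : List Bool} (e : (fun s : List Bool => s ++ p) = fun s => s ++ q) :
    p = q := congrFun e []

/-- The vertex of a splitting spells the route to it from the top of the frame: its head is the side
of the wire above, and its tail is the vertex of the splitting where that wire starts. -/
theorem path_injective (H : Evaluates Δ h τ β) (hr : Δ.IsReduced) {t t' : Δ.T}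
    (ht : Δ.topLabel t = [.x]) (ht' : Δ.topLabel t' = [.x])
    (e : β (some t, 0) = β (some t', 0)) : t = t' := by
  obtain ⟨p, hp⟩ := H.exists_path hr ht
  have hp' := e.symm.trans hp
  clear e
  induction p generalizing t t' with
  | nil =>
    obtain ⟨W, hW, eb, hx⟩ := exists_wire_zero_bot ht
    obtain ⟨W', hW', eb', hx'⟩ := exists_wire_zero_bot ht'
    rw [← eb, ← H.wire W hW] at hp
    rw [← eb', ← H.wire W' hW'] at hp'
    obtain ⟨h1, -⟩ | ⟨s, b, q, -, -, -, h1⟩ := H.wire_path hr hW hx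
      fun _ => hr.topLabel_above hW (by rw [eb]) ht
    · obtain ⟨h1', -⟩ | ⟨s, b, q, -, -, -, h1'⟩ := H.wire_path hr hW' hx'
        fun _ => hr.topLabel_above hW' (by rw [eb']) ht'
      · obtain rfl := Δ.top_inj _ hW _ hW' (h1.trans h1'.symm)
        simpa using eb.symm.trans eb'
      · simpa using append_inj (hp'.symm.trans h1')
    · simpa using append_inj (hp.symm.trans h1)
  | cons b p ih =>
    obtain ⟨W, hW, eb, hx⟩ := exists_wire_zero_bot ht
    obtain ⟨W', hW', eb', hx'⟩ := exists_wire_zero_bot ht'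
    rw [← eb, ← H.wire W hW] at hp
    rw [← eb', ← H.wire W' hW'] at hp'
    obtain ⟨-, h1⟩ | ⟨s, c, q, hs, et, hq, h1⟩ := H.wire_path hr hW hx
      fun _ => hr.topLabel_above hW (by rw [eb]) ht
    · simpa using append_inj (hp.symm.trans h1)
    · obtain ⟨-, h1'⟩ | ⟨s', c', q', hs', et', hq', h1'⟩ := H.wire_path hr hW' hx'
        fun _ => hr.topLabel_above hW' (by rw [eb']) ht'
      · simpa using append_inj (hp'.symm.trans h1')
      · obtain ⟨rfl, rfl⟩ := List.cons.inj (append_inj (hp.symm.trans h1))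
        obtain ⟨rfl, rfl⟩ := List.cons.inj (append_inj (hp'.symm.trans h1'))
        obtain rfl := ih hs hs' hq hq'
        obtain rfl := Δ.top_inj _ hW _ hW' (et.trans et'.symm)
        simpa using eb.symm.trans eb'

theorem botLabel_of_topLabel {t : Δ.T} (ht : Δ.topLabel t ≠ [.x]) :
    Δ.botLabel t = [.x] := by
  obtain ⟨h1, -⟩ | ⟨-, h2⟩ := Δ.labels t
  · exact absurd h1 ht
  · exact h2

/-- In a reduced diagram, every transistor with top label `x` is at an irregular vertex. -/
theorem path_mem_irregular (H : Evaluates Δ h τ β) (hr : Δ.IsReduced) {t : Δ.T}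
    (ht : Δ.topLabel t = [.x]) {p : List Bool} (hp : β (some t, 0) = fun s => s ++ p) :
    p ∈ irregular h.symm := by
  induction t using Δ.wellFounded_below.induction generalizing p with
  | _ t ih =>
    by_contra hpi
    have hreg := notMem_irregular.1 hpi
    set q := h.symm p with hq
    -- With `p`, also `b :: p` is regular, so by the induction hypothesis the wire on side `b` does
    -- not enter another splitting. Read through `h.symm`, its value is `s ++ b :: q`, which
    -- excludes the frame and forces side `b` of a joining at `q`.
    have side : ∀ b, ∃ W ∈ Δ.wires, ∃ m, W.top = (some t, sideIndex b) ∧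
        W.bot = (some m, sideIndex b) ∧ Δ.botLabel m = [.x] ∧
        h.symm ∘ τ (some m, 0) = fun s => s ++ q := by
      intro b
      obtain ⟨W, hW, et, hx⟩ := exists_wire_side_top ht b
      have hτ : τ W.top = fun s => s ++ b :: p := by
        rw [et]
        exact H.side_eq ht hp b
      have hβ : h.symm ∘ β W.bot = fun s => s ++ b :: q := by
        rw [← H.wire W hW, hτ]
        funext s
        simpa using hreg (s ++ [b])
      have hbot : ∀ t', W.bot.1 = some t' → Δ.botLabel t' = [.x] := by
        intro t' ht'
        refine botLabel_of_topLabel fun hl => ?_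
        have eb : W.bot = (some t', 0) := by
          have := getElem?_of_bot hW (o := some t') (i := W.bot.2) (Prod.ext ht' rfl)
          rw [Option.elim_some, hl] at this
          exact Prod.ext ht' (eq_zero_of_getElem? this).1
        refine append_notMem_irregular [b] hpi (ih t' ⟨W, hW, by rw [et], ht'⟩ hl ?_)
        rw [← eb, ← H.wire W hW, hτ]
        rfl
      obtain ⟨-, h1⟩ | ⟨m, b', q', hm, eb, hq', h1⟩ :=
        H.flip.wire_path hr.flip (flip_mem_flip hW) hx hbot
      · simpa using append_inj (hβ.symm.trans h1)
      · obtain ⟨rfl, rfl⟩ := List.cons.inj (append_inj (hβ.symm.trans h1))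
        exact ⟨W, hW, m, et, eb, hm, hq'⟩
    obtain ⟨W₀, hW₀, m, et₀, eb₀, hm, hmq⟩ := side false
    obtain ⟨W₂, hW₂, m', et₂, eb₂, hm', hmq'⟩ := side true
    obtain ⟨W₁, hW₁, et₁, ha⟩ := exists_wire_one_top ht
    obtain ⟨m'', q'', hm'', eb₁, hmq'', hc⟩ :=
      H.flip.wire_path_a hr.flip (flip_mem_flip hW₁) ha
    -- The three wires below the splitting end at joinings with the same vertex `q`, hence at a
    -- single joining.
    obtain rfl := H.flip.path_injective hr.flip hm hm' (hmq.trans hmq'.symm)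
    have hqq : q'' = q := by
      have h1 : h.symm (τ W₁.top []) = q'' := by
        rw [H.wire W₁ hW₁]
        exact congrFun hc []
      rw [et₁, H.one_eq ht hp] at h1
      exact h1.symm
    rw [hqq] at hmq''
    obtain rfl := H.flip.path_injective hr.flip hm hm'' (hmq.trans hmq''.symm)
    have hbt : Δ.botLabel t = [.x, .a, .x] := by
      obtain ⟨-, h2⟩ | ⟨h1, -⟩ := Δ.labels t
      · exact h2
      · simp [h1] at ht
    have htm : Δ.topLabel m = [.x, .a, .x] := by
      obtain ⟨-, h2⟩ | ⟨h1, -⟩ := Δ.labels m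
      · rw [show Δ.botLabel m = [.x] from hm] at h2
        simp at h2
      · exact h1
    have eb₁' : W₁.bot = (some m, 1) := eb₁
    have hw : ∀ i l, [Letter.x, .a, .x][i]? = some l →
        ∃ W ∈ Δ.wires, W.top = (some t, i) ∧ W.bot = (some m, i) := by
      rintro (_ | _ | _ | i) l hi
      · exact ⟨W₀, hW₀, et₀, eb₀⟩
      · exact ⟨W₁, hW₁, et₁, eb₁'⟩
      · exact ⟨W₂, hW₂, et₂, eb₂⟩
      · simp at hi
    -- The splitting `t` and the joining `m` that undoes it form a dipole.
    refine hr m t ⟨⟨W₀, hW₀, by rw [et₀], by rw [eb₀]⟩, (show Δ.botLabel m = [.x] from hm).trans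
      ht.symm, fun V hV i => ⟨fun e => ?_, fun e => ?_⟩⟩
    · have hi := getElem?_of_top hV e
      rw [Option.elim_some, hbt] at hi
      obtain ⟨W, hW, h1, h2⟩ := hw i _ hi
      rw [Δ.top_inj _ hV _ hW (e.trans h1.symm), h2]
    · have hi := getElem?_of_bot hV e
      rw [Option.elim_some, htm] at hi
      obtain ⟨W, hW, h1, h2⟩ := hw i _ hi
      rw [Δ.bot_inj _ hV _ hW (e.trans h2.symm), h1]

/-- A wire that does not end at a splitting carries, after `h.symm`, a canonical value. At an
irregular vertex this is impossible. -/
theorem exists_transistor_below (H : Evaluates Δ h τ β) (hr : Δ.IsReduced)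
    {W : Wire Δ.T Letter} (hW : W ∈ Δ.wires) (hx : W.label = .x) {p : List Bool}
    (hp : p ∈ irregular h.symm) (hτ : τ W.top = fun s => s ++ p) :
    ∃ t, Δ.topLabel t = [.x] ∧ β (some t, 0) = fun s => s ++ p := by
  by_cases hb : ∀ t, W.bot.1 = some t → Δ.botLabel t = [.x]
  · exfalso
    have key : ∀ q : List Bool, (h.symm ∘ β W.bot ≠ fun s => s ++ q) := by
      intro q h1
      rw [← H.wire W hW, hτ] at h1
      exact irregular_ne_append hp q h1
    obtain ⟨-, h1⟩ | ⟨m, b, q, -, -, -, h1⟩ :=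
      H.flip.wire_path hr.flip (flip_mem_flip hW) hx hb
    · exact key _ h1
    · exact key _ h1
  · push Not at hb
    obtain ⟨t, ht, hl⟩ := hb
    have ht' : Δ.topLabel t = [.x] := by
      obtain ⟨h1, -⟩ | ⟨-, h2⟩ := Δ.labels t
      · exact h1
      · exact absurd h2 hl
    have eb : W.bot = (some t, 0) := by
      have := getElem?_of_bot hW (o := some t) (i := W.bot.2) (Prod.ext ht rfl)
      rw [Option.elim_some, ht'] at this
      exact Prod.ext ht (eq_zero_of_getElem? this).1
    exact ⟨t, ht', by rw [← eb, ← H.wire W hW, hτ]⟩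

/-- All ancestors of an irregular vertex are irregular, so the subtree is reached by cutting
successively from the root. -/
theorem exists_transistor (H : Evaluates Δ h τ β) (hr : Δ.IsReduced) {p : List Bool}
    (hp : p ∈ irregular h.symm) : ∃ t, Δ.topLabel t = [.x] ∧ β (some t, 0) = fun s => s ++ p := by
  induction p with
  | nil =>
    obtain ⟨W, hW, et, hx⟩ := Δ.exists_wire_top (o := none) (i := 0) (a := .x) rfl
    refine H.exists_transistor_below hr hW hx hp ?_
    rw [et, H.top]
    exact funext fun s => (List.append_nil s).symm
  | cons b p ih =>
    have hp' : p ∈ irregular h.symm := by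
      by_contra hp'
      exact append_notMem_irregular [b] hp' hp
    obtain ⟨t, ht, htp⟩ := ih hp'
    obtain ⟨W, hW, et, hx⟩ := exists_wire_side_top ht b
    refine H.exists_transistor_below hr hW hx hp ?_
    rw [et]
    exact H.side_eq ht htp b

/-! ### Comparison of a reduced diagram with the normal form -/

theorem topValue_eq (H : Evaluates Δ h τ β) (e : irregular h.symm ⊕ irregular h ≃ Δ.T)
    (he₁ : ∀ p, Δ.topLabel (e (.inl p)) = [.x] ∧ β (some (e (.inl p)), 0) = fun s => s ++ p.1)
    (he₂ : ∀ q, Δ.botLabel (e (.inr q)) = [.x] ∧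
      h.symm ∘ τ (some (e (.inr q)), 0) = fun s => s ++ q.1)
    {W : Wire Δ.T Letter} (hW : W ∈ Δ.wires) :
    topValue h.symm h (W.top.map e.symm) = some (W.label, τ W.top) := by
  rcases ht : W.top.1 with _ | t
  · obtain ⟨e1, e2⟩ := top_eq_of_frame hW ht
    rw [e1, e2, H.top]
    rfl
  · have et : W.top = (some t, W.top.2) := Prod.ext ht rfl
    obtain ⟨x, rfl⟩ := e.surjective t
    have em : W.top.map e.symm = (some x, W.top.2) := by
      rw [et]
      simp [Contact.map]
    have hi := getElem?_of_top hW et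
    rw [em, et]
    obtain p | q := x
    · obtain ⟨h1, h2⟩ := he₁ p
      have hb : Δ.botLabel (e (.inl p)) = [.x, .a, .x] := by
        obtain ⟨-, h⟩ | ⟨h, -⟩ := Δ.labels (e (.inl p))
        · exact h
        · simp [h] at h1
      rw [Option.elim_some, hb] at hi
      rcases hn : W.top.2 with _ | _ | _ | n <;> simp only [hn] at hi
      · rw [show τ (some (e (.inl p)), 0) = _ from H.side_eq h1 h2 false]
        obtain hi := Option.some.inj hi
        rw [← hi]
        rfl
      · rw [show τ (some (e (.inl p)), 0 + 1) = _ from H.one_eq h1 h2]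
        obtain hi := Option.some.inj hi
        rw [← hi]
        rfl
      · rw [show τ (some (e (.inl p)), 0 + 1 + 1) = _ from H.side_eq h1 h2 true]
        obtain hi := Option.some.inj hi
        rw [← hi]
        rfl
      · simp at hi
    · obtain ⟨h1, h2⟩ := he₂ q
      rw [Option.elim_some, h1] at hi
      obtain ⟨hi, hl⟩ := eq_zero_of_getElem? hi
      rw [hi, hl]
      have : τ (some (e (.inr q)), 0) = fun s => h (s ++ q.1) := by
        funext s
        exact (h.symm_apply_eq).1 (congrFun h2 s)
      rw [this]
      rfl

theorem botValue_eq (H : Evaluates Δ h τ β) (e : irregular h.symm ⊕ irregular h ≃ Δ.T)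
    (he₁ : ∀ p, Δ.topLabel (e (.inl p)) = [.x] ∧ β (some (e (.inl p)), 0) = fun s => s ++ p.1)
    (he₂ : ∀ q, Δ.botLabel (e (.inr q)) = [.x] ∧
      h.symm ∘ τ (some (e (.inr q)), 0) = fun s => s ++ q.1)
    {W : Wire Δ.T Letter} (hW : W ∈ Δ.wires) :
    botValue h.symm h (W.bot.map e.symm) = some (W.label, β W.bot) := by
  have key := H.flip.topValue_eq ((Equiv.sumComm _ _).trans e) he₂ (fun p => ⟨(he₁ p).1, by
    rw [← (he₁ p).2]
    funext s
    simp
    rfl⟩) (flip_mem_flip hW)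
  have hc : (W.bot.map e.symm).map Sum.swap =
      W.flip.top.map ((Equiv.sumComm _ _).trans e).symm := by
    simp [Contact.map, Wire.flip, Function.comp_def]
  unfold botValue
  rw [hc]
  refine (congrArg (Option.map _) key).trans ?_
  have : h ∘ h.symm ∘ β W.bot = β W.bot := funext fun s => h.apply_symm_apply _
  exact congrArg (fun f => some (W.label, f)) this

/-- Transistors correspond to irregular vertices on both sides, and corresponding contacts carry the
same values. Both ends of a wire carry one value, which is exactly the condition for a wire of the
normal form. -/
theorem equivalent_normalForm (H : Evaluates Δ h τ β) (hr : Δ.IsReduced)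
    (hf : (exceptions h).Finite) : Δ.Equivalent (normalForm h hf) := by
  choose F₁ hF₁ using fun p : irregular h.symm => H.exists_transistor hr p.2
  choose F₂ hF₂ using fun q : irregular h => H.flip.exists_transistor hr.flip q.2
  have hbij : Function.Bijective (Sum.elim F₁ F₂) := by
    have hne : ∀ p q, F₁ p ≠ F₂ q := by
      intro p q e
      have h1 := (hF₁ p).1
      have h2 : Δ.botLabel (F₂ q) = [.x] := (hF₂ q).1
      rw [← e] at h2
      obtain ⟨-, h3⟩ | ⟨h3, -⟩ := Δ.labels (F₁ p)
      · simp [h2] at h3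
      · simp [h1] at h3
    constructor
    · rintro (p | q) (p' | q') e
      · have e : F₁ p = F₁ p' := e
        rw [Subtype.ext (append_inj ((hF₁ p).2.symm.trans (e ▸ (hF₁ p').2)))]
      · exact absurd e (hne p q')
      · exact absurd e.symm (hne p' q)
      · have e : F₂ q = F₂ q' := e
        rw [Subtype.ext (append_inj ((hF₂ q).2.symm.trans (e ▸ (hF₂ q').2)))]
    · intro t
      obtain ⟨ht, -⟩ | ⟨-, ht⟩ := Δ.labels t
      · obtain ⟨p, hp⟩ := H.exists_path hr ht
        refine ⟨.inl ⟨p, H.path_mem_irregular hr ht hp⟩, ?_⟩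
        exact H.path_injective hr (hF₁ _).1 ht ((hF₁ _).2.trans hp.symm)
      · obtain ⟨q, hq⟩ := H.flip.exists_path hr.flip ht
        refine ⟨.inr ⟨q, H.flip.path_mem_irregular hr.flip ht hq⟩, ?_⟩
        exact H.flip.path_injective hr.flip (hF₂ _).1 ht ((hF₂ _).2.trans hq.symm)
  let e : irregular h.symm ⊕ irregular h ≃ Δ.T := Equiv.ofBijective _ hbij
  have hl : ∀ x, Δ.topLabel (e x) = (normalForm h hf).topLabel x ∧
      Δ.botLabel (e x) = (normalForm h hf).botLabel x := by
    rintro (p | q)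
    · obtain ⟨h1, h2⟩ | ⟨h1, -⟩ := Δ.labels (F₁ p)
      · exact ⟨h1, h2⟩
      · simp [(hF₁ p).1] at h1
    · obtain ⟨-, h2⟩ | ⟨h1, h2⟩ := Δ.labels (F₂ q)
      · simp [show Δ.botLabel (F₂ q) = [.x] from (hF₂ q).1] at h2
      · exact ⟨h1, h2⟩
  refine equivalent_of_forward (Δ := Δ) (Δ' := normalForm h hf) e.symm (fun t => ?_) (fun t => ?_)
    fun W hW => ⟨τ W.top, H.topValue_eq e hF₁ hF₂ hW, ?_⟩
  · have := (hl (e.symm t)).1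
    rw [Equiv.apply_symm_apply] at this
    exact this.symm
  · have := (hl (e.symm t)).2
    rw [Equiv.apply_symm_apply] at this
    exact this.symm
  · rw [H.wire W hW]
    exact H.botValue_eq e hF₁ hF₂ hW

end Evaluates

/-- Both diagrams reduce to the normal form of the same permutation. -/
theorem dipoleEquiv_of_eval_eq (h : Δ.eval = Δ'.eval) : Δ.DipoleEquiv Δ' := by
  have key : ∀ (Γ : TreeDiagram), Γ.eval = Δ.perm →
      Γ.DipoleEquiv (normalForm Δ.perm Δ.exceptions_eval_finite) := by
    intro Γ hΓ
    obtain ⟨Γ', hr, hd⟩ := exists_isReduced (by simp) Γ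
    have H : Evaluates Γ' Δ.perm (Γ'.topValues id) (Γ'.botValues id) :=
      ⟨Γ'.isAssignment_values id, rfl, hd.eval_eq.symm.trans hΓ⟩
    exact .trans _ _ _ hd (.rel _ _ (Or.inl (H.equivalent_normalForm hr _)))
  exact .trans _ _ _ (key Δ rfl) (.symm _ _ (key Δ' h.symm))

end BraidedDiagram

theorem diagramGroupToQAut_bijective : Function.Bijective diagramGroupToQAut := by
  constructor
  · rintro ⟨Δ⟩ ⟨Δ'⟩ h
    refine Quotient.sound (BraidedDiagram.dipoleEquiv_of_eval_eq ?_)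
    exact congrArg (fun g : QAut => (g.1 : List Bool → List Bool)) h
  · rintro ⟨h, hh⟩
    have hf := (mem_QAut_iff h).1 hh
    refine ⟨Quotient.mk _ (BraidedDiagram.normalForm h hf), Subtype.ext (Equiv.ext ?_)⟩
    exact congrFun (BraidedDiagram.eval_normalForm h hf)

/-! ### The compact ultrametric space of vertices and ends of the tree -/

/-- The vertices and ends of the tree, as finite and infinite sequences of left/right choices, the
first choice coming first. -/
def TreePoint := {x : ℕ → Option Bool // ∀ n, x n = none → x (n + 1) = none}

namespace TreePoint

theorem uniformity_bot_eq : ∀ _ : ℕ, @uniformity (Option Bool) ⊥ = Filter.principal SetRel.id :=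
  fun _ => rfl

/-- The metric on sequences for which two sequences that first differ at the index `n` have
distance `2⁻ⁿ`. -/
noncomputable abbrev sequenceMetric : MetricSpace (ℕ → Option Bool) :=
  @PiNat.metricSpaceOfDiscreteUniformity (fun _ => Option Bool) (fun _ => ⊥) uniformity_bot_eq

attribute [local instance] sequenceMetric

noncomputable instance : MetricSpace TreePoint :=
  MetricSpace.induced Subtype.val Subtype.val_injective inferInstance

theorem dist_eq (x y : TreePoint) : dist x y = dist x.1 y.1 := rfl

instance : IsUltrametricDist TreePoint :=
  ⟨fun x y z => PiNat.dist_triangle_nonarch x.1 y.1 z.1⟩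

/-- A closed subset of a product of finite discrete spaces; each defining condition involves only
two coordinates. -/
instance : CompactSpace TreePoint := by
  let _ : TopologicalSpace (Option Bool) := ⊥
  have : DiscreteTopology (Option Bool) := ⟨rfl⟩
  have hc : IsClosed {x : ℕ → Option Bool | ∀ n, x n = none → x (n + 1) = none} := by
    simp only [Set.ofPred_forall]
    refine isClosed_iInter fun n => ?_
    have : IsClosed {p : Option Bool × Option Bool | p.1 = none → p.2 = none} := isClosed_discrete _
    exact this.preimage (f := fun x : ℕ → Option Bool => (x n, x (n + 1))) (by fun_prop)
  exact isCompact_iff_compactSpace.1 hc.isCompact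

/-- The sequence `b, x₀, x₁, …`. -/
def cons (b : Bool) (x : TreePoint) : TreePoint :=
  ⟨fun n => n.casesOn (some b) x.1, fun n => by
    cases n with
    | zero => simp
    | succ n => exact x.2 n⟩

/-- The empty sequence. -/
def root : TreePoint := ⟨fun _ => none, fun _ _ => rfl⟩

theorem cons_injective (b : Bool) : Function.Injective (cons b) := fun _ _ h =>
  Subtype.ext (funext fun n => congrFun (congrArg Subtype.val h) (n + 1))

theorem cons_inj {b c : Bool} {x y : TreePoint} (h : cons b x = cons c y) : b = c ∧ x = y := by
  obtain rfl : b = c := Option.some.inj (congrFun (congrArg Subtype.val h) 0)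
  exact ⟨rfl, cons_injective b h⟩

theorem cons_ne_root (b : Bool) (x : TreePoint) : cons b x ≠ root := fun h =>
  Option.some_ne_none b (congrFun (congrArg Subtype.val h) 0)

theorem eq_root_or_cons (x : TreePoint) : x = root ∨ ∃ b y, x = cons b y := by
  rcases h0 : x.1 0 with _ | b
  · left
    refine Subtype.ext (funext fun n => ?_)
    induction n with
    | zero => exact h0
    | succ n ih => exact x.2 n ih
  · right
    refine ⟨b, ⟨fun n => x.1 (n + 1), fun n => x.2 (n + 1)⟩, Subtype.ext (funext fun n => ?_)⟩
    cases n with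
    | zero => exact h0
    | succ n => rfl

/-- The point reached from the vertex `v` by the choices `x`. -/
def graft : List Bool → TreePoint → TreePoint
  | [], x => x
  | b :: v, x => graft v (cons b x)

/-- The point that corresponds to a vertex. -/
def node (v : List Bool) : TreePoint := graft v root

/-- The set of all vertices and ends below a vertex. -/
def cone (v : List Bool) : Set TreePoint := Set.range (graft v)

theorem graft_append (s v : List Bool) (x : TreePoint) :
    graft (s ++ v) x = graft v (graft s x) := by
  induction s generalizing x with
  | nil => rfl
  | cons b s ih => exact ih _

theorem graft_concat (v : List Bool) (b : Bool) (x : TreePoint) :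
    graft (v ++ [b]) x = cons b (graft v x) := graft_append _ _ _

theorem graft_node (v s : List Bool) : graft v (node s) = node (s ++ v) :=
  (graft_append s v root).symm

theorem graft_injective (v : List Bool) : Function.Injective (graft v) := by
  induction v with
  | nil => exact Function.injective_id
  | cons b v ih => exact ih.comp (cons_injective b)

theorem node_mem_cone_self (v : List Bool) : node v ∈ cone v := ⟨root, rfl⟩

theorem graft_eq_root {v : List Bool} {x : TreePoint} (h : graft v x = root) :
    v = [] ∧ x = root := by
  obtain rfl | ⟨v, b, rfl⟩ := List.eq_nil_or_concat' v
  · exact ⟨rfl, h⟩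
  · rw [graft_concat] at h
    exact absurd h (cons_ne_root _ _)

/-- One of the two vertices must be an ancestor of the other. The induction compares first choices,
which stand at the end of the lists. -/
theorem graft_eq_graft {v w : List Bool} {x y : TreePoint} (h : graft v x = graft w y) :
    (∃ s, v = s ++ w ∧ y = graft s x) ∨ ∃ s, w = s ++ v ∧ x = graft s y := by
  induction v using List.reverseRecOn generalizing w with
  | nil => exact Or.inr ⟨w, by simp, h⟩
  | append_singleton v b ih =>
    obtain rfl | ⟨w, c, rfl⟩ := List.eq_nil_or_concat' w
    · exact Or.inl ⟨v ++ [b], by simp, h.symm⟩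
    · rw [graft_concat, graft_concat] at h
      obtain ⟨rfl, h'⟩ := cons_inj h
      obtain ⟨s, rfl, hs⟩ | ⟨s, rfl, hs⟩ := ih h'
      · exact Or.inl ⟨s, by simp, hs⟩
      · exact Or.inr ⟨s, by simp, hs⟩

theorem node_eq_graft {v w : List Bool} {x : TreePoint} (h : node v = graft w x) :
    ∃ s, v = s ++ w ∧ x = node s := by
  obtain ⟨s, rfl, hs⟩ | ⟨s, rfl, hs⟩ := graft_eq_graft h
  · exact ⟨s, rfl, hs⟩
  · obtain ⟨rfl, rfl⟩ := graft_eq_root hs.symm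
    exact ⟨[], rfl, rfl⟩

theorem node_injective : Function.Injective node := by
  intro v w h
  obtain ⟨s, rfl, hs⟩ := node_eq_graft (x := root) h
  obtain ⟨rfl, -⟩ := graft_eq_root hs.symm
  rfl

theorem cone_injective : Function.Injective cone := by
  intro v w h
  obtain ⟨x, hx⟩ := h.subset (node_mem_cone_self v)
  obtain ⟨y, hy⟩ := h.superset (node_mem_cone_self w)
  obtain ⟨s, hs, -⟩ := node_eq_graft hx.symm
  obtain ⟨t, ht, -⟩ := node_eq_graft hy.symm
  have h1 := congrArg List.length hs
  have h2 := congrArg List.length ht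
  simp only [List.length_append] at h1 h2
  have : s = [] := List.length_eq_zero_iff.1 (by omega)
  simpa [this] using hs

theorem cone_ne_singleton (v w : List Bool) : cone v ≠ {node w} := by
  intro h
  have h1 : node v = node w := h.subset (node_mem_cone_self v)
  have h2 : graft v (cons true root) = node w := h.subset ⟨_, rfl⟩
  exact cons_ne_root _ _ (graft_injective v (h2.trans h1.symm))

/-! #### Balls -/

theorem dist_eq_pow {x y : TreePoint} (h : x ≠ y) :
    dist x y = (1 / 2 : ℝ) ^ PiNat.firstDiff x.1 y.1 :=
  PiNat.dist_eq_of_ne (Subtype.coe_ne_coe.2 h)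

theorem le_firstDiff_iff {x y : TreePoint} (h : x ≠ y) (n : ℕ) :
    n ≤ PiNat.firstDiff x.1 y.1 ↔ ∀ i < n, x.1 i = y.1 i := by
  rw [← PiNat.mem_cylinder_iff_le_firstDiff (Subtype.coe_ne_coe.2 h), PiNat.mem_cylinder_iff]

theorem dist_cons (b : Bool) (x y : TreePoint) :
    dist (cons b x) (cons b y) = 1 / 2 * dist x y := by
  by_cases h : x = y
  · simp [h]
  · have h' : cons b x ≠ cons b y := fun e => h (cons_injective b e)
    have key : PiNat.firstDiff (cons b x).1 (cons b y).1 = PiNat.firstDiff x.1 y.1 + 1 := by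
      refine eq_of_forall_le_iff fun n => ?_
      rw [le_firstDiff_iff h']
      cases n with
      | zero => simp
      | succ n =>
        rw [Nat.add_le_add_iff_right, le_firstDiff_iff h]
        refine ⟨fun H i hi => H (i + 1) (by omega), fun H i hi => ?_⟩
        cases i with
        | zero => rfl
        | succ i => exact H i (by omega)
    rw [dist_eq_pow h, dist_eq_pow h', key, pow_succ']

theorem dist_graft (v : List Bool) (x y : TreePoint) :
    dist (graft v x) (graft v y) = (1 / 2) ^ v.length * dist x y := by
  induction v generalizing x y with
  | nil => simp [graft]
  | cons b v ih =>
    rw [graft, graft, ih, dist_cons, List.length_cons, pow_succ]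
    ring

/-- The points that agree with `x` at the first `n` places. -/
def cylinder (x : TreePoint) (n : ℕ) : Set TreePoint := {y | ∀ i < n, y.1 i = x.1 i}

/-- Distances are powers of `1 / 2`, so a radius matters only through the first power below it. -/
theorem ball_eq_cylinder (x : TreePoint) {r : ℝ} {n : ℕ} (h : (1 / 2) ^ n < r)
    (h' : ∀ k < n, r ≤ (1 / 2) ^ k) : Metric.ball x r = cylinder x n := by
  ext y
  by_cases e : y = x
  · subst e
    have : (0 : ℝ) < r := lt_trans (by positivity) h
    simp [this, cylinder]
  · rw [Metric.mem_ball, dist_eq_pow e]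
    refine Iff.trans ?_ (le_firstDiff_iff e n)
    constructor
    · intro hr
      by_contra hlt
      exact absurd hr (not_lt.2 (h' _ (not_le.1 hlt)))
    · intro hn
      exact lt_of_le_of_lt (pow_le_pow_of_le_one (by norm_num) (by norm_num) hn) h

theorem isBall_cylinder (x : TreePoint) (n : ℕ) : IsBall (cylinder x n) := by
  cases n with
  -- All distances are at most `1`, so radius `2` gives the whole space.
  | zero => exact ⟨x, 2, by norm_num, (ball_eq_cylinder x (by norm_num) (by simp)).symm⟩
  | succ n =>
    -- Balls are open, so radius `(1 / 2) ^ n` forces agreement at `n + 1` places.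
    refine ⟨x, (1 / 2) ^ n, by positivity, (ball_eq_cylinder x ?_ fun k hk => ?_).symm⟩
    · exact pow_lt_pow_right_of_lt_one₀ (by norm_num) (by norm_num) (Nat.lt_succ_self n)
    · exact pow_le_pow_of_le_one (by norm_num) (by norm_num) (Nat.lt_succ_iff.1 hk)

theorem exists_eq_cylinder {B : Set TreePoint} (h : IsBall B) : ∃ x n, B = cylinder x n := by
  obtain ⟨x, r, hr, rfl⟩ := h
  have hex : ∃ n : ℕ, (1 / 2 : ℝ) ^ n < r := exists_pow_lt_of_lt_one hr (by norm_num)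
  classical
  exact ⟨x, Nat.find hex, ball_eq_cylinder x (Nat.find_spec hex)
    fun k hk => not_lt.1 (Nat.find_min hex hk)⟩

/-- The root is an isolated point: one further entry `none` already ends the sequence. This is where
balls with a single point come from. -/
theorem cylinder_root (n : ℕ) : cylinder root (n + 1) = {root} := by
  ext y
  constructor
  · intro hy
    obtain rfl | ⟨b, y, rfl⟩ := eq_root_or_cons y
    · rfl
    · have : some b = none := hy 0 (Nat.succ_pos n)
      simp at this
  · rintro rfl i -
    rfl

theorem cylinder_cons (b : Bool) (x : TreePoint) (n : ℕ) :
    cylinder (cons b x) (n + 1) = cons b '' cylinder x n := by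
  ext y
  constructor
  · intro hy
    obtain rfl | ⟨c, y, rfl⟩ := eq_root_or_cons y
    · have : none = some b := hy 0 (Nat.succ_pos n)
      simp at this
    · obtain rfl : c = b := Option.some.inj (hy 0 (Nat.succ_pos n))
      exact ⟨y, fun i hi => hy (i + 1) (by omega), rfl⟩
  · rintro ⟨y, hy, rfl⟩ i hi
    cases i with
    | zero => rfl
    | succ i => exact hy i (by omega)

theorem cone_concat (v : List Bool) (b : Bool) : cone (v ++ [b]) = cons b '' cone v := by
  unfold cone
  rw [← Set.range_comp]
  exact congrArg Set.range (funext fun x => graft_concat v b x)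

theorem node_concat (v : List Bool) (b : Bool) : node (v ++ [b]) = cons b (node v) :=
  graft_concat v b root

theorem cylinder_zero (x : TreePoint) : cylinder x 0 = cone [] := by
  ext y
  exact ⟨fun _ => ⟨y, rfl⟩, fun _ i hi => absurd hi (Nat.not_lt_zero i)⟩

theorem cylinder_node (v : List Bool) : cylinder (node v) v.length = cone v := by
  induction v using List.reverseRecOn with
  | nil => exact cylinder_zero _
  | append_singleton v b ih =>
    rw [List.length_append, List.length_singleton, node_concat, cylinder_cons, ih, cone_concat]

theorem cylinder_node_succ (v : List Bool) : cylinder (node v) (v.length + 1) = {node v} := by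
  induction v using List.reverseRecOn with
  | nil => exact cylinder_root _
  | append_singleton v b ih =>
    rw [List.length_append, List.length_singleton, node_concat, cylinder_cons, ih,
      Set.image_singleton]

/-- The choices of `x` are peeled off one by one: if `x` lasts for `n` choices a cone remains,
otherwise a single vertex. -/
theorem cylinder_eq (x : TreePoint) (n : ℕ) :
    (∃ v, cylinder x n = cone v) ∨ ∃ v, cylinder x n = {node v} := by
  induction n generalizing x with
  | zero => exact Or.inl ⟨[], cylinder_zero x⟩
  | succ n ih =>
    obtain rfl | ⟨b, y, rfl⟩ := eq_root_or_cons x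
    · exact Or.inr ⟨[], cylinder_root n⟩
    · rw [cylinder_cons]
      obtain ⟨v, hv⟩ | ⟨v, hv⟩ := ih y
      · exact Or.inl ⟨v ++ [b], by rw [hv, cone_concat]⟩
      · exact Or.inr ⟨v ++ [b], by rw [hv, node_concat, Set.image_singleton]⟩

theorem ball_eq (B : Ball TreePoint) : (∃ v, B.1 = cone v) ∨ ∃ v, B.1 = {node v} := by
  obtain ⟨x, n, h⟩ := exists_eq_cylinder B.2
  rw [h]
  exact cylinder_eq x n

/-- The ball of all points below a vertex. -/
def coneBall (v : List Bool) : Ball TreePoint :=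
  ⟨cone v, cylinder_node v ▸ isBall_cylinder _ _⟩

/-- The ball that consists of a vertex only. -/
def nodeBall (v : List Bool) : Ball TreePoint :=
  ⟨{node v}, cylinder_node_succ v ▸ isBall_cylinder _ _⟩

/-! #### The similarity structure -/

/-- The order-preserving similarities between the sets of all points below two vertices, and the
bijections between singletons of vertices. -/
def canonicalSim (B₁ B₂ : Ball TreePoint) : Set (B₁.1 ≃ B₂.1) :=
  {σ | ∃ v w, (B₁.1 = cone v ∧ B₂.1 = cone w ∧
      ∀ (y : B₁.1) z, y.1 = graft v z → (σ y).1 = graft w z) ∨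
    (B₁.1 = {node v} ∧ B₂.1 = {node w})}

theorem canonicalSim_subsingleton (B₁ B₂ : Ball TreePoint) :
    (canonicalSim B₁ B₂).Subsingleton := by
  rintro σ ⟨v, w, ⟨h1, h2, h3⟩ | ⟨h1, h2⟩⟩ σ' ⟨v', w', ⟨h1', h2', h3'⟩ | ⟨h1', h2'⟩⟩
  · obtain rfl := cone_injective (h1.symm.trans h1')
    obtain rfl := cone_injective (h2.symm.trans h2')
    refine Equiv.ext fun y => Subtype.ext ?_
    obtain ⟨z, hz⟩ := h1.subset y.2
    rw [h3 y z hz.symm, h3' y z hz.symm]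
  · exact absurd (h1.symm.trans h1') (cone_ne_singleton _ _)
  · exact absurd (h1'.symm.trans h1) (cone_ne_singleton _ _)
  · refine Equiv.ext fun y => Subtype.ext ?_
    exact (h2.subset (σ y).2).trans (h2.subset (σ' y).2).symm

/-- A ball inside the cone at `v` is a cone or a single vertex at some `s ++ v`, and the canonical
map sends it to its counterpart at `s ++ w`. -/
theorem canonicalSim_restrict {B₁ B₂ B₃ B₄ : Ball TreePoint} {h : B₁.1 ≃ B₂.1}
    (hh : h ∈ canonicalSim B₁ B₂) (hs : B₃.1 ⊆ B₁.1)
    (hr : (Set.range fun y : B₃.1 => (h ⟨y, hs y.2⟩).1) = B₄.1) :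
    ∃ g ∈ canonicalSim B₃ B₄, ∀ y : B₃.1, (g y).1 = h ⟨y, hs y.2⟩ := by
  have hinj : Function.Injective fun y : B₃.1 => (h ⟨y, hs y.2⟩).1 := fun y y' e => by
    have := h.injective (Subtype.ext e)
    exact Subtype.ext (congrArg (fun z : B₁.1 => z.1) this)
  let g : B₃.1 ≃ B₄.1 := (Equiv.ofInjective _ hinj).trans (Equiv.setCongr hr)
  have hg : ∀ y : B₃.1, (g y).1 = h ⟨y, hs y.2⟩ := fun y => rfl
  refine ⟨g, ?_, hg⟩
  obtain ⟨v, w, ⟨h1, h2, h3⟩ | ⟨h1, h2⟩⟩ := hh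
  · obtain ⟨u, hu⟩ | ⟨u, hu⟩ := ball_eq B₃
    · obtain ⟨z, hz⟩ := h1.subset (hs (hu.superset (node_mem_cone_self u)))
      obtain ⟨s, rfl, -⟩ := node_eq_graft hz.symm
      have hval : ∀ (y : B₃.1) z, y.1 = graft (s ++ v) z → (g y).1 = graft (s ++ w) z := by
        intro y z e
        rw [graft_append] at e ⊢
        rw [hg, h3 ⟨y, hs y.2⟩ _ e]
      refine ⟨s ++ v, s ++ w, Or.inl ⟨hu, ?_, hval⟩⟩
      rw [← hr]
      ext x
      constructor
      · rintro ⟨y, rfl⟩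
        obtain ⟨z, hz⟩ := hu.subset y.2
        exact ⟨z, (hval y z hz.symm).symm⟩
      · rintro ⟨z, rfl⟩
        exact ⟨⟨graft (s ++ v) z, hu.superset ⟨z, rfl⟩⟩, hval _ z rfl⟩
    · obtain ⟨z, hz⟩ := h1.subset (hs (hu.superset (Set.mem_singleton (node u))))
      obtain ⟨s, rfl, rfl⟩ := node_eq_graft hz.symm
      refine ⟨s ++ v, s ++ w, Or.inr ⟨hu, ?_⟩⟩
      have hval : ∀ y : B₃.1, (h ⟨y, hs y.2⟩).1 = node (s ++ w) := by
        intro y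
        rw [h3 ⟨y, hs y.2⟩ (node s) (by rw [graft_node]; exact hu.subset y.2), graft_node]
      rw [← hr]
      ext x
      constructor
      · rintro ⟨y, rfl⟩
        exact hval y
      · rintro rfl
        exact ⟨⟨_, hu.superset (Set.mem_singleton _)⟩, hval _⟩
  · obtain ⟨u, hu⟩ | ⟨u, hu⟩ := ball_eq B₃
    · exfalso
      refine cone_ne_singleton u v ?_
      rw [hu, h1] at hs
      exact (Set.subset_singleton_iff_eq.1 hs).resolve_left
        (Set.nonempty_iff_ne_empty.1 ⟨_, node_mem_cone_self u⟩)
    · refine ⟨u, w, Or.inr ⟨hu, ?_⟩⟩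
      rw [← hr]
      ext x
      constructor
      · rintro ⟨y, rfl⟩
        exact h2.subset (h _).2
      · rintro rfl
        exact ⟨⟨_, hu.superset (Set.mem_singleton _)⟩, h2.subset (h _).2⟩

theorem canonicalSim_similarity {B₁ B₂ : Ball TreePoint} {h : B₁.1 ≃ B₂.1}
    (hh : h ∈ canonicalSim B₁ B₂) :
    ∃ C : ℝ, 0 < C ∧ ∀ x y, dist (h x) (h y) = C * dist x y := by
  obtain ⟨v, w, ⟨h1, h2, h3⟩ | ⟨h1, h2⟩⟩ := hh
  -- The quotient of the contraction factors of `graft w` and `graft v`.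
  · refine ⟨(1 / 2) ^ w.length / (1 / 2) ^ v.length, by positivity, fun x y => ?_⟩
    obtain ⟨a, ha⟩ := h1.subset x.2
    obtain ⟨b, hb⟩ := h1.subset y.2
    rw [Subtype.dist_eq, Subtype.dist_eq, h3 x a ha.symm, h3 y b hb.symm, ← ha, ← hb, dist_graft,
      dist_graft]
    field_simp
  · refine ⟨1, one_pos, fun x y => ?_⟩
    have e : x = y := Subtype.ext ((h1.subset x.2).trans (h1.subset y.2).symm)
    simp [e]

/-- The small similarity structure on the space of vertices and ends of the tree. -/
def similarityStructure : FiniteSimilarityStructure TreePoint where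
  sim := canonicalSim
  similarity _ _ _ hh := canonicalSim_similarity hh
  finite B₁ B₂ := (canonicalSim_subsingleton B₁ B₂).finite
  refl_mem B := by
    obtain ⟨v, hv⟩ | ⟨v, hv⟩ := ball_eq B
    · exact ⟨v, v, Or.inl ⟨hv, hv, fun _ _ e => e⟩⟩
    · exact ⟨v, v, Or.inr ⟨hv, hv⟩⟩
  symm_mem := by
    rintro B₁ B₂ h ⟨v, w, ⟨h1, h2, h3⟩ | ⟨h1, h2⟩⟩
    · refine ⟨w, v, Or.inl ⟨h2, h1, fun y z e => ?_⟩⟩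
      obtain ⟨z', hz'⟩ := h1.subset (h.symm y).2
      have := h3 (h.symm y) z' hz'.symm
      rw [Equiv.apply_symm_apply, e] at this
      rw [← hz', graft_injective w this]
    · exact ⟨w, v, Or.inr ⟨h2, h1⟩⟩
  trans_mem := by
    rintro B₁ B₂ B₃ h ⟨v, w, ⟨h1, h2, h3⟩ | ⟨h1, h2⟩⟩ k ⟨w', u, ⟨k1, k2, k3⟩ | ⟨k1, k2⟩⟩
    · obtain rfl := cone_injective (h2.symm.trans k1)
      exact ⟨v, u, Or.inl ⟨h1, k2, fun y z e => k3 _ z (h3 y z e)⟩⟩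
    · exact absurd (h2.symm.trans k1) (cone_ne_singleton _ _)
    · exact absurd (k1.symm.trans h2) (cone_ne_singleton _ _)
    · exact ⟨v, u, Or.inr ⟨h1, k2⟩⟩
  restrict_mem _ _ _ _ _ hh hs hr := canonicalSim_restrict hh hs hr

theorem similarityStructure_isSmall : similarityStructure.IsSmall := canonicalSim_subsingleton

end TreePoint

/-! ### Quasi-automorphisms as locally determined homeomorphisms -/

namespace TreePoint

theorem isOpen_ball (B : Ball TreePoint) : IsOpen B.1 := by
  obtain ⟨x, r, -, h⟩ := B.2
  rw [h]
  exact Metric.isOpen_ball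

theorem denseRange_node : DenseRange node := by
  rw [Metric.denseRange_iff]
  intro x r hr
  obtain ⟨v, hv⟩ | ⟨v, hv⟩ := ball_eq ⟨Metric.ball x r, x, r, hr, rfl⟩
  · exact ⟨v, Metric.mem_ball'.1 (hv.superset (node_mem_cone_self v))⟩
  · exact ⟨v, Metric.mem_ball'.1 (hv.superset (Set.mem_singleton _))⟩

theorem exists_node_of_mem_group {h : TreePoint ≃ₜ TreePoint} (hh : h ∈ similarityStructure.group)
    (u : List Bool) : ∃ w, h (node u) = node w := by
  obtain ⟨B, B', hx, σ, ⟨v, w, ⟨h1, h2, h3⟩ | ⟨h1, h2⟩⟩, hσ⟩ := hh (node u)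
  · obtain ⟨z, hz⟩ := h1.subset hx
    obtain ⟨s, rfl, rfl⟩ := node_eq_graft hz.symm
    exact ⟨s ++ w, by rw [hσ ⟨_, hx⟩, h3 ⟨_, hx⟩ _ hz.symm, graft_node]⟩
  · exact ⟨w, by rw [hσ ⟨_, hx⟩]; exact h2.subset (σ _).2⟩

/-- The vertex to which an element of the group maps a vertex. -/
noncomputable def vertexMap (h : similarityStructure.group) (v : List Bool) : List Bool :=
  (exists_node_of_mem_group h.2 v).choose

theorem node_vertexMap (h : similarityStructure.group) (v : List Bool) :
    node (vertexMap h v) = h.1 (node v) :=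
  (exists_node_of_mem_group h.2 v).choose_spec.symm

theorem vertexMap_mul (g h : similarityStructure.group) (v : List Bool) :
    vertexMap (g * h) v = vertexMap g (vertexMap h v) := by
  apply node_injective
  rw [node_vertexMap, node_vertexMap, node_vertexMap]
  rfl

theorem vertexMap_one (v : List Bool) : vertexMap 1 v = v := by
  apply node_injective
  rw [node_vertexMap]
  rfl

/-- The permutation of the vertices induced by an element of the group. -/
noncomputable def vertexPerm (h : similarityStructure.group) : Equiv.Perm (List Bool) where
  toFun := vertexMap h
  invFun := vertexMap h⁻¹
  left_inv v := by rw [← vertexMap_mul, inv_mul_cancel, vertexMap_one]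
  right_inv v := by rw [← vertexMap_mul, mul_inv_cancel, vertexMap_one]

/-- Finitely many of the balls given by local determination cover the space. On a cone the map
preserves the edges below every vertex, so each ball of the cover yields at most one exception, and
only if it is a single vertex. -/
theorem exceptions_vertexMap_finite (h : similarityStructure.group) :
    (exceptions (vertexMap h)).Finite := by
  choose B B' hx σ hσ hval using h.2
  obtain ⟨t, -, ht⟩ := isCompact_univ.elim_nhds_subcover (fun x => (B x).1)
    fun x _ => (isOpen_ball (B x)).mem_nhds (hx x)
  refine (t.finite_toSet.biUnion (t := fun x => {v | (B x).1 = {node v}}) fun x _ =>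
    Set.Subsingleton.finite fun v hv w hw => node_injective ?_).subset ?_
  · exact Set.singleton_injective ((Eq.symm hv).trans hw)
  · rintro u ⟨b, hb⟩
    obtain ⟨x, hxt, hu⟩ := Set.mem_iUnion₂.1 (ht (Set.mem_univ (node u)))
    refine Set.mem_biUnion hxt ?_
    obtain ⟨v, w, ⟨h1, h2, h3⟩ | ⟨h1, h2⟩⟩ := hσ x
    · refine absurd ?_ hb
      have key : ∀ s, vertexMap h (s ++ v) = s ++ w := by
        intro s
        apply node_injective
        have hm : node (s ++ v) ∈ (B x).1 := by
          rw [h1, ← graft_node]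
          exact ⟨_, rfl⟩
        rw [node_vertexMap, hval x ⟨_, hm⟩, h3 ⟨_, hm⟩ (node s) (graft_node v s).symm, graft_node]
      obtain ⟨z, hz⟩ := h1.subset hu
      obtain ⟨s, rfl, -⟩ := node_eq_graft hz.symm
      rw [key, ← List.cons_append, key, List.cons_append]
    · change (B x).1 = {node u}
      rw [h1, show node u = node v from h1.subset hu]

/-- The homomorphism that restricts the elements of the group to the vertices. -/
noncomputable def groupToQAut : similarityStructure.group →* QAut :=
  MonoidHom.mk' (fun h => ⟨vertexPerm h, (mem_QAut_iff _).2 (exceptions_vertexMap_finite h)⟩)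
    fun g h => Subtype.ext (Equiv.ext (vertexMap_mul g h))

/-- Continuous maps that agree on the dense set of vertices are equal. -/
theorem groupToQAut_injective : Function.Injective groupToQAut := by
  intro g h e
  have e' : ∀ v, vertexMap g v = vertexMap h v :=
    fun v => congrArg (fun k : QAut => k.1 v) e
  refine Subtype.ext (Homeomorph.ext (congrFun (denseRange_node.equalizer g.1.continuous
    h.1.continuous (funext fun v => ?_))))
  change g.1 (node v) = h.1 (node v)
  rw [← node_vertexMap, ← node_vertexMap, e']

/-! #### Extension of quasi-automorphisms to the ends of the tree -/

/-- The graph of the extension of a quasi-automorphism. -/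
def ExtensionGraph (g : List Bool → List Bool) (x y : TreePoint) : Prop :=
  (∃ v, x = node v ∧ y = node (g v)) ∨
    ∃ v, v ∉ irregular g ∧ ∃ z, x = graft v z ∧ y = graft (g v) z

theorem exists_prefix (x : TreePoint) (n : ℕ) :
    (∃ v, x = node v) ∨ ∃ v z, v.length = n ∧ x = graft v z := by
  induction n with
  | zero => exact Or.inr ⟨[], x, rfl, rfl⟩
  | succ n ih =>
    obtain h | ⟨v, z, rfl, rfl⟩ := ih
    · exact Or.inl h
    · obtain rfl | ⟨b, z, rfl⟩ := eq_root_or_cons z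
      · exact Or.inl ⟨v, rfl⟩
      · exact Or.inr ⟨b :: v, z, rfl, rfl⟩

theorem exists_extensionGraph {g : List Bool → List Bool} (hg : (exceptions g).Finite)
    (x : TreePoint) : ∃ y, ExtensionGraph g x y := by
  obtain ⟨n, hn⟩ := ((irregular_finite hg).image List.length).bddAbove
  -- `n` bounds the lengths of irregular vertices, so any vertex of length `n + 1` is regular.
  obtain ⟨v, rfl⟩ | ⟨v, z, hv, rfl⟩ := exists_prefix x (n + 1)
  · exact ⟨_, Or.inl ⟨v, rfl, rfl⟩⟩
  · refine ⟨_, Or.inr ⟨v, fun hi => ?_, z, rfl, rfl⟩⟩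
    have := hn ⟨v, hi, rfl⟩
    omega

/-- Two descriptions of a point are related by a path `s` from one vertex to the other, and `g`
respects `s` below a regular vertex. -/
theorem ExtensionGraph.unique {g : List Bool → List Bool} {x y y' : TreePoint}
    (h : ExtensionGraph g x y) (h' : ExtensionGraph g x y') : y = y' := by
  obtain ⟨v, rfl, rfl⟩ | ⟨v, hv, z, rfl, rfl⟩ := h <;>
    obtain ⟨v', e, rfl⟩ | ⟨v', hv', z', e, rfl⟩ := h'
  · rw [node_injective e]
  · obtain ⟨s, rfl, rfl⟩ := node_eq_graft e
    rw [graft_node, notMem_irregular.1 hv']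
  · obtain ⟨s, rfl, rfl⟩ := node_eq_graft e.symm
    rw [graft_node, notMem_irregular.1 hv]
  · obtain ⟨s, rfl, rfl⟩ | ⟨s, rfl, rfl⟩ := graft_eq_graft e
    · rw [notMem_irregular.1 hv', graft_append]
    · rw [notMem_irregular.1 hv, graft_append]

theorem ExtensionGraph.symm {g : Equiv.Perm (List Bool)} {x y : TreePoint}
    (h : ExtensionGraph g x y) : ExtensionGraph g.symm y x := by
  obtain ⟨v, rfl, rfl⟩ | ⟨v, hv, z, rfl, rfl⟩ := h
  · exact Or.inl ⟨g v, rfl, by simp⟩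
  · exact Or.inr ⟨g v, notMem_irregular_inv (notMem_irregular.1 hv), z, rfl, by simp⟩

/-- The extension of a quasi-automorphism to the ends of the tree. -/
noncomputable def extend {g : List Bool → List Bool} (hg : (exceptions g).Finite)
    (x : TreePoint) : TreePoint := (exists_extensionGraph hg x).choose

theorem extensionGraph_extend {g : List Bool → List Bool} (hg : (exceptions g).Finite)
    (x : TreePoint) : ExtensionGraph g x (extend hg x) := (exists_extensionGraph hg x).choose_spec

theorem extend_node {g : List Bool → List Bool} (hg : (exceptions g).Finite) (v : List Bool) :
    extend hg (node v) = node (g v) :=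
  (extensionGraph_extend hg _).unique (Or.inl ⟨v, rfl, rfl⟩)

theorem extend_graft {g : List Bool → List Bool} (hg : (exceptions g).Finite) {v : List Bool}
    (hv : v ∉ irregular g) (z : TreePoint) : extend hg (graft v z) = graft (g v) z :=
  (extensionGraph_extend hg _).unique (Or.inr ⟨v, hv, z, rfl, rfl⟩)

theorem extend_symm_extend {g : Equiv.Perm (List Bool)} (hg : (exceptions g).Finite)
    (hg' : (exceptions g.symm).Finite) (x : TreePoint) : extend hg' (extend hg x) = x :=
  (extensionGraph_extend hg' _).unique (extensionGraph_extend hg x).symm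

/-- Every point lies in a ball on which the extension is in the similarity structure. -/
theorem extend_locallyDetermined {g : List Bool → List Bool} (hg : (exceptions g).Finite)
    (x : TreePoint) : ∃ B B' : Ball TreePoint, x ∈ B.1 ∧ ∃ σ ∈ similarityStructure.sim B B',
      ∀ y : B.1, extend hg y = (σ y).1 := by
  obtain ⟨v, rfl, -⟩ | ⟨v, hv, z, rfl, -⟩ := extensionGraph_extend hg x
  · refine ⟨nodeBall v, nodeBall (g v), rfl,
      Equiv.ofUnique ({node v} : Set TreePoint) ({node (g v)} : Set TreePoint),
      ⟨v, g v, Or.inr ⟨rfl, rfl⟩⟩, ?_⟩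
    rintro ⟨_, rfl⟩
    exact extend_node hg v
  · let σ : cone v ≃ cone (g v) := (Equiv.ofInjective _ (graft_injective v)).symm.trans
      (Equiv.ofInjective _ (graft_injective (g v)))
    have hσ : ∀ (y : cone v) z, y.1 = graft v z → (σ y).1 = graft (g v) z := by
      rintro ⟨_, h⟩ z rfl
      have : σ ⟨graft v z, h⟩ = Equiv.ofInjective _ (graft_injective (g v)) z :=
        congrArg (Equiv.ofInjective _ (graft_injective (g v)))
          (Equiv.ofInjective_symm_apply (graft_injective v) z)
      rw [this]
      rfl
    refine ⟨coneBall v, coneBall (g v), ⟨z, rfl⟩, σ, ⟨v, g v, Or.inl ⟨rfl, rfl, hσ⟩⟩, ?_⟩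
    rintro ⟨_, z, rfl⟩
    exact (extend_graft hg hv z).trans (hσ ⟨_, z, rfl⟩ z rfl).symm

/-- Around every point the extension is a similarity on an open ball, hence Lipschitz there. -/
theorem continuous_extend {g : List Bool → List Bool} (hg : (exceptions g).Finite) :
    Continuous (extend hg) := by
  refine continuous_iff_continuousAt.2 fun x => ?_
  obtain ⟨B, B', hx, σ, hσ, h⟩ := extend_locallyDetermined hg x
  obtain ⟨C, -, hd⟩ := similarityStructure.similarity _ _ σ hσ
  obtain ⟨r, hr, hball⟩ := Metric.isOpen_iff.1 (isOpen_ball B) x hx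
  refine continuousAt_of_locally_lipschitz hr C fun y hy => ?_
  have := hd ⟨y, hball hy⟩ ⟨x, hx⟩
  rw [Subtype.dist_eq, Subtype.dist_eq, ← h, ← h] at this
  exact this.le

theorem groupToQAut_surjective : Function.Surjective groupToQAut := by
  rintro ⟨g, hg⟩
  have h1 := (mem_QAut_iff g).1 hg
  have h2 : (exceptions g.symm).Finite := (mem_QAut_iff g⁻¹).1 (QAut.inv_mem hg)
  let H : TreePoint ≃ₜ TreePoint :=
    { toFun := extend h1
      invFun := extend h2
      left_inv := extend_symm_extend h1 h2
      right_inv := extend_symm_extend (g := g.symm) h2 h1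
      continuous_toFun := continuous_extend h1
      continuous_invFun := continuous_extend h2 }
  have hH : H ∈ similarityStructure.group := extend_locallyDetermined h1
  refine ⟨⟨H, hH⟩, Subtype.ext (Equiv.ext fun v => node_injective ?_)⟩
  exact (node_vertexMap ⟨H, hH⟩ v).trans (extend_node h1 v)

end TreePoint

/-! ### The presentation is tree-like, and the three statements together -/

theorem treePresentation_isTreeLike : treePresentation.IsTreeLike := by
  constructor
  · rintro _ rfl
    exact ⟨rfl, by simp⟩
  · intro l w₁ w₂ h₁ h₂
    exact (Prod.mk.inj h₁).2.trans (Prod.mk.inj h₂).2.symm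

theorem mainTheorem3 :
    Nonempty (QAut ≃* BraidedDiagramGroup treePresentation [Letter.x]) ∧
    treePresentation.IsTreeLike ∧
    ∃ (X : Type) (_ : MetricSpace X) (_ : IsUltrametricDist X) (_ : CompactSpace X)
      (S : FiniteSimilarityStructure X), S.IsSmall ∧ Nonempty (QAut ≃* S.group) :=
  ⟨⟨(MulEquiv.ofBijective diagramGroupToQAut diagramGroupToQAut_bijective).symm⟩,
    treePresentation_isTreeLike, TreePoint, inferInstance, inferInstance, inferInstance,
    TreePoint.similarityStructure, TreePoint.similarityStructure_isSmall,
    ⟨(MulEquiv.ofBijective TreePoint.groupToQAut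
      ⟨TreePoint.groupToQAut_injective, TreePoint.groupToQAut_surjective⟩).symm⟩⟩
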